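/- **Characterization of the finite-transmission feedback information (FTFI) capacity of the Gaussian linear channel.** Let $n,p,q\in\mathbb N$, $\kappa\in[0,\infty)$. Consider the channel with inputs $A_i\in\mathbb R^q$ and outputs $B_i\in\mathbb R^p$, $$B_i=\sum_{j=0}^{i-1}C_{i,j}B_j+D_{i,i}A_i+V_i,\qquad i=0,\dots,n,$$ where $C_{i,j}\in\mathbb R^{p\times p}$, $D_{i,i}\in\mathbb R^{p\times q}$, $V_i\sim N(0,K_{V_i})$ with $K_{V_i}\succ0$, and $V_i$ is independent of $(V^{i-1},A^i)$; here $X^i=(X_0,\dots,X_i)$. Let $R_{i,i}\succ 0$ be $q\times q$, and let $Q_i(i-1)\succeq 0$ be $ip\times ip$. A channel input distribution is a sequence of stochastic kernels $P_i(da_i\mid a^{i-1},b^{i-1})$, $i=0,\dots,n$; together with the channel it determines the law of $(A^n,B^n)$. It is *feasible* if $$\frac1{n+1}\sum_{i=0}^n\mathbf E\big\{\langle A_i,R_{i,i}A_i\rangle+\langle B^{i-1},Q_i(i-1)B^{i-1}\rangle\big\}\le\kappa .$$ The FTFI capacity $C(\kappa)$ is the supremum of the directed information $I(A^n\to B^n)=\sum_{i=0}^n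 I(A^i;B_i\mid B^{i-1})$ over all feasible channel input distributions (with $\sup\varnothing=-\infty$). $H$ denotes (conditional) differential entropy, and logarithms are natural. Then the following hold. (a) Let $\mathcal P^g(\kappa)$ be the set of feasible input distributions of the form $\pi_i(da_i\mid b^{i-1})$ for which $\{(A_i,B_i)\}_{i=0}^n$ is jointly Gaussian. The entropies $H(V^n)$, and $H(B^n)$ for elements of $\mathcal P^g(\kappa)$, are well defined, and $$C(\kappa)=\sup_{\mathcal P^g(\kappa)}\{H(B^n)-H(V^n)\}.$$ The optimal channel input distribution is Gaussian in the following sense. If some input distribution is feasible, then the supremum defining $C(\kappa)$ is attained by an input distribution of the linear Gaussian form described in (b). Moreover, for every feasible input distribution attaining $C(\kappa)$ there is a feasible one of that form, also attaining $C(\kappa)$, which gives the same law of $B^n$ and, for each $i$, the same law of $(B^{i-1},D_{i,i}A_i)$. (b) For matrices $\Gamma_{i,j}\in\mathbb R^{q\times p}$ $(0\le j<i\le n)$ and $q\times q$ matrices $K_{Z_i}\succeq0$ $(0\le i\le n)$, consider the input distribution $$\pi_i(\cdot\mid b^{i-1})=N\Big(\sum_{j<i}\Gamma_{i,j}b_j,\;K_{Z_i}\Big).$$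 It makes $\{(A_i,B_i)\}_{i=0}^n$ jointly Gaussian, and the law of this process is realized, on some probability space, by $$A_i^g=\sum_{j<i}\Gamma_{i,j}B_j^g+Z_i,\qquad B_i^g=\sum_{j<i}C_{i,j}B^g_j+D_{i,i}A_i^g+V_i,$$ where $\{Z_i\}$ is an independent process with $Z_i\sim N(0,K_{Z_i})$, $Z_i$ is independent of $(A^{g,i-1},B^{g,i-1})$, $Z^n$ is independent of $V^n$, $V_i\sim N(0,K_{V_i})$, and $V_i$ is independent of $(V^{i-1},A^{g,i})$. The entropies below are well defined, and $$I(A^{g,n}\to B^{g,n})=H(B^{g,n})-H(V^n)=\sum_{i=0}^nH(B^g_i\mid B^{g,i-1})-H(V^n)=\frac12\sum_{i=0}^n\log\frac{|D_{i,i}K_{Z_i}D_{i,i}^T+K_{V_i}|}{|K_{V_i}|}.$$ Consequently $$C(\kappa)=\sup_{(\Gamma,K_Z)}\{H(B^{g,n})-H(V^n)\}=\sup_{(\Gamma,K_Z)}\ \frac12\sum_{i=0}^n\log\frac{|D_{i,i}K_{Z_i}D_{i,i}^T+K_{V_i}|}{|K_{V_i}|},$$ the suprema being over all $(\Gamma,K_Z)$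 with $\frac1{n+1}\sum_{i=0}^n\mathbf E\{\langle A_i^g,R_{i,i}A_i^g\rangle+\langle B^{g,i-1},Q_i(i-1)B^{g,i-1}\rangle\}\le\kappa$. -/

import Mathlib

open MeasureTheory ProbabilityTheory Matrix
open scoped ENNReal NNReal

noncomputable section

namespace FeedbackCapacity

/-- Euclidean space of column vectors with `d` real entries. -/
abbrev Vec (d : ℕ) : Type := EuclideanSpace ℝ (Fin d)

/-- The matrix-vector product, as a map between Euclidean spaces. -/
def mulVecE {a b : ℕ} (M : Matrix (Fin a) (Fin b) ℝ) (x : Vec b) : Vec a :=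
  WithLp.toLp 2 (M *ᵥ x.ofLp)

theorem measurable_mulVecE {a b : ℕ} (M : Matrix (Fin a) (Fin b) ℝ) :
    Measurable (mulVecE M) :=
  (LinearMap.continuous_of_finiteDimensional (Matrix.toEuclideanLin M)).measurable

/-! ### Information measures -/

section Information

variable {Ω E F G : Type*} [MeasurableSpace Ω] [MeasurableSpace E] [MeasurableSpace F]
  [MeasurableSpace G]

/-- Conditional mutual information `I(U; X | W)`: the relative entropy of the law of `(W, U, X)`
with respect to `P_W ⊗ P_{U|W} ⊗ P_{X|W} = P_{W,U} ⊗ P_{X|W}`. -/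
def condMutualInfo [StandardBorelSpace G] [Nonempty G] (μ : Measure Ω) [IsFiniteMeasure μ]
    (U : Ω → E) (X : Ω → G) (W : Ω → F) : ℝ≥0∞ :=
  InformationTheory.klDiv (μ.map fun ω => ((W ω, U ω), X ω))
    ((μ.map fun ω => (W ω, U ω)) ⊗ₘ (condDistrib X W μ).comap Prod.fst measurable_fst)

/-- Differential entropy (in nats) of a law `ν` with density `f` with respect to Lebesgue measure:
`H(ν) = -∫ log f dν`. It is meaningful when `HasDiffEntropy ν` holds. -/
def diffEntropy {E : Type*} [MeasureSpace E] (ν : Measure E) : ℝ :=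
  -∫ x, Real.log (ν.rnDeriv volume x).toReal ∂ν

/-- `ν` has a density with respect to Lebesgue measure and its differential entropy is a
convergent integral. -/
def HasDiffEntropy {E : Type*} [MeasureSpace E] (ν : Measure E) : Prop :=
  ν ≪ volume ∧ Integrable (fun x => Real.log (ν.rnDeriv volume x).toReal) ν

/-- Conditional differential entropy `H(X | W) = ∫ H(P_{X|W=w}) P_W(dw)`. It is meaningful when
`HasCondDiffEntropy μ X W` holds. -/
def condDiffEntropy {G : Type*} [MeasureSpace G] [StandardBorelSpace G] [Nonempty G]
    (μ : Measure Ω) [IsFiniteMeasure μ] (X : Ω → G) (W : Ω → F) : ℝ :=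
  ∫ w, diffEntropy (condDistrib X W μ w) ∂(μ.map W)

/-- Almost all conditional laws of `X` given `W` have a differential entropy, and these
entropies are integrable. -/
def HasCondDiffEntropy {G : Type*} [MeasureSpace G] [StandardBorelSpace G] [Nonempty G]
    (μ : Measure Ω) [IsFiniteMeasure μ] (X : Ω → G) (W : Ω → F) : Prop :=
  (∀ᵐ w ∂(μ.map W), HasDiffEntropy (condDistrib X W μ w)) ∧
    Integrable (fun w => diffEntropy (condDistrib X W μ w)) (μ.map W)

end Information

/-! ### Trajectories of channel inputs and outputs -/

/-- Trajectories `((a_0, b_0), …, (a_{k-1}, b_{k-1}))` of `k` inputs in `ℝ^q` and `k` outputs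
in `ℝ^p`. -/
abbrev Path (p q k : ℕ) : Type := Fin k → Vec q × Vec p

variable {p q : ℕ}

/-- The output trajectory. -/
def outputs {k : ℕ} (ω : Path p q k) : Fin k → Vec p := fun j => (ω j).2

/-- `A_i`. -/
def inputAt {k : ℕ} (i : Fin k) (ω : Path p q k) : Vec q := (ω i).1

/-- `B_i`. -/
def outputAt {k : ℕ} (i : Fin k) (ω : Path p q k) : Vec p := (ω i).2

/-- `B^{i-1} = (B_0, …, B_{i-1})`. -/
def outputsBefore {k : ℕ} (i : Fin k) (ω : Path p q k) : Fin i → Vec p :=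
  fun j => (ω (j.castLE i.isLt.le)).2

/-- `A^i = (A_0, …, A_i)`. -/
def inputsUpTo {k : ℕ} (i : Fin k) (ω : Path p q k) : Fin (i + 1) → Vec q :=
  fun j => (ω (j.castLE i.isLt)).1

/-! ### The channel -/

/-- Data of the Gaussian linear channel with memory
`B_i = ∑_{j < i} C_{i,j} B_j + D_{i,i} A_i + V_i`, `V_i ∼ N(0, K_{V_i})`, with the quadratic cost
`⟨A_i, R_{i,i} A_i⟩ + ⟨B^{i-1}, Q_i(i-1) B^{i-1}⟩`. Coefficients are given for all times; for a
horizon `n` only those with `i ≤ n` are used. -/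
structure GaussianChannel (p q : ℕ) where
  C : (i : ℕ) → Fin i → Matrix (Fin p) (Fin p) ℝ
  D : ℕ → Matrix (Fin p) (Fin q) ℝ
  KV : ℕ → Matrix (Fin p) (Fin p) ℝ
  R : ℕ → Matrix (Fin q) (Fin q) ℝ
  Q : (i : ℕ) → Matrix (Fin i × Fin p) (Fin i × Fin p) ℝ
  posDef_KV : ∀ i, (KV i).PosDef
  posDef_R : ∀ i, (R i).PosDef
  posSemidef_Q : ∀ i, (Q i).PosSemidef

namespace GaussianChannel

variable (ch : GaussianChannel p q)

/-- One step of the channel recursion: `∑_{j < i} C_{i,j} b_j + D_{i,i} a + v`. -/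
def step (i : ℕ) (b : Fin i → Vec p) (a : Vec q) (v : Vec p) : Vec p :=
  ∑ j, mulVecE (ch.C i j) (b j) + mulVecE (ch.D i) a + v

theorem measurable_step (i : ℕ) :
    Measurable fun x : (Path p q i × Vec q) × Vec p =>
      ch.step i (outputs x.1.1) x.1.2 x.2 := by
  unfold step outputs
  refine Measurable.add (Measurable.add (Finset.measurable_sum _ fun j _ => ?_) ?_) (by fun_prop)
  · exact (measurable_mulVecE _).comp (by fun_prop)
  · exact (measurable_mulVecE _).comp (by fun_prop)

/-- The channel distribution `Q_i(db_i | b^{i-1}, a_i)`: the law of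
`∑_{j < i} C_{i,j} b_j + D_{i,i} a_i + V_i` with `V_i ∼ N(0, K_{V_i})`. -/
def kernel (i : ℕ) : Kernel (Path p q i × Vec q) (Vec p) :=
  (Kernel.id ×ₖ Kernel.const _ (multivariateGaussian 0 (ch.KV i))).map
    fun x => ch.step i (outputs x.1.1) x.1.2 x.2

instance (i : ℕ) : IsMarkovKernel (ch.kernel i) :=
  Kernel.IsMarkovKernel.map _ (ch.measurable_step i)

/-- The law of the noise trajectory `V^n = (V_0, …, V_n)`. -/
def noiseLaw (n : ℕ) : Measure (Fin (n + 1) → Vec p) :=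
  Measure.pi fun i => multivariateGaussian 0 (ch.KV i)

end GaussianChannel

/-! ### Channel input distributions with feedback -/

/-- Channel input distributions with feedback `P_i(da_i | a^{i-1}, b^{i-1})`. -/
structure InputPolicy (p q : ℕ) where
  kernel : (i : ℕ) → Kernel (Path p q i) (Vec q)
  markov : ∀ i, IsMarkovKernel (kernel i)

namespace InputPolicy

instance (P : InputPolicy p q) (i : ℕ) : IsMarkovKernel (P.kernel i) := P.markov i

/-- The policy is of the form `π_i(da_i | b^{i-1})`, i.e. it does not use the past inputs. -/
def OutputOnly (P : InputPolicy p q) : Prop :=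
  ∀ (i : ℕ) (h h' : Path p q i), outputs h = outputs h' → P.kernel i h = P.kernel i h'

end InputPolicy

namespace GaussianChannel

variable (ch : GaussianChannel p q)

/-- The joint law of `(A_0, B_0), …, (A_{k-1}, B_{k-1})` when the input distributions `P` are used
over the channel. -/
def jointLaw (P : InputPolicy p q) : (k : ℕ) → Measure (Path p q k)
  | 0 => Measure.dirac Fin.elim0
  | k + 1 => (jointLaw P k ⊗ₘ (P.kernel k ⊗ₖ ch.kernel k)).map
      fun x => (Fin.snoc x.1 x.2 : Path p q (k + 1))

theorem measurable_snoc (k : ℕ) :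
    Measurable fun x : Path p q k × (Vec q × Vec p) => (Fin.snoc x.1 x.2 : Path p q (k + 1)) := by
  refine measurable_pi_lambda _ fun j => ?_
  induction j using Fin.lastCases with
  | last => simpa using measurable_snd
  | cast j =>
    simp only [Fin.snoc_castSucc]
    exact (measurable_pi_apply j).comp measurable_fst

instance (P : InputPolicy p q) (k : ℕ) : IsProbabilityMeasure (ch.jointLaw P k) := by
  induction k with
  | zero => unfold jointLaw; infer_instance
  | succ k ih =>
    unfold jointLaw
    exact Measure.isProbabilityMeasure_map (measurable_snoc k).aemeasurable

/-- The law of `B^n`. -/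
def outputLaw (P : InputPolicy p q) (n : ℕ) : Measure (Fin (n + 1) → Vec p) :=
  (ch.jointLaw P (n + 1)).map outputs

/-- Directed information `I(A^n → B^n) = ∑_{i=0}^n I(A^i; B_i | B^{i-1})`. -/
def directedInfo (P : InputPolicy p q) (n : ℕ) : ℝ≥0∞ :=
  ∑ i : Fin (n + 1),
    condMutualInfo (ch.jointLaw P (n + 1)) (inputsUpTo i) (outputAt i) (outputsBefore i)

/-- The instantaneous cost `⟨a, R_{i,i} a⟩ + ⟨b^{i-1}, Q_i(i-1) b^{i-1}⟩`. -/
def stageCost (i : ℕ) (a : Vec q) (b : Fin i → Vec p) : ℝ :=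
  a.ofLp ⬝ᵥ ch.R i *ᵥ a.ofLp +
    (fun jl : Fin i × Fin p => b jl.1 jl.2) ⬝ᵥ ch.Q i *ᵥ fun jl => b jl.1 jl.2

/-- The average cost `1/(n+1) ∑_{i=0}^n E(⟨A_i, R_{i,i} A_i⟩ + ⟨B^{i-1}, Q_i(i-1) B^{i-1}⟩)`
(the integrand is nonnegative, the value may be infinite). -/
def avgCost (P : InputPolicy p q) (n : ℕ) : ℝ≥0∞ :=
  ((n : ℝ≥0∞) + 1)⁻¹ * ∑ i : Fin (n + 1),
    ∫⁻ ω, ENNReal.ofReal (ch.stageCost i (inputAt i ω) (outputsBefore i ω))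
      ∂(ch.jointLaw P (n + 1))

/-- The set of all input distributions with feedback whose average cost is at most `κ`. -/
def feasible (n : ℕ) (κ : ℝ≥0) : Set (InputPolicy p q) :=
  {P | ch.avgCost P n ≤ κ}

/-- The FTFI capacity: the supremum of directed information over all input distributions
`P_i(da_i | a^{i-1}, b^{i-1})` satisfying the cost constraint (`-∞` if there are none). -/
def capacity (n : ℕ) (κ : ℝ≥0) : EReal :=
  ⨆ P ∈ ch.feasible n κ, (ch.directedInfo P n : EReal)

/-- The Gaussian input distributions `π^g_i(da_i | b^{i-1})` satisfying the cost constraint: those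
for which the process `{(A_i, B_i) : i = 0, …, n}` is jointly Gaussian. -/
def gaussianFeasible (n : ℕ) (κ : ℝ≥0) : Set (InputPolicy p q) :=
  {P | P ∈ ch.feasible n κ ∧ P.OutputOnly ∧ IsGaussian (ch.jointLaw P (n + 1))}

end GaussianChannel

/-! ### Linear Gaussian strategies `A_i = Γ_i(i-1) B^{i-1} + Z_i` -/

/-- Gains `Γ_{i,j}`, `j < i`, and innovations covariances `K_{Z_i} ⪰ 0`. Only those with
`i ≤ n` are used on the horizon `n`. -/
structure LinearStrategy (p q : ℕ) where
  Γ : (i : ℕ) → Fin i → Matrix (Fin q) (Fin p) ℝ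
  KZ : ℕ → Matrix (Fin q) (Fin q) ℝ
  posSemidef_KZ : ∀ i, (KZ i).PosSemidef

namespace LinearStrategy

variable (θ : LinearStrategy p q)

/-- `∑_{j < i} Γ_{i,j} b_j + z`. -/
def step (i : ℕ) (b : Fin i → Vec p) (z : Vec q) : Vec q :=
  ∑ j, mulVecE (θ.Γ i j) (b j) + z

theorem measurable_step (i : ℕ) :
    Measurable fun x : Path p q i × Vec q => θ.step i (outputs x.1) x.2 := by
  unfold step outputs
  refine Measurable.add (Finset.measurable_sum _ fun j _ => ?_) (by fun_prop)
  exact (measurable_mulVecE _).comp (by fun_prop)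

/-- The input distribution `π_i(da_i | b^{i-1})` of `∑_{j < i} Γ_{i,j} b_j + Z_i` with
`Z_i ∼ N(0, K_{Z_i})`. -/
def policy : InputPolicy p q where
  kernel i := (Kernel.id ×ₖ Kernel.const _ (multivariateGaussian 0 (θ.KZ i))).map
    fun x => θ.step i (outputs x.1) x.2
  markov i := Kernel.IsMarkovKernel.map _ (θ.measurable_step i)

/-- `(1/2) ∑_{i=0}^n log (|D_{i,i} K_{Z_i} D_{i,i}ᵀ + K_{V_i}| / |K_{V_i}|)`. -/
def logDetRate (ch : GaussianChannel p q) (n : ℕ) : ℝ :=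
  (1 / 2) * ∑ i ∈ Finset.range (n + 1),
    Real.log ((ch.D i * θ.KZ i * (ch.D i)ᵀ + ch.KV i).det / (ch.KV i).det)

/-- On a probability space, the random variables `Z_i, V_i, A_i, B_i`, `0 ≤ i ≤ n`, realize the
strategy `θ` over the channel `ch`. -/
structure IsRealization (ch : GaussianChannel p q) (n : ℕ) {Ω : Type*} [MeasurableSpace Ω]
    (μ : Measure Ω) (Z A : Fin (n + 1) → Ω → Vec q) (V B : Fin (n + 1) → Ω → Vec p) : Prop where
  isProbability : IsProbabilityMeasure μ
  law_Z : ∀ i, HasLaw (Z i) (multivariateGaussian 0 (θ.KZ i)) μ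
  law_V : ∀ i, HasLaw (V i) (multivariateGaussian 0 (ch.KV i)) μ
  /-- `{Z_i}` is an independent process -/
  indep_Z : iIndepFun Z μ
  /-- `Z^n` is independent of `V^n` -/
  indep_Z_V : IndepFun (fun ω i => Z i ω) (fun ω i => V i ω) μ
  /-- `Z_i` is independent of `(A^{i-1}, B^{i-1})` -/
  indep_Z_past : ∀ i : Fin (n + 1), IndepFun (Z i)
    (fun ω (j : Fin i) => (A (j.castLE i.isLt.le) ω, B (j.castLE i.isLt.le) ω)) μ
  /-- `V_i` is independent of `(V^{i-1}, A^i)` -/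
  indep_V_past : ∀ i : Fin (n + 1), IndepFun (V i)
    (fun ω => (fun j : Fin i => V (j.castLE i.isLt.le) ω,
      fun j : Fin (i + 1) => A (j.castLE i.isLt) ω)) μ
  /-- `A_i = ∑_{j < i} Γ_{i,j} B_j + Z_i` -/
  input_eq : ∀ i ω, A i ω = θ.step i (fun j => B (j.castLE i.isLt.le) ω) (Z i ω)
  /-- `B_i = ∑_{j < i} C_{i,j} B_j + D_{i,i} A_i + V_i` -/
  output_eq : ∀ i ω, B i ω = ch.step i (fun j => B (j.castLE i.isLt.le) ω) (A i ω) (V i ω)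

/-- The pairs `(Γ, K_Z)` satisfying the cost constraint. -/
def feasible (ch : GaussianChannel p q) (n : ℕ) (κ : ℝ≥0) : Set (LinearStrategy p q) :=
  {θ | ch.avgCost θ.policy n ≤ κ}

end LinearStrategy

end FeedbackCapacity

end

open FeedbackCapacity

/-! An arbitrary feasible input distribution P is compared with the linear Gaussian one that has the
same second moments. Since R_{i,i} is positive definite, finite cost puts the inputs in L², and the
channel recursion then puts the outputs in L². Projecting A_i orthogonally onto the span of the
coordinates of B^{i-1} gives the gains Γ_i, and the second-moment matrix of the residual is K_{Z_i}.
The recursion determines all output second moments from (Γ, K_Z), so this strategy θ has the same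
quadratic cost as P (`GaussianChannel.exists_matches`, `LinearStrategy.Matches.avgCost_eq`).

Let γ_i be the conditional law of B_i given B^{i-1} under θ: Gaussian, with covariance Σ_i = D K_Z
Dᵀ + K_V. The divergence, under P, of the law of (B^{i-1}, A^i, B_i) from P_{B^{i-1},A^i} ⊗ γ_i is
computed in two ways. The log-likelihood ratio is a constant plus two quadratic terms of mean p that
cancel, so the divergence is (1/2) log(|Σ_i|/|K_{V_i}|), although P need not be Gaussian
(`klDiv_compProd_addNoise_gaussian`). By the chain rule it is also I(A^i; B_i | B^{i-1}) plus the
divergence of P_{B^{i-1},B_i} from P_{B^{i-1}} ⊗ γ_i (`klDiv_eq_condMutualInfo_add`). Summed over i,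
this gives the central identity KL(P_{B^n} ‖ P^θ_{B^n}) + I(A^n → B^n) = (1/2) ∑
log(|Σ_i|/|K_{V_i}|) (`LinearStrategy.Matches.klDiv_add_directedInfo`).

It yields the upper bound, the value for θ itself, and rigidity: for an optimal P the divergence
vanishes, so the output laws agree, and the law of (B^{i-1}, D_{i,i} A_i) follows by deconvolving
the Gaussian noise. The log-density of P^θ_{B^n} is quadratic, so H(B^n) under P is its value under
θ minus the same divergence; this gives the entropy formulas.

For attainment, rate and cost are continuous in (Γ, K_Z). Positive definiteness of K_V bounds output
moments from below, so the bounded input energy confines the gains to a compact set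
(`LinearStrategy.exists_isMaxOn_logDetRate`). -/

namespace FeedbackCapacity

/-! ### Lebesgue densities of nondegenerate Gaussian laws. -/

section GaussianDensity

variable {d : ℕ}

/-- The density of the centered Gaussian law with covariance matrix `S` on `ℝ^d`. -/
noncomputable def gaussDensity (S : Matrix (Fin d) (Fin d) ℝ) (x : Vec d) : ℝ :=
  (√((2 * Real.pi) ^ d * S.det))⁻¹ * Real.exp (-(x.ofLp ⬝ᵥ S⁻¹ *ᵥ x.ofLp) / 2)

theorem gaussDensity_pos {S : Matrix (Fin d) (Fin d) ℝ} (hS : S.PosDef) (x : Vec d) :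
    0 < gaussDensity S x := by
  have := hS.det_pos
  unfold gaussDensity
  positivity

@[fun_prop]
theorem continuous_gaussDensity (S : Matrix (Fin d) (Fin d) ℝ) : Continuous (gaussDensity S) := by
  unfold gaussDensity
  simp only [dotProduct, mulVec]
  fun_prop

theorem log_gaussDensity {S : Matrix (Fin d) (Fin d) ℝ} (hS : S.PosDef) (x : Vec d) :
    Real.log (gaussDensity S x) =
      -(Real.log ((2 * Real.pi) ^ d * S.det) / 2) - (x.ofLp ⬝ᵥ S⁻¹ *ᵥ x.ofLp) / 2 := by
  have := hS.det_pos
  unfold gaussDensity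
  rw [Real.log_mul (by positivity) (by positivity), Real.log_exp, Real.log_inv,
    Real.log_sqrt (by positivity)]
  ring

/-- Both sides are finite measures with the same characteristic function, by the Fourier transform
of the Gaussian. -/
theorem stdGaussian_eq_withDensity :
    stdGaussian (Vec d) = volume.withDensity fun x =>
      ENNReal.ofReal ((√((2 * Real.pi) ^ d))⁻¹ * Real.exp (-‖x‖ ^ 2 / 2)) := by
  have hint : Integrable (fun x : Vec d => Real.exp (-‖x‖ ^ 2 / 2)) := by
    have h := GaussianFourier.integrable_cexp_neg_mul_sq_norm_add (V := Vec d) (b := 1 / 2)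
      (by norm_num) 0 0
    refine h.norm.congr (.of_forall fun x => ?_)
    simp only [Complex.norm_exp]
    congr 1
    have : ((‖x‖ : ℂ) ^ 2).re = ‖x‖ ^ 2 := by norm_cast
    simp [this]
    ring
  have : IsFiniteMeasure ((volume : Measure (Vec d)).withDensity fun x =>
      ENNReal.ofReal ((√((2 * Real.pi) ^ d))⁻¹ * Real.exp (-‖x‖ ^ 2 / 2))) :=
    isFiniteMeasure_withDensity_ofReal (hint.const_mul _).2
  apply Measure.ext_of_charFun
  ext t
  rw [charFun_stdGaussian, charFun_apply, integral_withDensity_eq_integral_toReal_smul (by fun_prop)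
    (.of_forall fun _ => ENNReal.ofReal_lt_top)]
  have key := GaussianFourier.integral_cexp_neg_mul_sq_norm_add (V := Vec d) (b := 1 / 2)
      (by norm_num) Complex.I t
  have hc : ((Real.pi : ℂ) / (1 / 2)) ^ (Module.finrank ℝ (Vec d) / 2 : ℂ) =
      (√((2 * Real.pi) ^ d) : ℝ) := by
    rw [finrank_euclideanSpace_fin, Real.sqrt_eq_rpow, ← Real.rpow_natCast,
      ← Real.rpow_mul (by positivity), Complex.ofReal_cpow (by positivity)]
    congr 1
    · push_cast; ring
    · push_cast; ring
  rw [hc] at key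
  calc Complex.exp (-‖t‖ ^ 2 / 2)
      = ((√((2 * Real.pi) ^ d) : ℝ) : ℂ)⁻¹ * ∫ v : Vec d,
        Complex.exp (-(1 / 2) * ‖v‖ ^ 2 + Complex.I * (inner ℝ t v : ℝ)) := by
        rw [key, ← mul_assoc, inv_mul_cancel₀, one_mul]
        · congr 1
          simp
          ring
        · have : 0 < √((2 * Real.pi) ^ d) := by positivity
          exact_mod_cast this.ne'
    _ = _ := by
        rw [← integral_const_mul]
        refine integral_congr_ae (.of_forall fun v => ?_)
        simp only
        rw [ENNReal.toReal_ofReal (by positivity), Complex.real_smul, Complex.exp_add]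
        push_cast
        rw [mul_assoc, real_inner_comm, mul_comm Complex.I]
        congr 3
        ring

theorem map_withDensity_comp {α β : Type*} [MeasurableSpace α] [MeasurableSpace β]
    (μ : Measure α) {T : α → β} (hT : Measurable T) {f : β → ℝ≥0∞} (hf : Measurable f) :
    (μ.withDensity fun x => f (T x)).map T = (μ.map T).withDensity f := by
  ext s hs
  rw [Measure.map_apply hT hs, withDensity_apply _ (hT hs), withDensity_apply _ hs,
    setLIntegral_map hs hf hT]

-- The law is the image of the standard one under A = √S. This map scales Lebesgue measure by (det
-- S)^(-1/2) and turns the form of S⁻¹ into ‖x‖².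
open scoped MatrixOrder in
theorem multivariateGaussian_eq_withDensity {S : Matrix (Fin d) (Fin d) ℝ} (hS : S.PosDef) :
    multivariateGaussian 0 S = volume.withDensity fun x => ENNReal.ofReal (gaussDensity S x) := by
  have hdet := hS.det_pos
  set A := CFC.sqrt S with hA
  have hAA : A * A = S := CFC.sqrt_mul_sqrt_self _ hS.posSemidef.nonneg
  have hAdet : A.det = √S.det := by rw [hA, hS.posSemidef.det_sqrt]; simp
  have hAu : IsUnit A.det := by
    rw [hAdet, isUnit_iff_ne_zero]; positivity
  have hAT : Aᵀ = A := by
    have := (CFC.sqrt_nonneg S).isSelfAdjoint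
    simpa [IsSelfAdjoint, star_eq_conjTranspose] using this
  have hlin : (fun x : Vec d => (0 : Vec d) + toEuclideanCLM (𝕜 := ℝ) A x) =
      toEuclideanLin A := by
    ext1 x; rw [zero_add]; rfl
  have hld : LinearMap.det (toEuclideanLin A) = A.det := by
    rw [Matrix.toEuclideanLin_eq_toLin_orthonormal, LinearMap.det_toLin]
  have hmeas : Measurable (toEuclideanLin A) :=
    (LinearMap.continuous_of_finiteDimensional _).measurable
  have hvol : (volume : Measure (Vec d)).map (toEuclideanLin A) =
      ENNReal.ofReal (√S.det)⁻¹ • volume := by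
    rw [Measure.map_linearMap_addHaar_eq_smul_addHaar volume (by rw [hld]; exact hAu.ne_zero), hld,
      hAdet, abs_of_nonneg (by positivity)]
  have hnorm : ∀ x : Vec d, (toEuclideanLin A x).ofLp ⬝ᵥ S⁻¹ *ᵥ (toEuclideanLin A x).ofLp
      = ‖x‖ ^ 2 := by
    intro x
    have h1 : (toEuclideanLin A x).ofLp = A *ᵥ x.ofLp := rfl
    rw [h1, mulVec_mulVec, ← hAA, Matrix.mul_inv_rev, Matrix.mul_assoc, nonsing_inv_mul _ hAu,
      Matrix.mul_one, dotProduct_comm, dotProduct_mulVec, vecMul_mulVec, transpose_nonsing_inv, hAT,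
      nonsing_inv_mul _ hAu]
    rw [EuclideanSpace.real_norm_sq_eq]
    simp [dotProduct, sq]
  rw [multivariateGaussian, hlin, stdGaussian_eq_withDensity]
  -- The standard density is written as a function of the image point A x, so that it can be carried
  -- through the push-forward.
  have : (fun x : Vec d => ENNReal.ofReal ((√((2 * Real.pi) ^ d))⁻¹ * Real.exp (-‖x‖ ^ 2 / 2))) =
      fun x => (fun y => ENNReal.ofReal (√S.det) * ENNReal.ofReal (gaussDensity S y))
        (toEuclideanLin A x) := by
    ext x
    simp only
    rw [← ENNReal.ofReal_mul (by positivity), gaussDensity, hnorm, Real.sqrt_mul (by positivity)]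
    congr 1
    have : 0 < √S.det := by positivity
    field_simp
  rw [this, map_withDensity_comp _ hmeas
    (f := fun y => ENNReal.ofReal (√S.det) * ENNReal.ofReal (gaussDensity S y)) (by fun_prop), hvol,
    withDensity_smul_measure]
  change _ • volume.withDensity (ENNReal.ofReal (√S.det) • fun y =>
    ENNReal.ofReal (gaussDensity S y)) = _
  rw [withDensity_smul _ (by fun_prop), smul_smul, ← ENNReal.ofReal_mul (by positivity),
    inv_mul_cancel₀ (by positivity), ENNReal.ofReal_one, one_smul]

end GaussianDensity

/-! ### Kernels that add independent noise. -/

section AddNoise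

variable {α β G : Type*} [MeasurableSpace α] [MeasurableSpace β]
  [AddCommGroup G] [MeasurableSpace G] [MeasurableAdd₂ G]

/-- The kernel `x ↦ law of m x + v`, where `v` has law `ρ`. -/
noncomputable def addNoise (ρ : Measure G) (m : α → G) : Kernel α G :=
  (Kernel.id ×ₖ Kernel.const α ρ).map fun x => m x.1 + x.2

variable {ρ : Measure G} [IsProbabilityMeasure ρ] {m : α → G}

theorem measurable_add_noise (hm : Measurable m) : Measurable fun x : α × G => m x.1 + x.2 :=
  (hm.comp measurable_fst).add measurable_snd

theorem measurable_shear (hm : Measurable m) : Measurable fun x : α × G => (x.1, m x.1 + x.2) :=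
  measurable_fst.prodMk (measurable_add_noise hm)

theorem isMarkovKernel_addNoise (hm : Measurable m) : IsMarkovKernel (addNoise ρ m) :=
  Kernel.IsMarkovKernel.map _ (measurable_add_noise hm)

theorem addNoise_apply (hm : Measurable m) (x : α) :
    addNoise ρ m x = ρ.map fun v => m x + v := by
  rw [addNoise, Kernel.map_apply _ (measurable_add_noise hm), Kernel.prod_apply,
    Kernel.id_apply, Kernel.const_apply, Measure.dirac_prod,
    Measure.map_map (measurable_add_noise hm) (by fun_prop)]
  rfl

theorem addNoise_comp {g : β → α} (hg : Measurable g) (hm : Measurable m) :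
    (addNoise ρ m).comap g hg = addNoise ρ (m ∘ g) := by
  ext1 x
  rw [Kernel.comap_apply, addNoise_apply hm, addNoise_apply (hm.comp hg)]
  rfl

theorem compProd_addNoise (μ : Measure α) [SFinite μ] (hm : Measurable m) :
    μ ⊗ₘ addNoise ρ m = (μ.prod ρ).map fun x => (x.1, m x.1 + x.2) := by
  have := isMarkovKernel_addNoise (ρ := ρ) hm
  refine Measure.ext_of_lintegral _ fun f hf => ?_
  rw [Measure.lintegral_compProd hf, lintegral_map hf (measurable_shear hm),
    lintegral_prod (fun x : α × G => f (x.1, m x.1 + x.2))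
      (hf.comp (measurable_shear hm)).aemeasurable]
  refine lintegral_congr fun x => ?_
  rw [addNoise_apply hm, lintegral_map (by fun_prop) (by fun_prop)]

theorem map_compProd_comap {γ : Type*} [MeasurableSpace γ] (μ : Measure α) [SFinite μ]
    {g : α → β} (hg : Measurable g)
    (κ : Kernel β γ) [IsMarkovKernel κ] :
    (μ ⊗ₘ κ.comap g hg).map (Prod.map g id) = (μ.map g) ⊗ₘ κ := by
  refine Measure.ext_of_lintegral _ fun f hf => ?_
  rw [lintegral_map hf (by fun_prop), Measure.lintegral_compProd (by fun_prop),
    Measure.lintegral_compProd hf, lintegral_map (by fun_prop) hg]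
  rfl

/-- Data processing applied to the map and to its inverse. -/
theorem klDiv_map_measurableEquiv (μ ν : Measure α) [IsFiniteMeasure μ] [IsFiniteMeasure ν]
    (e : α ≃ᵐ β) :
    InformationTheory.klDiv (μ.map e) (ν.map e) = InformationTheory.klDiv μ ν := by
  refine le_antisymm (InformationTheory.klDiv_map_le _ _ e.measurable) ?_
  have := InformationTheory.klDiv_map_le (μ.map e) (ν.map e) e.symm.measurable
  simpa [Measure.map_map e.symm.measurable e.measurable] using this

end AddNoise

/-! ### Expectations of quadratic forms through linear functionals. -/

section SecondMoments

-- With C = √M, every expected quadratic form reduces to second moments of linear functionals. Those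
-- are the only data on which matching of moments is stated.
open scoped MatrixOrder in
theorem exists_quadForm_eq_sum_sq {ι : Type*} [Fintype ι] [DecidableEq ι] {M : Matrix ι ι ℝ}
    (hM : M.PosSemidef) :
    ∃ C : Matrix ι ι ℝ, M = Cᵀ * C ∧ ∀ y, y ⬝ᵥ M *ᵥ y = ∑ k, (C k ⬝ᵥ y) ^ 2 := by
  have hT : (CFC.sqrt M)ᵀ = CFC.sqrt M := by
    simpa [IsSelfAdjoint, star_eq_conjTranspose] using (CFC.sqrt_nonneg M).isSelfAdjoint
  have hC : M = (CFC.sqrt M)ᵀ * CFC.sqrt M := by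
    rw [hT, CFC.sqrt_mul_sqrt_self _ hM.nonneg]
  refine ⟨CFC.sqrt M, hC, fun y => ?_⟩
  generalize CFC.sqrt M = C at hC
  rw [hC, ← mulVec_mulVec, dotProduct_mulVec,
    vecMul_transpose]
  simp [dotProduct, mulVec, sq]

theorem trace_transpose_mul_self_mul {ι : Type*} [Fintype ι] (C S : Matrix ι ι ℝ) :
    (Cᵀ * C * S).trace = ∑ k, C k ⬝ᵥ S *ᵥ C k := by
  rw [Matrix.mul_assoc, trace_mul_comm, trace]
  refine Finset.sum_congr rfl fun k _ => ?_
  rw [diag_apply, Matrix.mul_assoc, Matrix.mul_apply]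
  refine Finset.sum_congr rfl fun l _ => ?_
  rw [Matrix.mul_apply]
  rfl

theorem measurable_dotProduct {Ω ι : Type*} [MeasurableSpace Ω] [Fintype ι] {y : Ω → ι → ℝ}
    (hy : Measurable y) (β : ι → ℝ) : Measurable fun ω => β ⬝ᵥ y ω := by
  unfold dotProduct; fun_prop

/-- The hypothesis says that S is the second-moment matrix of y. Working with the lower integral
avoids integrability assumptions. -/
theorem lintegral_quadForm {Ω ι : Type*} [MeasurableSpace Ω] [Fintype ι] [DecidableEq ι]
    {μ : Measure Ω} {y : Ω → ι → ℝ} (hy : Measurable y) {M S : Matrix ι ι ℝ}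
    (hM : M.PosSemidef) (hS : S.PosSemidef)
    (h : ∀ β, ∫⁻ ω, ENNReal.ofReal ((β ⬝ᵥ y ω) ^ 2) ∂μ = ENNReal.ofReal (β ⬝ᵥ S *ᵥ β)) :
    ∫⁻ ω, ENNReal.ofReal (y ω ⬝ᵥ M *ᵥ y ω) ∂μ = ENNReal.ofReal (M * S).trace := by
  obtain ⟨C, hC, hsq⟩ := exists_quadForm_eq_sum_sq hM
  simp_rw [hsq]
  rw [hC, trace_transpose_mul_self_mul, ENNReal.ofReal_sum_of_nonneg]
  · simp_rw [← h]
    rw [← lintegral_finsetSum]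
    · exact lintegral_congr fun ω => ENNReal.ofReal_sum_of_nonneg fun _ _ => sq_nonneg _
    · exact fun k _ => ((measurable_dotProduct hy _).pow_const 2).ennreal_ofReal
  · exact fun k _ => by simpa using hS.dotProduct_mulVec_nonneg (C k)

theorem lintegral_quadForm_congr {Ω Ω' ι : Type*} [MeasurableSpace Ω] [MeasurableSpace Ω']
    [Fintype ι] [DecidableEq ι]
    {μ : Measure Ω} {μ' : Measure Ω'} {y : Ω → ι → ℝ} {y' : Ω' → ι → ℝ} (hy : Measurable y)
    (hy' : Measurable y') {M : Matrix ι ι ℝ} (hM : M.PosSemidef)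
    (h : ∀ β, ∫⁻ ω, ENNReal.ofReal ((β ⬝ᵥ y ω) ^ 2) ∂μ =
      ∫⁻ ω, ENNReal.ofReal ((β ⬝ᵥ y' ω) ^ 2) ∂μ') :
    ∫⁻ ω, ENNReal.ofReal (y ω ⬝ᵥ M *ᵥ y ω) ∂μ = ∫⁻ ω, ENNReal.ofReal (y' ω ⬝ᵥ M *ᵥ y' ω) ∂μ' := by
  obtain ⟨C, -, hsq⟩ := exists_quadForm_eq_sum_sq hM
  simp_rw [hsq, ENNReal.ofReal_sum_of_nonneg fun _ _ => sq_nonneg _]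
  rw [lintegral_finsetSum, lintegral_finsetSum]
  · simp_rw [h]
  · exact fun k _ => ((measurable_dotProduct hy' _).pow_const 2).ennreal_ofReal
  · exact fun k _ => ((measurable_dotProduct hy _).pow_const 2).ennreal_ofReal

variable {d : ℕ}

theorem measurable_ofLp : Measurable fun v : Vec d => v.ofLp := by fun_prop

/-- The cross term of the expanded square vanishes because the law is centered. -/
theorem lintegral_sq_add_multivariateGaussian {K : Matrix (Fin d) (Fin d) ℝ} (hK : K.PosSemidef)
    (c : ℝ) (β : Fin d → ℝ) :
    ∫⁻ v, ENNReal.ofReal ((c + β ⬝ᵥ v.ofLp) ^ 2) ∂(multivariateGaussian 0 K) =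
      ENNReal.ofReal (c ^ 2 + β ⬝ᵥ K *ᵥ β) := by
  have hin : ∀ v : Vec d, β ⬝ᵥ v.ofLp = inner ℝ (WithLp.toLp 2 β) v := by
    intro v
    simp [PiLp.inner_apply, dotProduct, mul_comm]
  have hL2 : MemLp (fun v : Vec d => v) 2 (multivariateGaussian 0 K) := IsGaussian.memLp_two_id
  have hβ : MemLp (fun v : Vec d => β ⬝ᵥ v.ofLp) 2 (multivariateGaussian 0 K) := by
    simp_rw [hin]
    exact hL2.const_inner _
  have h1 : ∫ v : Vec d, β ⬝ᵥ v.ofLp ∂(multivariateGaussian 0 K) = 0 := by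
    simp_rw [hin]
    rw [integral_inner (hL2.integrable (by norm_num)), integral_id_multivariateGaussian,
      inner_zero_right]
  have h2 : ∫ v : Vec d, (β ⬝ᵥ v.ofLp) ^ 2 ∂(multivariateGaussian 0 K) = β ⬝ᵥ K *ᵥ β := by
    have h := covarianceBilin_multivariateGaussian (μ := 0) hK (WithLp.toLp 2 β) (WithLp.toLp 2 β)
    rw [covarianceBilin_apply hL2] at h
    simp only [integral_id_multivariateGaussian', sub_zero, ← hin] at h
    rw [← h]
    simp [sq]
  have hc : MemLp (fun v : Vec d => c + β ⬝ᵥ v.ofLp) 2 (multivariateGaussian 0 K) :=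
    (memLp_const c).add hβ
  rw [← ofReal_integral_eq_lintegral_ofReal hc.integrable_sq (.of_forall fun _ => sq_nonneg _)]
  congr 1
  have hi1 := hβ.integrable (by norm_num)
  simp_rw [add_sq]
  have hi2 : Integrable (fun v : Vec d => c ^ 2 + 2 * c * β ⬝ᵥ v.ofLp)
      (multivariateGaussian 0 K) := (integrable_const _).add (hi1.const_mul _)
  rw [integral_add hi2 hβ.integrable_sq,
    integral_add (integrable_const _) (hi1.const_mul _), integral_const_mul, h1, h2]
  simp

theorem lintegral_quadForm_multivariateGaussian {K M : Matrix (Fin d) (Fin d) ℝ}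
    (hK : K.PosSemidef) (hM : M.PosSemidef) :
    ∫⁻ v, ENNReal.ofReal (v.ofLp ⬝ᵥ M *ᵥ v.ofLp) ∂(multivariateGaussian 0 K) =
      ENNReal.ofReal (M * K).trace := by
  refine lintegral_quadForm measurable_ofLp hM hK fun β => ?_
  simpa using lintegral_sq_add_multivariateGaussian hK 0 β

end SecondMoments

/-! ### Divergence between two Gaussian channels. -/

section GaussianDivergence

variable {α : Type*} [MeasurableSpace α] {d : ℕ}

theorem measurePreserving_shear (μ : Measure α) [SFinite μ] {m : α → Vec d} (hm : Measurable m) :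
    MeasurePreserving (fun x : α × Vec d => (x.1, m x.1 + x.2)) (μ.prod volume)
      (μ.prod volume) :=
  (MeasurePreserving.id μ).skew_product (measurable_add_noise hm)
    (.of_forall fun x => map_add_left_eq_self volume (m x))

theorem compProd_addNoise_gaussian (μ : Measure α) [SFinite μ] {m : α → Vec d} (hm : Measurable m)
    {K : Matrix (Fin d) (Fin d) ℝ} (hK : K.PosDef) :
    μ ⊗ₘ addNoise (multivariateGaussian 0 K) m = (μ.prod volume).withDensity fun x =>
      ENNReal.ofReal (gaussDensity K (x.2 - m x.1)) := by
  have hg : Measurable fun x : α × Vec d => ENNReal.ofReal (gaussDensity K (x.2 - m x.1)) := by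
    have := (continuous_gaussDensity K).measurable
    fun_prop
  rw [compProd_addNoise μ hm, multivariateGaussian_eq_withDensity hK,
    prod_withDensity_right (by fun_prop), ← (measurePreserving_shear μ hm).map_eq,
    ← map_withDensity_comp _ (measurable_shear hm) hg, (measurePreserving_shear μ hm).map_eq]
  simp

theorem integrable_quadForm_of_lintegral {Ω : Type*} [MeasurableSpace Ω] {μ : Measure Ω}
    {ι : Type*} [Fintype ι] {y : Ω → ι → ℝ}
    (hy : Measurable y) {M : Matrix ι ι ℝ} (hM : M.PosSemidef) {c : ℝ}
    (h : ∫⁻ ω, ENNReal.ofReal (y ω ⬝ᵥ M *ᵥ y ω) ∂μ = ENNReal.ofReal c) :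
    Integrable (fun ω => y ω ⬝ᵥ M *ᵥ y ω) μ := by
  refine ⟨?_, ?_⟩
  · have : Measurable fun ω => y ω ⬝ᵥ M *ᵥ y ω := by
      unfold dotProduct mulVec dotProduct; fun_prop
    exact this.aestronglyMeasurable
  · rw [hasFiniteIntegral_iff_ofReal
      (.of_forall fun ω => by simpa using hM.dotProduct_mulVec_nonneg (y ω)), h]
    exact ENNReal.ofReal_lt_top

theorem integral_quadForm_of_lintegral {Ω : Type*} [MeasurableSpace Ω] {μ : Measure Ω}
    {ι : Type*} [Fintype ι] {y : Ω → ι → ℝ}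
    (hy : Measurable y) {M : Matrix ι ι ℝ} (hM : M.PosSemidef) {c : ℝ} (hc : 0 ≤ c)
    (h : ∫⁻ ω, ENNReal.ofReal (y ω ⬝ᵥ M *ᵥ y ω) ∂μ = ENNReal.ofReal c) :
    ∫ ω, y ω ⬝ᵥ M *ᵥ y ω ∂μ = c := by
  rw [integral_eq_lintegral_of_nonneg_ae
    (.of_forall fun ω => by simpa using hM.dotProduct_mulVec_nonneg (y ω))
    (integrable_quadForm_of_lintegral hy hM h).1, h, ENNReal.toReal_ofReal hc]

theorem lintegral_inv_quadForm_gaussian {K : Matrix (Fin d) (Fin d) ℝ} (hK : K.PosDef) :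
    ∫⁻ v, ENNReal.ofReal (v.ofLp ⬝ᵥ K⁻¹ *ᵥ v.ofLp) ∂(multivariateGaussian 0 K) =
      ENNReal.ofReal d := by
  rw [lintegral_quadForm_multivariateGaussian hK.posSemidef hK.inv.posSemidef,
    nonsing_inv_mul _ hK.det_pos.ne'.isUnit]
  simp

/-- The divergence between two Gaussian channels whose output covariances match on average. -/
theorem klDiv_compProd_addNoise_gaussian (μ : Measure α) [IsProbabilityMeasure μ]
    {m₁ m₂ : α → Vec d} (hm₁ : Measurable m₁) (hm₂ : Measurable m₂)
    {K₁ K₂ : Matrix (Fin d) (Fin d) ℝ} (hK₁ : K₁.PosDef) (hK₂ : K₂.PosDef)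
    (h : ∫⁻ x, ENNReal.ofReal ((m₁ x.1 + x.2 - m₂ x.1).ofLp ⬝ᵥ K₂⁻¹ *ᵥ
      (m₁ x.1 + x.2 - m₂ x.1).ofLp) ∂(μ.prod (multivariateGaussian 0 K₁)) = ENNReal.ofReal d) :
    InformationTheory.klDiv (μ ⊗ₘ addNoise (multivariateGaussian 0 K₁) m₁)
        (μ ⊗ₘ addNoise (multivariateGaussian 0 K₂) m₂) =
      ENNReal.ofReal (1 / 2 * Real.log (K₂.det / K₁.det)) ∧
    0 ≤ 1 / 2 * Real.log (K₂.det / K₁.det) := by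
  have := isMarkovKernel_addNoise (ρ := multivariateGaussian 0 K₁) hm₁
  have := isMarkovKernel_addNoise (ρ := multivariateGaussian 0 K₂) hm₂
  set M₁ := μ ⊗ₘ addNoise (multivariateGaussian 0 K₁) m₁ with hM₁
  set M₂ := μ ⊗ₘ addNoise (multivariateGaussian 0 K₂) m₂ with hM₂
  have hg₁ := (continuous_gaussDensity K₁).measurable
  have hg₂ := (continuous_gaussDensity K₂).measurable
  have hd₁ := hK₁.det_pos
  have hd₂ := hK₂.det_pos
  -- The reference density is positive, so the quotient of the two densities is the Radon-Nikodym
  -- derivative.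
  set r : α × Vec d → ℝ≥0∞ := fun x =>
    ENNReal.ofReal (gaussDensity K₁ (x.2 - m₁ x.1) / gaussDensity K₂ (x.2 - m₂ x.1)) with hr
  have hrm : Measurable r := by fun_prop
  have hM : M₁ = M₂.withDensity r := by
    rw [hM₁, hM₂, compProd_addNoise_gaussian μ hm₁ hK₁, compProd_addNoise_gaussian μ hm₂ hK₂,
      ← withDensity_mul _ (by fun_prop) hrm]
    congr 1
    ext x
    simp only [Pi.mul_apply, hr]
    rw [← ENNReal.ofReal_mul (gaussDensity_pos hK₂ _).le,
      mul_div_cancel₀ _ (gaussDensity_pos hK₂ _).ne']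
  have hac : M₁ ≪ M₂ := hM ▸ withDensity_absolutelyContinuous _ _
  -- The factors (2π)^d cancel in the log-likelihood ratio. Each quadratic form has mean d under
  -- `M₁`, the first by direct computation and the second by `h`, so only the determinants survive
  -- integration.
  set L : α × Vec d → ℝ := fun x => 1 / 2 * Real.log (K₂.det / K₁.det)
    - 1 / 2 * ((x.2 - m₁ x.1).ofLp ⬝ᵥ K₁⁻¹ *ᵥ (x.2 - m₁ x.1).ofLp)
    + 1 / 2 * ((x.2 - m₂ x.1).ofLp ⬝ᵥ K₂⁻¹ *ᵥ (x.2 - m₂ x.1).ofLp) with hL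
  have hllr : llr M₁ M₂ =ᵐ[M₁] L := by
    have h1 : M₁.rnDeriv M₂ =ᵐ[M₁] r := by
      refine hac.ae_le ?_
      rw [hM]
      exact Measure.rnDeriv_withDensity M₂ hrm
    filter_upwards [h1] with x hx
    have hp₁ := gaussDensity_pos hK₁ (x.2 - m₁ x.1)
    have hp₂ := gaussDensity_pos hK₂ (x.2 - m₂ x.1)
    rw [llr, hx, hr, ENNReal.toReal_ofReal (by positivity), Real.log_div hp₁.ne' hp₂.ne',
      log_gaussDensity hK₁, log_gaussDensity hK₂, hL, Real.log_div hd₂.ne' hd₁.ne',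
      Real.log_mul (by positivity) hd₁.ne', Real.log_mul (by positivity) hd₂.ne']
    ring
  have hq₁ : ∫⁻ x, ENNReal.ofReal ((x.2 - m₁ x.1).ofLp ⬝ᵥ K₁⁻¹ *ᵥ (x.2 - m₁ x.1).ofLp) ∂M₁ =
      ENNReal.ofReal d := by
    rw [hM₁, compProd_addNoise μ hm₁, lintegral_map _ (measurable_shear hm₁)]
    · simp only [add_sub_cancel_left]
      rw [lintegral_prod]
      · simp only [lintegral_const, measure_univ, mul_one]
        exact lintegral_inv_quadForm_gaussian hK₁
      · simp only [dotProduct, mulVec]; fun_prop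
    · simp only [dotProduct, mulVec]; fun_prop
  have hq₂ : ∫⁻ x, ENNReal.ofReal ((x.2 - m₂ x.1).ofLp ⬝ᵥ K₂⁻¹ *ᵥ (x.2 - m₂ x.1).ofLp) ∂M₁ =
      ENNReal.ofReal d := by
    rw [hM₁, compProd_addNoise μ hm₁, lintegral_map _ (measurable_shear hm₁)]
    · exact h
    · simp only [dotProduct, mulVec]; fun_prop
  have hy₁ : Measurable fun x : α × Vec d => (x.2 - m₁ x.1).ofLp := by fun_prop
  have hy₂ : Measurable fun x : α × Vec d => (x.2 - m₂ x.1).ofLp := by fun_prop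
  have hi₁ := integrable_quadForm_of_lintegral hy₁ hK₁.inv.posSemidef hq₁
  have hi₂ := integrable_quadForm_of_lintegral hy₂ hK₂.inv.posSemidef hq₂
  have hv₁ := integral_quadForm_of_lintegral hy₁ hK₁.inv.posSemidef (by positivity) hq₁
  have hv₂ := integral_quadForm_of_lintegral hy₂ hK₂.inv.posSemidef (by positivity) hq₂
  have hi₀ : Integrable (fun x : α × Vec d => 1 / 2 * Real.log (K₂.det / K₁.det)
      - 1 / 2 * ((x.2 - m₁ x.1).ofLp ⬝ᵥ K₁⁻¹ *ᵥ (x.2 - m₁ x.1).ofLp)) M₁ :=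
    (integrable_const _).sub (hi₁.const_mul _)
  have hLi : Integrable L M₁ := hi₀.add (hi₂.const_mul _)
  have hint : ∫ x, llr M₁ M₂ x ∂M₁ = 1 / 2 * Real.log (K₂.det / K₁.det) := by
    rw [integral_congr_ae hllr, hL, integral_add hi₀ (hi₂.const_mul _),
      integral_sub (integrable_const _) (hi₁.const_mul _), integral_const_mul, integral_const_mul,
      integral_const_mul, hv₁, hv₂]
    simp
  have hkl := InformationTheory.klDiv_ne_top hac (hLi.congr hllr.symm)
  have htr := InformationTheory.toReal_klDiv_of_measure_eq hac (by simp)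
  rw [hint] at htr
  rw [← htr]
  exact ⟨(ENNReal.ofReal_toReal hkl).symm, ENNReal.toReal_nonneg⟩

end GaussianDivergence

/-! ### Splitting a divergence into conditional mutual information and a remainder. -/

section MutualInformation

variable {Ω E F G : Type*} [MeasurableSpace Ω] [MeasurableSpace E] [MeasurableSpace F]
  [MeasurableSpace G]

/-- Two variables that are conditionally independent given the first coordinate may be drawn in
either order (Tonelli). -/
theorem map_compProd_swap (μ : Measure F) [SFinite μ] (τ : Kernel F E) [IsMarkovKernel τ]
    (γ : Kernel F G) [IsMarkovKernel γ] :
    ((μ ⊗ₘ τ) ⊗ₘ γ.comap Prod.fst measurable_fst).map (fun x => ((x.1.1, x.2), x.1.2)) =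
      (μ ⊗ₘ γ) ⊗ₘ τ.comap Prod.fst measurable_fst := by
  refine Measure.ext_of_lintegral _ fun f hf => ?_
  rw [lintegral_map hf (by fun_prop), Measure.lintegral_compProd (by fun_prop),
    Measure.lintegral_compProd (by fun_prop), Measure.lintegral_compProd (by fun_prop),
    Measure.lintegral_compProd (by fun_prop)]
  · refine lintegral_congr fun w => ?_
    simp only [Kernel.comap_apply]
    rw [lintegral_lintegral_swap]
    exact (show Measurable fun x : E × G => f ((w, x.2), x.1) by fun_prop).aemeasurable

/-- Comparing the channel with a reference kernel that only sees `W`: the divergence splits into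
the conditional mutual information and the divergence of the law of `(W, X)`. -/
theorem klDiv_eq_condMutualInfo_add [StandardBorelSpace E] [Nonempty E]
    [StandardBorelSpace G] [Nonempty G] (μ : Measure Ω) [IsProbabilityMeasure μ] {U : Ω → E}
    {X : Ω → G} {W : Ω → F} (hU : Measurable U) (hX : Measurable X) (hW : Measurable W)
    (γ : Kernel F G) [IsMarkovKernel γ] :
    InformationTheory.klDiv (μ.map fun ω => ((W ω, U ω), X ω))
        ((μ.map fun ω => (W ω, U ω)) ⊗ₘ γ.comap Prod.fst measurable_fst) =
      InformationTheory.klDiv (μ.map fun ω => (W ω, X ω)) ((μ.map W) ⊗ₘ γ) +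
        condMutualInfo μ U X W := by
  have : IsProbabilityMeasure (μ.map W) := Measure.isProbabilityMeasure_map hW.aemeasurable
  set τ := condDistrib U W μ
  set η := condDistrib X W μ
  set τ' := condDistrib U (fun ω => (W ω, X ω)) μ
  have hWU : (μ.map fun ω => (W ω, U ω)) = μ.map W ⊗ₘ τ :=
    (compProd_map_condDistrib hU.aemeasurable).symm
  have hWX : (μ.map fun ω => (W ω, X ω)) = μ.map W ⊗ₘ η :=
    (compProd_map_condDistrib hX.aemeasurable).symm
  have hWXU : (μ.map fun ω => ((W ω, X ω), U ω)) = (μ.map fun ω => (W ω, X ω)) ⊗ₘ τ' :=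
    (compProd_map_condDistrib hU.aemeasurable).symm
  let e : ((F × E) × G) ≃ᵐ ((F × G) × E) :=
    { toFun := fun x => ((x.1.1, x.2), x.1.2)
      invFun := fun x => ((x.1.1, x.2), x.1.2)
      left_inv := fun _ => rfl
      right_inv := fun _ => rfl
      measurable_toFun := by change Measurable fun x : (F × E) × G => ((x.1.1, x.2), x.1.2); fun_prop
      measurable_invFun := by
        change Measurable fun x : (F × G) × E => ((x.1.1, x.2), x.1.2); fun_prop }
  have he : (e : (F × E) × G → (F × G) × E) = fun x => ((x.1.1, x.2), x.1.2) := rfl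
  have hJ : (μ.map fun ω => ((W ω, U ω), X ω)).map e = (μ.map fun ω => (W ω, X ω)) ⊗ₘ τ' := by
    rw [Measure.map_map e.measurable (by fun_prop), ← hWXU]
    rfl
  -- After exchanging U and X, the reference law draws U given (W, X) from `τ`, whatever `ξ` is.
  have key : ∀ (ξ : Kernel F G) [IsMarkovKernel ξ],
      InformationTheory.klDiv (μ.map fun ω => ((W ω, U ω), X ω))
        ((μ.map fun ω => (W ω, U ω)) ⊗ₘ ξ.comap Prod.fst measurable_fst) =
      InformationTheory.klDiv ((μ.map fun ω => (W ω, X ω)) ⊗ₘ τ')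
        ((μ.map W ⊗ₘ ξ) ⊗ₘ τ.comap Prod.fst measurable_fst) := by
    intro ξ _
    have : IsProbabilityMeasure (μ.map fun ω => ((W ω, U ω), X ω)) :=
      Measure.isProbabilityMeasure_map (by fun_prop)
    have : IsProbabilityMeasure (μ.map fun ω => (W ω, U ω)) :=
      Measure.isProbabilityMeasure_map (by fun_prop)
    rw [← klDiv_map_measurableEquiv _ _ e, hJ, he, hWU, map_compProd_swap]
  have : IsProbabilityMeasure (μ.map fun ω => (W ω, X ω)) :=
    Measure.isProbabilityMeasure_map (by fun_prop)
  -- The second term of the chain rule compares `τ'` with `τ` and does not involve `γ`. Taking `ξ =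
  -- η` in `key` identifies it with the conditional mutual information.
  rw [key γ, InformationTheory.klDiv_compProd_eq_add, condMutualInfo]
  congr 1
  rw [key η, hWX]

end MutualInformation

variable {p q : ℕ}

/-! ### Measurability and splitting of trajectories. -/

section Trajectories

@[fun_prop]
theorem continuous_mulVecE {a b : ℕ} (M : Matrix (Fin a) (Fin b) ℝ) : Continuous (mulVecE M) :=
  LinearMap.continuous_of_finiteDimensional (Matrix.toEuclideanLin M)

@[fun_prop]
theorem measurable_mulVecE' {a b : ℕ} (M : Matrix (Fin a) (Fin b) ℝ) : Measurable (mulVecE M) :=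
  measurable_mulVecE M

@[fun_prop]
theorem measurable_outputs {k : ℕ} : Measurable (outputs : Path p q k → Fin k → Vec p) := by
  unfold outputs; fun_prop

/-- The trajectory before time `i`, the input at time `i` and the output at time `i`. -/
def splitAt {k : ℕ} (i : Fin k) (ω : Path p q k) : (Path p q i × Vec q) × Vec p :=
  ((fun j => ω (j.castLE i.isLt.le), (ω i).1), (ω i).2)

@[fun_prop]
theorem measurable_splitAt {k : ℕ} (i : Fin k) :
    Measurable (splitAt i : Path p q k → (Path p q i × Vec q) × Vec p) := by
  unfold splitAt; fun_prop

/-- All inputs up to the current time. -/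
def allInputs {k : ℕ} (x : Path p q k × Vec q) : Fin (k + 1) → Vec q :=
  Fin.snoc (α := fun _ => Vec q) (fun j => (x.1 j).1) x.2

theorem measurable_finSnoc {k : ℕ} {E : Type*} [MeasurableSpace E] :
    Measurable fun x : (Fin k → E) × E => (Fin.snoc (α := fun _ => E) x.1 x.2) := by
  refine measurable_pi_lambda _ fun j => ?_
  induction j using Fin.lastCases with
  | last => simpa using measurable_snd
  | cast j =>
    simp only [Fin.snoc_castSucc]
    exact (measurable_pi_apply j).comp measurable_fst

@[fun_prop]
theorem measurable_allInputs {k : ℕ} :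
    Measurable (allInputs : Path p q k × Vec q → Fin (k + 1) → Vec q) :=
  measurable_finSnoc.comp
    (f := fun x : Path p q k × Vec q => ((fun j => (x.1 j).1 : Fin k → Vec q), x.2)) (by fun_prop)

theorem splitAt_last_snoc {k : ℕ} (x : Path p q k) (y : Vec q × Vec p) :
    splitAt (Fin.last k) (Fin.snoc x y : Path p q (k + 1)) = ((x, y.1), y.2) := by
  refine Prod.ext (Prod.ext (funext fun j => ?_) ?_) ?_
  · exact Fin.snoc_castSucc (α := fun _ => Vec q × Vec p) y x j
  · exact congrArg (fun z : Vec q × Vec p => z.1) (Fin.snoc_last (α := fun _ => Vec q × Vec p) y x)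
  · exact congrArg (fun z : Vec q × Vec p => z.2) (Fin.snoc_last (α := fun _ => Vec q × Vec p) y x)

theorem splitAt_castSucc_snoc {k : ℕ} (i : Fin k) (x : Path p q k) (y : Vec q × Vec p) :
    splitAt i.castSucc (Fin.snoc x y : Path p q (k + 1)) = splitAt i x := by
  refine Prod.ext (Prod.ext (funext fun j => ?_) ?_) ?_
  · exact Fin.snoc_castSucc (α := fun _ => Vec q × Vec p) y x (j.castLE i.isLt.le)
  · exact congrArg (fun z : Vec q × Vec p => z.1)
      (Fin.snoc_castSucc (α := fun _ => Vec q × Vec p) y x i)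
  · exact congrArg (fun z : Vec q × Vec p => z.2)
      (Fin.snoc_castSucc (α := fun _ => Vec q × Vec p) y x i)

theorem inputsUpTo_eq {k : ℕ} (i : Fin k) (ω : Path p q k) :
    inputsUpTo i ω = allInputs (splitAt i ω).1 := by
  ext1 j
  unfold inputsUpTo allInputs splitAt
  induction j using Fin.lastCases with
  | last => simp [Fin.castLE]
  | cast j => simp [Fin.castLE]

end Trajectories

/-! ### The trajectory law, cut at a given time. -/

namespace GaussianChannel

variable (ch : GaussianChannel p q)

/-- The noiseless part of the channel output as a function of past outputs and input. -/
def mean (i : ℕ) (x : (Fin i → Vec p) × Vec q) : Vec p :=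
  ∑ j, mulVecE (ch.C i j) (x.1 j) + mulVecE (ch.D i) x.2

@[fun_prop]
theorem measurable_mean (i : ℕ) : Measurable (ch.mean i) := by
  unfold mean; fun_prop

theorem kernel_eq_addNoise (i : ℕ) :
    ch.kernel i = addNoise (multivariateGaussian 0 (ch.KV i))
      fun x => ch.mean i (outputs x.1, x.2) := rfl

variable (P : InputPolicy p q)

/-- The joint law of the trajectory before time `i` and of the input at time `i`. -/
noncomputable def inputLaw (i : ℕ) : Measure (Path p q i × Vec q) :=
  ch.jointLaw P i ⊗ₘ P.kernel i

instance (i : ℕ) : IsProbabilityMeasure (ch.inputLaw P i) := by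
  unfold inputLaw; infer_instance

theorem map_fst_inputLaw (i : ℕ) : (ch.inputLaw P i).map Prod.fst = ch.jointLaw P i :=
  Measure.fst_compProd _ _

theorem lintegral_inputLaw_fst (i : ℕ) {f : Path p q i → ℝ≥0∞} (hf : Measurable f) :
    ∫⁻ x, f x.1 ∂(ch.inputLaw P i) = ∫⁻ h, f h ∂(ch.jointLaw P i) := by
  rw [← ch.map_fst_inputLaw P i, lintegral_map hf measurable_fst]

theorem jointLaw_succ (k : ℕ) :
    ch.jointLaw P (k + 1) = (ch.inputLaw P k ⊗ₘ ch.kernel k).map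
      fun z => (Fin.snoc z.1.1 (z.1.2, z.2) : Path p q (k + 1)) := by
  rw [jointLaw, inputLaw, ← Measure.compProd_assoc', Measure.map_map (measurable_snoc k)
    (MeasurableEquiv.measurable _)]
  rfl

theorem measurable_snoc_path (k : ℕ) : Measurable fun z : (Path p q k × Vec q) × Vec p =>
    (Fin.snoc z.1.1 (z.1.2, z.2) : Path p q (k + 1)) :=
  (measurable_snoc k).comp
    (f := fun z : (Path p q k × Vec q) × Vec p => (z.1.1, (z.1.2, z.2))) (by fun_prop)

/-- Later steps only append entries, so what is seen up to time i does not depend on the horizon.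
All statements at time i are thereby reduced to `inputLaw` and the channel kernel. -/
theorem map_splitAt_jointLaw {k : ℕ} (i : Fin k) :
    (ch.jointLaw P k).map (splitAt i) = ch.inputLaw P i ⊗ₘ ch.kernel i := by
  induction k with
  | zero => exact i.elim0
  | succ k ih =>
    rw [jointLaw_succ, Measure.map_map (measurable_splitAt i) (measurable_snoc_path k)]
    induction i using Fin.lastCases with
    | last =>
      have : (splitAt (Fin.last k) ∘ fun z : (Path p q k × Vec q) × Vec p =>
          (Fin.snoc z.1.1 (z.1.2, z.2) : Path p q (k + 1))) = id :=
        funext fun z => splitAt_last_snoc z.1.1 (z.1.2, z.2)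
      rw [this]
      exact Measure.map_id
    | cast j =>
      have : (splitAt j.castSucc ∘ fun z : (Path p q k × Vec q) × Vec p =>
          (Fin.snoc z.1.1 (z.1.2, z.2) : Path p q (k + 1))) =
          (splitAt j ∘ Prod.fst) ∘ Prod.fst :=
        funext fun z => splitAt_castSucc_snoc j z.1.1 (z.1.2, z.2)
      rw [this, ← Measure.map_map (by fun_prop) (by fun_prop),
        ← Measure.map_map (by fun_prop) (by fun_prop)]
      have h1 : (ch.inputLaw P k ⊗ₘ ch.kernel k).map Prod.fst = ch.inputLaw P k :=
        Measure.fst_compProd _ _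
      rw [h1, map_fst_inputLaw]
      exact ih j

theorem lintegral_kernel (k : ℕ) (x : Path p q k × Vec q) {f : Vec p → ℝ≥0∞} (hf : Measurable f) :
    ∫⁻ y, f y ∂(ch.kernel k x) =
      ∫⁻ v, f (ch.mean k (outputs x.1, x.2) + v) ∂(multivariateGaussian 0 (ch.KV k)) := by
  rw [kernel_eq_addNoise, addNoise_apply (by fun_prop), lintegral_map hf (by fun_prop)]

theorem lintegral_jointLaw_succ (k : ℕ) {f : Path p q (k + 1) → ℝ≥0∞} (hf : Measurable f) :
    ∫⁻ ω, f ω ∂(ch.jointLaw P (k + 1)) =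
      ∫⁻ x, ∫⁻ v, f (Fin.snoc x.1 (x.2, ch.mean k (outputs x.1, x.2) + v))
        ∂(multivariateGaussian 0 (ch.KV k)) ∂(ch.inputLaw P k) := by
  rw [jointLaw_succ, lintegral_map hf (measurable_snoc_path k),
    Measure.lintegral_compProd (f := fun z : (Path p q k × Vec q) × Vec p =>
      f (Fin.snoc z.1.1 (z.1.2, z.2))) (hf.comp (measurable_snoc_path k))]
  refine lintegral_congr fun x => ?_
  exact ch.lintegral_kernel k x
    (f := fun y => f (Fin.snoc x.1 (x.2, y))) (by
      have h1 := measurable_snoc_path (p := p) (q := q) k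
      have h2 : Measurable fun y : Vec p => (x, y) := by fun_prop
      exact hf.comp (h1.comp h2))

end GaussianChannel

/-! ### Propagation of second moments along the channel recursion. -/

/-- The linear functional of an output trajectory with coefficients `β`. -/
def pairing {i : ℕ} (β : Fin i → Fin p → ℝ) (b : Fin i → Vec p) : ℝ := ∑ j, β j ⬝ᵥ (b j).ofLp

@[fun_prop]
theorem measurable_pairing {i : ℕ} (β : Fin i → Fin p → ℝ) : Measurable (pairing β) := by
  unfold pairing dotProduct; fun_prop

@[simp]
theorem pairing_add {i : ℕ} (β β' : Fin i → Fin p → ℝ) (b : Fin i → Vec p) :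
    pairing (β + β') b = pairing β b + pairing β' b := by
  simp [pairing, Finset.sum_add_distrib]

@[simp]
theorem pairing_smul {i : ℕ} (c : ℝ) (β : Fin i → Fin p → ℝ) (b : Fin i → Vec p) :
    pairing (c • β) b = c * pairing β b := by
  simp [pairing, Finset.mul_sum]

@[simp]
theorem pairing_neg {i : ℕ} (β : Fin i → Fin p → ℝ) (b : Fin i → Vec p) :
    pairing (-β) b = -pairing β b := by
  simp [pairing]

@[simp]
theorem pairing_zero {i : ℕ} (b : Fin i → Vec p) : pairing (0 : Fin i → Fin p → ℝ) b = 0 := by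
  simp [pairing]

theorem pairing_snoc {k : ℕ} (β : Fin (k + 1) → Fin p → ℝ) (h : Path p q k) (y : Vec q × Vec p) :
    pairing β (outputs (Fin.snoc h y : Path p q (k + 1))) =
      pairing (fun j => β j.castSucc) (outputs h) + β (Fin.last k) ⬝ᵥ y.2.ofLp := by
  unfold pairing outputs
  rw [Fin.sum_univ_castSucc, Fin.snoc_last]
  simp only [Fin.snoc_castSucc]

theorem dotProduct_sum_mulVecE {i a : ℕ} (M : Fin i → Matrix (Fin a) (Fin p) ℝ) (β : Fin a → ℝ)
    (b : Fin i → Vec p) :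
    β ⬝ᵥ (∑ j, mulVecE (M j) (b j)).ofLp = pairing (fun j => (M j)ᵀ *ᵥ β) b := by
  simp only [WithLp.ofLp_sum, dotProduct_sum, pairing, mulVecE, mulVec_transpose,
    ← dotProduct_mulVec]

theorem dotProduct_mulVecE {a b : ℕ} (M : Matrix (Fin a) (Fin b) ℝ) (β : Fin a → ℝ)
    (x : Vec b) : β ⬝ᵥ (mulVecE M x).ofLp = (Mᵀ *ᵥ β) ⬝ᵥ x.ofLp := by
  rw [mulVecE, mulVec_transpose, ← dotProduct_mulVec]

namespace GaussianChannel

variable (ch : GaussianChannel p q) (P : InputPolicy p q)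

theorem dotProduct_mean (i : ℕ) (β : Fin p → ℝ) (x : (Fin i → Vec p) × Vec q) :
    β ⬝ᵥ (ch.mean i x).ofLp =
      pairing (fun j => (ch.C i j)ᵀ *ᵥ β) x.1 + ((ch.D i)ᵀ *ᵥ β) ⬝ᵥ x.2.ofLp := by
  rw [mean, WithLp.ofLp_add, dotProduct_add, dotProduct_sum_mulVecE, dotProduct_mulVecE]

/-- Substituting the channel equation for the last output moves its coefficient to the past outputs
through Cᵀ and to the input through Dᵀ. The fresh centered noise adds its own variance. -/
theorem lintegral_sq_jointLaw_succ (k : ℕ) (β : Fin (k + 1) → Fin p → ℝ) :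
    ∫⁻ ω, ENNReal.ofReal ((pairing β (outputs ω)) ^ 2) ∂(ch.jointLaw P (k + 1)) =
      ∫⁻ x, ENNReal.ofReal ((((ch.D k)ᵀ *ᵥ β (Fin.last k)) ⬝ᵥ x.2.ofLp +
        pairing (fun j => β j.castSucc + (ch.C k j)ᵀ *ᵥ β (Fin.last k)) (outputs x.1)) ^ 2)
          ∂(ch.inputLaw P k) +
      ENNReal.ofReal (β (Fin.last k) ⬝ᵥ ch.KV k *ᵥ β (Fin.last k)) := by
  have hnn : 0 ≤ β (Fin.last k) ⬝ᵥ ch.KV k *ᵥ β (Fin.last k) := by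
    simpa using (ch.posDef_KV k).posSemidef.dotProduct_mulVec_nonneg (β (Fin.last k))
  rw [lintegral_jointLaw_succ _ _ _ (by fun_prop)]
  have : ∀ x : Path p q k × Vec q, ∫⁻ v, ENNReal.ofReal ((pairing β (outputs (Fin.snoc x.1
      (x.2, ch.mean k (outputs x.1, x.2) + v) : Path p q (k + 1)))) ^ 2)
        ∂(multivariateGaussian 0 (ch.KV k)) =
      ENNReal.ofReal ((((ch.D k)ᵀ *ᵥ β (Fin.last k)) ⬝ᵥ x.2.ofLp +
        pairing (fun j => β j.castSucc + (ch.C k j)ᵀ *ᵥ β (Fin.last k)) (outputs x.1)) ^ 2) +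
      ENNReal.ofReal (β (Fin.last k) ⬝ᵥ ch.KV k *ᵥ β (Fin.last k)) := by
    intro x
    rw [← ENNReal.ofReal_add (sq_nonneg _) hnn,
      ← lintegral_sq_add_multivariateGaussian (ch.posDef_KV k).posSemidef]
    refine lintegral_congr fun v => ?_
    congr 2
    rw [pairing_snoc, WithLp.ofLp_add, dotProduct_add, dotProduct_mean]
    have := pairing_add (fun j => β j.castSucc) (fun j => (ch.C k j)ᵀ *ᵥ β (Fin.last k))
      (outputs x.1)
    simp only [Pi.add_def] at this ⊢
    rw [this]
    ring
  simp_rw [this]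
  rw [lintegral_add_right _ measurable_const, lintegral_const, measure_univ, mul_one]

/-- The joint second moments of `(A_i, B^{i-1})` are those of `A_i = ∑_{j < i} Γ_j B_j + Z` with `Z`
of second moment matrix `K`, uncorrelated with `B^{i-1}`. -/
def MatchesAt (i : ℕ) (Γ : Fin i → Matrix (Fin q) (Fin p) ℝ) (K : Matrix (Fin q) (Fin q) ℝ) :
    Prop :=
  ∀ (α : Fin q → ℝ) (β : Fin i → Fin p → ℝ),
    ∫⁻ x, ENNReal.ofReal ((α ⬝ᵥ x.2.ofLp + pairing β (outputs x.1)) ^ 2) ∂(ch.inputLaw P i) =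
      ∫⁻ h, ENNReal.ofReal ((pairing (fun j => β j + (Γ j)ᵀ *ᵥ α) (outputs h)) ^ 2)
        ∂(ch.jointLaw P i) + ENNReal.ofReal (α ⬝ᵥ K *ᵥ α)

end GaussianChannel

namespace LinearStrategy

variable (θ : LinearStrategy p q) (ch : GaussianChannel p q)

/-- The input distributions `P` have the same second moments as the strategy `θ` up to time `n`. -/
def Matches (P : InputPolicy p q) (n : ℕ) : Prop :=
  ∀ i ≤ n, ch.MatchesAt P i (θ.Γ i) (θ.KZ i)

/-- The gains `C_{i,j} + D_{i,i} Γ_{i,j}` of the closed loop. -/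
def loopGain (i : ℕ) (j : Fin i) : Matrix (Fin p) (Fin p) ℝ := ch.C i j + ch.D i * θ.Γ i j

/-- The covariance `D_{i,i} K_{Z_i} D_{i,i}ᵀ + K_{V_i}` of the output innovations. -/
def innovCov (i : ℕ) : Matrix (Fin p) (Fin p) ℝ := ch.D i * θ.KZ i * (ch.D i)ᵀ + ch.KV i

theorem posDef_innovCov (i : ℕ) : (θ.innovCov ch i).PosDef := by
  refine Matrix.PosDef.posSemidef_add ?_ (ch.posDef_KV i)
  simpa using (θ.posSemidef_KZ i).mul_mul_conjTranspose_same (ch.D i)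

/-- The second moment of `∑_{j < i} ⟨β_j, B_j⟩`. -/
def outQuad : (i : ℕ) → (Fin i → Fin p → ℝ) → ℝ
  | 0, _ => 0
  | i + 1, β => outQuad i (fun j => β j.castSucc + (θ.loopGain ch i j)ᵀ *ᵥ β (Fin.last i)) +
      β (Fin.last i) ⬝ᵥ θ.innovCov ch i *ᵥ β (Fin.last i)

theorem outQuad_nonneg (i : ℕ) (β : Fin i → Fin p → ℝ) : 0 ≤ θ.outQuad ch i β := by
  induction i with
  | zero => exact le_rfl
  | succ i ih =>
    refine add_nonneg (ih _) ?_
    simpa using (θ.posDef_innovCov ch i).posSemidef.dotProduct_mulVec_nonneg (β (Fin.last i))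

theorem dotProduct_KZ_nonneg (i : ℕ) (α : Fin q → ℝ) : 0 ≤ α ⬝ᵥ θ.KZ i *ᵥ α := by
  simpa using (θ.posSemidef_KZ i).dotProduct_mulVec_nonneg α

variable {θ ch} {P : InputPolicy p q} {n : ℕ}

/-- Matching replaces each input by its regression on past outputs plus an uncorrelated residual, so
the recursion closes on the outputs. The answer depends on `θ` only. The range reaches n + 1 because
the first n + 1 outputs use only inputs up to time n. -/
theorem Matches.lintegral_sq (hP : θ.Matches ch P n) {i : ℕ} (hi : i ≤ n + 1)
    (β : Fin i → Fin p → ℝ) :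
    ∫⁻ ω, ENNReal.ofReal ((pairing β (outputs ω)) ^ 2) ∂(ch.jointLaw P i) =
      ENNReal.ofReal (θ.outQuad ch i β) := by
  induction i with
  | zero => simp [pairing, outQuad]
  | succ i ih =>
    rw [GaussianChannel.lintegral_sq_jointLaw_succ, hP i (by omega), ih (by omega), outQuad,
      ← ENNReal.ofReal_add (outQuad_nonneg _ _ _ _) (dotProduct_KZ_nonneg _ _ _),
      ← ENNReal.ofReal_add (add_nonneg (outQuad_nonneg _ _ _ _) (dotProduct_KZ_nonneg _ _ _))]
    · congr 1
      have h1 : (fun j => β j.castSucc + (ch.C i j)ᵀ *ᵥ β (Fin.last i) +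
          (θ.Γ i j)ᵀ *ᵥ (ch.D i)ᵀ *ᵥ β (Fin.last i)) =
          fun j => β j.castSucc + (θ.loopGain ch i j)ᵀ *ᵥ β (Fin.last i) := by
        ext1 j
        rw [loopGain, transpose_add, transpose_mul, add_mulVec, ← mulVec_mulVec, add_assoc]
      have h2 : ((ch.D i)ᵀ *ᵥ β (Fin.last i)) ⬝ᵥ θ.KZ i *ᵥ (ch.D i)ᵀ *ᵥ β (Fin.last i) =
          β (Fin.last i) ⬝ᵥ (ch.D i * θ.KZ i * (ch.D i)ᵀ) *ᵥ β (Fin.last i) := by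
        rw [← mulVec_mulVec, ← mulVec_mulVec, dotProduct_mulVec (β (Fin.last i)),
          mulVec_transpose]
      rw [h1, h2, innovCov, add_mulVec, dotProduct_add, add_assoc]
    · simpa using (ch.posDef_KV i).posSemidef.dotProduct_mulVec_nonneg (β (Fin.last i))

theorem Matches.lintegral_input_sq (hP : θ.Matches ch P n) {i : ℕ} (hi : i ≤ n)
    (α : Fin q → ℝ) (β : Fin i → Fin p → ℝ) :
    ∫⁻ x, ENNReal.ofReal ((α ⬝ᵥ x.2.ofLp + pairing β (outputs x.1)) ^ 2) ∂(ch.inputLaw P i) =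
      ENNReal.ofReal (θ.outQuad ch i (fun j => β j + (θ.Γ i j)ᵀ *ᵥ α) + α ⬝ᵥ θ.KZ i *ᵥ α) := by
  rw [hP i hi, hP.lintegral_sq (by omega),
    ENNReal.ofReal_add (outQuad_nonneg _ _ _ _) (dotProduct_KZ_nonneg _ _ _)]

/-- The mean of the input given the past outputs. -/
def inputMean (θ : LinearStrategy p q) (i : ℕ) (b : Fin i → Vec p) : Vec q :=
  ∑ j, mulVecE (θ.Γ i j) (b j)

@[fun_prop]
theorem measurable_inputMean (θ : LinearStrategy p q) (i : ℕ) : Measurable (θ.inputMean i) := by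
  unfold inputMean; fun_prop

theorem policy_kernel_eq_addNoise (θ : LinearStrategy p q) (i : ℕ) :
    θ.policy.kernel i = addNoise (multivariateGaussian 0 (θ.KZ i))
      fun h => θ.inputMean i (outputs h) := rfl

theorem inputLaw_policy (θ : LinearStrategy p q) (ch : GaussianChannel p q) (i : ℕ) :
    ch.inputLaw θ.policy i = ((ch.jointLaw θ.policy i).prod (multivariateGaussian 0 (θ.KZ i))).map
      fun x => (x.1, θ.inputMean i (outputs x.1) + x.2) := by
  rw [GaussianChannel.inputLaw, policy_kernel_eq_addNoise, compProd_addNoise _ (by fun_prop)]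

theorem matches_policy (θ : LinearStrategy p q) (ch : GaussianChannel p q) (n : ℕ) :
    θ.Matches ch θ.policy n := by
  intro i _ α β
  rw [inputLaw_policy, lintegral_map (by unfold dotProduct; fun_prop) (by fun_prop),
    lintegral_prod _ (by unfold dotProduct; fun_prop)]
  have : ∀ h : Path p q i, ∫⁻ z, ENNReal.ofReal ((α ⬝ᵥ (θ.inputMean i (outputs h) + z).ofLp +
      pairing β (outputs h)) ^ 2) ∂(multivariateGaussian 0 (θ.KZ i)) =
      ENNReal.ofReal ((pairing (fun j => β j + (θ.Γ i j)ᵀ *ᵥ α) (outputs h)) ^ 2) +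
        ENNReal.ofReal (α ⬝ᵥ θ.KZ i *ᵥ α) := by
    intro h
    rw [← ENNReal.ofReal_add (sq_nonneg _) (dotProduct_KZ_nonneg _ _ _),
      ← lintegral_sq_add_multivariateGaussian (θ.posSemidef_KZ i)]
    refine lintegral_congr fun z => ?_
    congr 2
    rw [WithLp.ofLp_add, dotProduct_add, inputMean, dotProduct_sum_mulVecE]
    have := pairing_add β (fun j => (θ.Γ i j)ᵀ *ᵥ α) (outputs h)
    simp only [Pi.add_def] at this ⊢
    rw [this]
    ring
  simp only [this]
  rw [lintegral_add_right _ measurable_const, lintegral_const, measure_univ, mul_one]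

end LinearStrategy

/-! ### Matching the second moments of an arbitrary input distribution. -/

section QuadraticForms

/-- With M = Cᵀ C and C invertible, this is Cauchy-Schwarz for y = C⁻¹ (C y). The constant is the
sum of the squared entries of C⁻¹. -/
theorem exists_sq_le_mul_quadForm {ι : Type*} [Fintype ι] [DecidableEq ι] {M : Matrix ι ι ℝ}
    (hM : M.PosDef) : ∃ c : ℝ, 0 ≤ c ∧ ∀ (y : ι → ℝ) (k : ι), y k ^ 2 ≤ c * (y ⬝ᵥ M *ᵥ y) := by
  obtain ⟨C, hC, hsq⟩ := exists_quadForm_eq_sum_sq hM.posSemidef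
  have hdet : IsUnit C.det := by
    have := hM.det_pos
    rw [hC, det_mul, det_transpose] at this
    exact isUnit_iff_ne_zero.2 fun h => by simp [h] at this
  refine ⟨∑ k, ∑ l, C⁻¹ k l ^ 2, by positivity, fun y k => ?_⟩
  have hy : y k = ∑ l, C⁻¹ k l * (C l ⬝ᵥ y) := by
    have : y = C⁻¹ *ᵥ (C *ᵥ y) := by
      rw [mulVec_mulVec, nonsing_inv_mul _ hdet, one_mulVec]
    exact congrFun this k
  rw [hsq]
  calc y k ^ 2 ≤ (∑ l, C⁻¹ k l ^ 2) * ∑ l, (C l ⬝ᵥ y) ^ 2 := by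
        rw [hy]; exact Finset.sum_mul_sq_le_sq_mul_sq _ _ _
    _ ≤ _ := by
        refine mul_le_mul_of_nonneg_right ?_ (Finset.sum_nonneg fun _ _ => sq_nonneg _)
        exact Finset.single_le_sum (f := fun k => ∑ l, C⁻¹ k l ^ 2)
          (fun _ _ => Finset.sum_nonneg fun _ _ => sq_nonneg _) (Finset.mem_univ k)

/-- Orthogonal projection of one block of a linear map onto the range of the other. -/
theorem exists_orthogonal_residual {E F H : Type*} [AddCommGroup E] [Module ℝ E] [AddCommGroup F]
    [Module ℝ F] [FiniteDimensional ℝ F] [NormedAddCommGroup H] [InnerProductSpace ℝ H]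
    (L : E × F →ₗ[ℝ] H) :
    ∃ T : E →ₗ[ℝ] F, ∀ x y, inner ℝ (L (0, y)) (L (x, -T x)) = 0 := by
  let G : F →ₗ[ℝ] H := L ∘ₗ LinearMap.inr ℝ E F
  -- `G` need not be injective, so a linear section picks one preimage of each projected vector.
  obtain ⟨s, hs⟩ := G.rangeRestrict.exists_rightInverse_of_surjective G.range_rangeRestrict
  let π : H →ₗ[ℝ] G.range := (LinearMap.range G).orthogonalProjectionOnto.toLinearMap
  refine ⟨s ∘ₗ π ∘ₗ L ∘ₗ LinearMap.inl ℝ E F, fun x y => ?_⟩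
  set t := (s ∘ₗ π ∘ₗ L ∘ₗ LinearMap.inl ℝ E F) x with ht
  have hG : G t = (LinearMap.range G).orthogonalProjectionOnto (L (x, 0)) := by
    have := congrArg (Subtype.val) (LinearMap.congr_fun hs (π (L (x, 0))))
    exact this
  have hL : L (x, -t) = L (x, 0) - G t := by
    rw [show ((x, -t) : E × F) = (x, 0) - (0, t) by simp, map_sub]
    rfl
  rw [hL, hG]
  exact Submodule.inner_right_of_mem_orthogonal (K := LinearMap.range G) ⟨y, rfl⟩
    (Submodule.sub_starProjection_mem_orthogonal (K := LinearMap.range G) _)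

theorem lintegral_sq_eq_norm_toLp {Ω : Type*} [MeasurableSpace Ω] {μ : Measure Ω} {f : Ω → ℝ}
    (hf : MemLp f 2 μ) :
    ∫⁻ ω, ENNReal.ofReal (f ω ^ 2) ∂μ = ENNReal.ofReal (‖hf.toLp f‖ ^ 2) := by
  rw [← real_inner_self_eq_norm_sq, L2.inner_def,
    ← ofReal_integral_eq_lintegral_ofReal hf.integrable_sq (.of_forall fun _ => sq_nonneg _)]
  congr 1
  refine integral_congr_ae ?_
  filter_upwards [hf.coeFn_toLp] with ω hω
  simp [hω, sq]

theorem memLp_two_of_lintegral_sq {Ω : Type*} [MeasurableSpace Ω] {μ : Measure Ω} {f : Ω → ℝ}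
    (hf : Measurable f) (h : ∫⁻ ω, ENNReal.ofReal (f ω ^ 2) ∂μ < ∞) : MemLp f 2 μ := by
  rw [memLp_two_iff_integrable_sq hf.aestronglyMeasurable]
  refine ⟨(hf.pow_const 2).aestronglyMeasurable, ?_⟩
  rwa [hasFiniteIntegral_iff_ofReal (.of_forall fun _ => sq_nonneg _)]

end QuadraticForms

namespace GaussianChannel

variable (ch : GaussianChannel p q) (P : InputPolicy p q)

/-- Linear regression in L²: `T` gives the coefficients of the projection of each input functional
on the output functionals, and K is the Gram matrix of the residuals. The matching identity is
Pythagoras. -/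
theorem exists_matchesAt {i : ℕ}
    (hA : ∀ α : Fin q → ℝ, MemLp (fun x => α ⬝ᵥ x.2.ofLp) 2 (ch.inputLaw P i))
    (hB : ∀ β : Fin i → Fin p → ℝ, MemLp (fun h => pairing β (outputs h)) 2 (ch.jointLaw P i)) :
    ∃ (Γ : Fin i → Matrix (Fin q) (Fin p) ℝ) (K : Matrix (Fin q) (Fin q) ℝ),
      K.PosSemidef ∧ ch.MatchesAt P i Γ K := by
  let f : (Fin q → ℝ) × (Fin i → Fin p → ℝ) → Path p q i × Vec q → ℝ :=
    fun x z => x.1 ⬝ᵥ z.2.ofLp + pairing x.2 (outputs z.1)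
  have hf : ∀ x, MemLp (f x) 2 (ch.inputLaw P i) := by
    intro x
    refine (hA x.1).add ?_
    have := hB x.2
    rw [← ch.map_fst_inputLaw P i] at this
    exact this.comp_of_map (by fun_prop)
  let L : (Fin q → ℝ) × (Fin i → Fin p → ℝ) →ₗ[ℝ] Lp ℝ 2 (ch.inputLaw P i) :=
    { toFun := fun x => (hf x).toLp
      map_add' := fun x y => by
        rw [← MemLp.toLp_add]
        congr 1
        ext z
        simp only [f, Prod.fst_add, Prod.snd_add, add_dotProduct, pairing_add, Pi.add_apply]
        ring
      map_smul' := fun c x => by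
        rw [RingHom.id_apply, ← MemLp.toLp_const_smul]
        congr 1
        ext z
        simp only [f, Prod.smul_fst, Prod.smul_snd, smul_dotProduct, pairing_smul, Pi.smul_apply,
          smul_eq_mul]
        ring }
  obtain ⟨T, hT⟩ := exists_orthogonal_residual L
  let N : (Fin q → ℝ) →ₗ[ℝ] Lp ℝ 2 (ch.inputLaw P i) := L ∘ₗ LinearMap.prod LinearMap.id (-T)
  let K : Matrix (Fin q) (Fin q) ℝ := Matrix.of fun k l =>
    inner ℝ (N (Pi.single k 1)) (N (Pi.single l 1))
  have hK : ∀ α, α ⬝ᵥ K *ᵥ α = ‖N α‖ ^ 2 := by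
    intro α
    have hα : N α = ∑ k, α k • N (Pi.single k 1) := by
      conv_lhs => rw [pi_eq_sum_univ' α]
      simp [map_sum, Pi.single]
    rw [← real_inner_self_eq_norm_sq, hα]
    simp only [sum_inner, inner_sum, real_inner_smul_left, real_inner_smul_right, dotProduct,
      mulVec, K, Matrix.of_apply, Finset.mul_sum]
    refine Finset.sum_congr rfl fun k _ => Finset.sum_congr rfl fun l _ => ?_
    rw [real_inner_comm]
    ring
  have hT' : ∀ α j, (LinearMap.toMatrix' (LinearMap.proj j ∘ₗ T)) *ᵥ α = T α j := by
    intro α j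
    rw [LinearMap.toMatrix'_mulVec]
    rfl
  refine ⟨fun j => (LinearMap.toMatrix' (LinearMap.proj j ∘ₗ T))ᵀ, K, ?_, fun α β => ?_⟩
  · refine Matrix.PosSemidef.of_dotProduct_mulVec_nonneg ?_ fun α => ?_
    · ext k l
      simp only [conjTranspose_apply, K, Matrix.of_apply, star_trivial]
      exact real_inner_comm _ _
    · rw [star_trivial, hK]
      positivity
  · have h1 := lintegral_sq_eq_norm_toLp (hf (α, β))
    have h2 := lintegral_sq_eq_norm_toLp (hf (0, β + T α))
    have h3 : ∫⁻ h, ENNReal.ofReal ((pairing (fun j => β j +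
        (LinearMap.toMatrix' (LinearMap.proj j ∘ₗ T))ᵀᵀ *ᵥ α) (outputs h)) ^ 2)
          ∂(ch.jointLaw P i) = ENNReal.ofReal (‖L (0, β + T α)‖ ^ 2) := by
      rw [← ch.lintegral_inputLaw_fst P i (by fun_prop)]
      simp only [transpose_transpose, hT']
      refine Eq.trans (lintegral_congr fun x => ?_) h2
      simp only [f, zero_dotProduct, zero_add]
      rfl
    rw [h3, hK, ← ENNReal.ofReal_add (by positivity) (by positivity)]
    refine h1.trans ?_
    congr 1
    change ‖L (α, β)‖ ^ 2 = _
    -- Splitting into a function of past outputs and the residual, which are orthogonal by `hT`.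
    have hL : L (α, β) = L (0, β + T α) + N α := by
      change _ = _ + L (α, -T α)
      rw [← map_add]
      simp
    rw [hL, norm_add_sq_real, show inner ℝ (L (0, β + T α)) (N α) = 0 from hT _ _]
    ring

theorem lintegral_stageCost {k : ℕ} (i : Fin k) :
    ∫⁻ ω, ENNReal.ofReal (ch.stageCost i (inputAt i ω) (outputsBefore i ω)) ∂(ch.jointLaw P k) =
      ∫⁻ x, ENNReal.ofReal (x.2.ofLp ⬝ᵥ ch.R i *ᵥ x.2.ofLp) ∂(ch.inputLaw P i) +
      ∫⁻ h, ENNReal.ofReal ((fun jl : Fin i × Fin p => outputs h jl.1 jl.2) ⬝ᵥ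
        ch.Q i *ᵥ fun jl => outputs h jl.1 jl.2) ∂(ch.jointLaw P i) := by
  have h1 : (ch.jointLaw P k).map (fun ω => (splitAt i ω).1) = ch.inputLaw P i := by
    change (ch.jointLaw P k).map (Prod.fst ∘ splitAt i) = _
    rw [← Measure.map_map (by fun_prop) (by fun_prop), map_splitAt_jointLaw]
    exact Measure.fst_compProd _ _
  rw [← ch.lintegral_inputLaw_fst P i (by simp only [dotProduct, mulVec]; fun_prop),
    ← lintegral_add_left (by simp only [dotProduct, mulVec]; fun_prop), ← h1,
    lintegral_map (by simp only [dotProduct, mulVec]; fun_prop) (by fun_prop)]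
  refine lintegral_congr fun ω => ?_
  rw [← ENNReal.ofReal_add]
  · rfl
  · simpa using (ch.posDef_R i).posSemidef.dotProduct_mulVec_nonneg _
  · simpa using (ch.posSemidef_Q i).dotProduct_mulVec_nonneg _

theorem lintegral_stageCost_ne_top {n : ℕ} (h : ch.avgCost P n ≠ ∞) (i : Fin (n + 1)) :
    ∫⁻ ω, ENNReal.ofReal (ch.stageCost i (inputAt i ω) (outputsBefore i ω))
      ∂(ch.jointLaw P (n + 1)) ≠ ∞ := by
  intro hi
  refine h ?_
  rw [avgCost, ENNReal.sum_eq_top.2 ⟨i, Finset.mem_univ _, hi⟩, ENNReal.mul_top]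
  exact ENNReal.inv_ne_zero.2 (by finiteness)

/-- Positive definiteness of R is what turns finite cost into finite input energy. -/
theorem memLp_input {i : ℕ}
    (h : ∫⁻ x, ENNReal.ofReal (x.2.ofLp ⬝ᵥ ch.R i *ᵥ x.2.ofLp) ∂(ch.inputLaw P i) ≠ ∞)
    (α : Fin q → ℝ) : MemLp (fun x => α ⬝ᵥ x.2.ofLp) 2 (ch.inputLaw P i) := by
  obtain ⟨c, hc, hle⟩ := exists_sq_le_mul_quadForm (ch.posDef_R i)
  have hk : ∀ k, MemLp (fun x : Path p q i × Vec q => x.2.ofLp k) 2 (ch.inputLaw P i) := by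
    intro k
    refine memLp_two_of_lintegral_sq (by fun_prop) ?_
    calc ∫⁻ x, ENNReal.ofReal (x.2.ofLp k ^ 2) ∂(ch.inputLaw P i)
        ≤ ∫⁻ x, ENNReal.ofReal c * ENNReal.ofReal (x.2.ofLp ⬝ᵥ ch.R i *ᵥ x.2.ofLp)
          ∂(ch.inputLaw P i) := by
          refine lintegral_mono fun x => ?_
          rw [← ENNReal.ofReal_mul hc]
          exact ENNReal.ofReal_le_ofReal (hle _ _)
      _ < ∞ := by
          rw [lintegral_const_mul' _ _ ENNReal.ofReal_ne_top]
          exact ENNReal.mul_lt_top ENNReal.ofReal_lt_top h.lt_top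
  unfold dotProduct
  exact memLp_finsetSum _ fun k _ => (hk k).const_mul _

/-- Q may be degenerate, so the cost does not control the outputs. Their moments come from those of
the inputs by the recursion. -/
theorem memLp_outputs {i : ℕ}
    (h : ∀ k < i, ∀ α : Fin q → ℝ, MemLp (fun x => α ⬝ᵥ x.2.ofLp) 2 (ch.inputLaw P k))
    (β : Fin i → Fin p → ℝ) : MemLp (fun ω => pairing β (outputs ω)) 2 (ch.jointLaw P i) := by
  induction i with
  | zero =>
    simp only [pairing, Finset.univ_eq_empty, Finset.sum_empty]
    exact MemLp.zero
  | succ i ih =>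
    refine memLp_two_of_lintegral_sq (by fun_prop) ?_
    rw [lintegral_sq_jointLaw_succ]
    refine ENNReal.add_lt_top.2 ⟨?_, ENNReal.ofReal_lt_top⟩
    have h1 := h i (by omega) ((ch.D i)ᵀ *ᵥ β (Fin.last i))
    have h2 := ih (fun k hk => h k (by omega))
      (fun j => β j.castSucc + (ch.C i j)ᵀ *ᵥ β (Fin.last i))
    rw [← ch.map_fst_inputLaw P i] at h2
    have h3 := h1.add (h2.comp_of_map (by fun_prop))
    refine (lintegral_sq_eq_norm_toLp h3).trans_lt ?_
    exact ENNReal.ofReal_lt_top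

theorem exists_matches {n : ℕ} (h : ch.avgCost P n ≠ ∞) :
    ∃ θ : LinearStrategy p q, θ.Matches ch P n := by
  have hA : ∀ i ≤ n, ∀ α : Fin q → ℝ, MemLp (fun x => α ⬝ᵥ x.2.ofLp) 2 (ch.inputLaw P i) := by
    intro i hi α
    refine ch.memLp_input P ?_ α
    have := ch.lintegral_stageCost_ne_top P h ⟨i, by omega⟩
    rw [lintegral_stageCost] at this
    exact (ENNReal.add_ne_top.1 this).1
  have hex : ∀ i, ∃ (Γ : Fin i → Matrix (Fin q) (Fin p) ℝ) (K : Matrix (Fin q) (Fin q) ℝ),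
      K.PosSemidef ∧ (i ≤ n → ch.MatchesAt P i Γ K) := by
    intro i
    by_cases hi : i ≤ n
    · obtain ⟨Γ, K, hK, hm⟩ := ch.exists_matchesAt P (hA i hi)
        (ch.memLp_outputs P fun k hk => hA k (by omega))
      exact ⟨Γ, K, hK, fun _ => hm⟩
    -- Coefficients beyond the horizon are never used.
    · exact ⟨0, 0, Matrix.PosSemidef.zero, fun h => absurd h hi⟩
  choose Γ K hK hm using hex
  exact ⟨⟨Γ, K, hK⟩, hm⟩

end GaussianChannel

namespace LinearStrategy

variable {θ : LinearStrategy p q} {ch : GaussianChannel p q} {P P' : InputPolicy p q} {n : ℕ}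

/-- The cost is quadratic, hence a function of the second moments, which `θ` determines. -/
theorem Matches.avgCost_eq (hP : θ.Matches ch P n) (hP' : θ.Matches ch P' n) :
    ch.avgCost P n = ch.avgCost P' n := by
  unfold GaussianChannel.avgCost
  congr 1
  refine Finset.sum_congr rfl fun i _ => ?_
  have hi : (i : ℕ) ≤ n := by omega
  rw [GaussianChannel.lintegral_stageCost, GaussianChannel.lintegral_stageCost]
  congr 1
  · refine lintegral_quadForm_congr (by fun_prop) (by fun_prop) (ch.posDef_R i).posSemidef
      fun α => ?_
    have h := (hP.lintegral_input_sq hi α 0).trans (hP'.lintegral_input_sq hi α 0).symm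
    simpa using h
  · refine lintegral_quadForm_congr (by fun_prop) (by fun_prop) (ch.posSemidef_Q i) fun β => ?_
    have h := (hP.lintegral_sq (i := i) (by omega) fun j l => β (j, l)).trans
      (hP'.lintegral_sq (i := i) (by omega) fun j l => β (j, l)).symm
    simpa only [pairing, dotProduct, Fintype.sum_prod_type] using h

end LinearStrategy

/-! ### Output laws as Gaussian chains, and the chain rule for their divergence. -/

/-- Appending a last entry to a finite sequence. -/
def snocMeasurableEquiv (E : Type*) [MeasurableSpace E] (k : ℕ) :
    (Fin k → E) × E ≃ᵐ (Fin (k + 1) → E) where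
  toFun x := Fin.snoc (α := fun _ => E) x.1 x.2
  invFun y := (fun j => y j.castSucc, y (Fin.last k))
  left_inv x := by simp
  right_inv y := Fin.snoc_init_self (α := fun _ => E) y
  measurable_toFun := measurable_finSnoc
  measurable_invFun := by
    change Measurable fun y : Fin (k + 1) → E => (fun j : Fin k => y j.castSucc, y (Fin.last k))
    fun_prop

theorem snocMeasurableEquiv_apply {E : Type*} [MeasurableSpace E] {k : ℕ} (x : (Fin k → E) × E) :
    snocMeasurableEquiv E k x = Fin.snoc (α := fun _ => E) x.1 x.2 := rfl

theorem outputs_snoc {k : ℕ} (h : Path p q k) (y : Vec q × Vec p) :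
    outputs (Fin.snoc h y : Path p q (k + 1)) = snocMeasurableEquiv (Vec p) k (outputs h, y.2) := by
  ext1 j
  induction j using Fin.lastCases with
  | last => simp [outputs, snocMeasurableEquiv_apply]
  | cast j => simp [outputs, snocMeasurableEquiv_apply]

/-- The law of `b_i = m_i(b_0, …, b_{i-1}) + w_i` with independent `w_i ∼ N(0, S_i)`. -/
noncomputable def chainLaw (m : (i : ℕ) → (Fin i → Vec p) → Vec p)
    (S : ℕ → Matrix (Fin p) (Fin p) ℝ) : (k : ℕ) → Measure (Fin k → Vec p)
  | 0 => Measure.dirac Fin.elim0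
  | k + 1 => (chainLaw m S k ⊗ₘ addNoise (multivariateGaussian 0 (S k)) (m k)).map
      (snocMeasurableEquiv (Vec p) k)

theorem isProbabilityMeasure_chainLaw {m : (i : ℕ) → (Fin i → Vec p) → Vec p}
    (hm : ∀ i, Measurable (m i)) (S : ℕ → Matrix (Fin p) (Fin p) ℝ) (k : ℕ) :
    IsProbabilityMeasure (chainLaw m S k) := by
  induction k with
  | zero => unfold chainLaw; infer_instance
  | succ k ih =>
    unfold chainLaw
    have := isMarkovKernel_addNoise (ρ := multivariateGaussian 0 (S k)) (hm k)
    exact Measure.isProbabilityMeasure_map (MeasurableEquiv.measurable _).aemeasurable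

theorem map_mulVecE_add_multivariateGaussian {D : Matrix (Fin p) (Fin q) ℝ}
    {K : Matrix (Fin q) (Fin q) ℝ} {K' : Matrix (Fin p) (Fin p) ℝ} (hK : K.PosSemidef)
    (hK' : K'.PosSemidef) :
    ((multivariateGaussian 0 K).prod (multivariateGaussian 0 K')).map
      (fun x => mulVecE D x.1 + x.2) = multivariateGaussian 0 (D * K * Dᵀ + K') := by
  have hS : (D * K * Dᵀ + K').PosSemidef := by
    refine Matrix.PosSemidef.add ?_ hK'
    simpa using hK.mul_mul_conjTranspose_same D
  have h1 : ((multivariateGaussian 0 K).prod (multivariateGaussian 0 K')).map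
      (fun x => mulVecE D x.1 + x.2) =
      ((multivariateGaussian 0 K).map (mulVecE D)) ∗ (multivariateGaussian 0 K') := by
    rw [Measure.conv]
    conv_rhs => rw [← Measure.map_id (μ := multivariateGaussian 0 K')]
    rw [Measure.map_prod_map _ _ (by fun_prop) (by fun_prop),
      Measure.map_map (by fun_prop) (by fun_prop)]
    rfl
  have := Measure.isProbabilityMeasure_map (μ := multivariateGaussian 0 K)
    (measurable_mulVecE D).aemeasurable
  rw [h1]
  refine Measure.ext_of_charFun (funext fun t => ?_)
  have h2 : charFun ((multivariateGaussian 0 K).map (mulVecE D)) t =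
      charFun (multivariateGaussian 0 K) (mulVecE Dᵀ t) := by
    rw [charFun_apply, charFun_apply, integral_map (by fun_prop) (by fun_prop)]
    refine integral_congr_ae (.of_forall fun x => ?_)
    have : inner ℝ (mulVecE D x) t = inner ℝ x (mulVecE Dᵀ t) := by
      simp only [mulVecE, EuclideanSpace.inner_eq_star_dotProduct, star_trivial]
      rw [mulVec_transpose, dotProduct_mulVec]
    simp only [this]
  rw [charFun_conv, h2, charFun_multivariateGaussian hK, charFun_multivariateGaussian hK',
    charFun_multivariateGaussian hS, ← Complex.exp_add]
  congr 1
  have h3 : t.ofLp ⬝ᵥ (D * K * Dᵀ + K') *ᵥ t.ofLp =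
      (mulVecE Dᵀ t).ofLp ⬝ᵥ K *ᵥ (mulVecE Dᵀ t).ofLp + t.ofLp ⬝ᵥ K' *ᵥ t.ofLp := by
    simp only [mulVecE]
    rw [add_mulVec, dotProduct_add, ← mulVec_mulVec, ← mulVec_mulVec, dotProduct_mulVec,
      mulVec_transpose]
  rw [h3]
  push_cast
  simp
  ring

namespace GaussianChannel

variable (ch : GaussianChannel p q) (P : InputPolicy p q)

/-- The law of the first `k` outputs. -/
noncomputable def outLaw (k : ℕ) : Measure (Fin k → Vec p) := (ch.jointLaw P k).map outputs

instance (k : ℕ) : IsProbabilityMeasure (ch.outLaw P k) :=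
  Measure.isProbabilityMeasure_map (by fun_prop)

theorem outputLaw_eq_outLaw (n : ℕ) : ch.outputLaw P n = ch.outLaw P (n + 1) := rfl

/-- The joint law of the outputs before time `i` and of the output at time `i`. -/
noncomputable def pairLaw (i : ℕ) : Measure ((Fin i → Vec p) × Vec p) :=
  (ch.inputLaw P i ⊗ₘ ch.kernel i).map fun z => (outputs z.1.1, z.2)

instance (k : ℕ) : IsProbabilityMeasure (ch.pairLaw P k) :=
  Measure.isProbabilityMeasure_map (by fun_prop)

theorem map_outputAt_jointLaw {k : ℕ} (i : Fin k) :
    (ch.jointLaw P k).map (fun ω => (outputsBefore i ω, outputAt i ω)) = ch.pairLaw P i := by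
  rw [pairLaw, ← map_splitAt_jointLaw, Measure.map_map (by fun_prop) (by fun_prop)]
  rfl

theorem map_outputsBefore_jointLaw {k : ℕ} (i : Fin k) :
    (ch.jointLaw P k).map (outputsBefore i) = ch.outLaw P i := by
  rw [outLaw, ← ch.map_fst_inputLaw P i]
  have h : (ch.inputLaw P i ⊗ₘ ch.kernel i).map Prod.fst = ch.inputLaw P i :=
    Measure.fst_compProd _ _
  rw [← h, ← map_splitAt_jointLaw, Measure.map_map (by fun_prop) (by fun_prop),
    Measure.map_map (by fun_prop) (by fun_prop), Measure.map_map (by fun_prop) (by fun_prop)]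
  rfl

theorem outLaw_succ (k : ℕ) :
    ch.outLaw P (k + 1) = (ch.pairLaw P k).map (snocMeasurableEquiv (Vec p) k) := by
  rw [outLaw, pairLaw, jointLaw_succ, Measure.map_map (by fun_prop) (measurable_snoc_path k),
    Measure.map_map (by fun_prop) (by fun_prop)]
  congr 1
  ext1 z
  exact outputs_snoc _ _

theorem fst_pairLaw (i : ℕ) : (ch.pairLaw P i).fst = ch.outLaw P i := by
  have h : (ch.inputLaw P i ⊗ₘ ch.kernel i).map Prod.fst = ch.inputLaw P i :=
    Measure.fst_compProd _ _
  rw [outLaw, ← map_fst_inputLaw, ← h, pairLaw, Measure.fst,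
    Measure.map_map (by fun_prop) (by fun_prop),
    Measure.map_map (by fun_prop) (by fun_prop), Measure.map_map (by fun_prop) (by fun_prop)]
  rfl

/-- Chain rule for the divergence of the output law from a reference law. -/
theorem klDiv_outLaw_chainLaw {m : (i : ℕ) → (Fin i → Vec p) → Vec p}
    (hm : ∀ i, Measurable (m i)) (S : ℕ → Matrix (Fin p) (Fin p) ℝ) (k : ℕ) :
    InformationTheory.klDiv (ch.outLaw P k) (chainLaw m S k) =
      ∑ i ∈ Finset.range k, InformationTheory.klDiv (ch.pairLaw P i)
        (ch.outLaw P i ⊗ₘ addNoise (multivariateGaussian 0 (S i)) (m i)) := by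
  induction k with
  | zero =>
    rw [Finset.sum_range_zero, outLaw, jointLaw, Measure.map_dirac' (by fun_prop), chainLaw,
      show outputs (Fin.elim0 : Path p q 0) = Fin.elim0 from funext fun j => j.elim0,
      InformationTheory.klDiv_self]
  | succ k ih =>
    have := isProbabilityMeasure_chainLaw hm S k
    have := isMarkovKernel_addNoise (ρ := multivariateGaussian 0 (S k)) (hm k)
    rw [Finset.sum_range_succ, outLaw_succ, chainLaw, klDiv_map_measurableEquiv, ← ih]
    -- For general P the conditional law of the output is not explicit; any disintegration serves in
    -- the chain rule.
    have h : ch.outLaw P k ⊗ₘ (ch.pairLaw P k).condKernel = ch.pairLaw P k := by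
      rw [← fst_pairLaw]
      exact Measure.disintegrate _ _
    rw [← h, InformationTheory.klDiv_compProd_eq_add]

end GaussianChannel

namespace LinearStrategy

variable (θ : LinearStrategy p q) (ch : GaussianChannel p q)

/-- The conditional mean of the output of the closed loop given the past outputs. -/
def loopMean (i : ℕ) (b : Fin i → Vec p) : Vec p := ∑ j, mulVecE (θ.loopGain ch i j) (b j)

@[fun_prop]
theorem measurable_loopMean (i : ℕ) : Measurable (θ.loopMean ch i) := by
  unfold loopMean; fun_prop

theorem mulVecE_add_mul {a b c : ℕ} (M : Matrix (Fin a) (Fin b) ℝ) (N : Matrix (Fin a) (Fin c) ℝ)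
    (L : Matrix (Fin c) (Fin b) ℝ) (x : Vec b) :
    mulVecE (M + N * L) x = mulVecE M x + mulVecE N (mulVecE L x) := by
  simp [mulVecE, add_mulVec, ← mulVec_mulVec]

theorem mulVecE_add {a b : ℕ} (M : Matrix (Fin a) (Fin b) ℝ) (x y : Vec b) :
    mulVecE M (x + y) = mulVecE M x + mulVecE M y :=
  (Matrix.toEuclideanLin M).map_add x y

theorem mulVecE_sum {a b : ℕ} {ι : Type*} (s : Finset ι) (M : Matrix (Fin a) (Fin b) ℝ)
    (x : ι → Vec b) : mulVecE M (∑ j ∈ s, x j) = ∑ j ∈ s, mulVecE M (x j) :=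
  map_sum (Matrix.toEuclideanLin M) x s

theorem mean_inputMean_add (i : ℕ) (b : Fin i → Vec p) (z : Vec q) :
    ch.mean i (b, θ.inputMean i b + z) = θ.loopMean ch i b + mulVecE (ch.D i) z := by
  simp only [GaussianChannel.mean, inputMean, loopMean, loopGain, mulVecE_add_mul,
    mulVecE_add, mulVecE_sum, Finset.sum_add_distrib]
  abel

/-- Inserting the strategy into the channel leaves the gains C + D Γ and the innovation D Z + V, a
Gaussian independent of the past. -/
theorem pairLaw_policy (i : ℕ) :
    ch.pairLaw θ.policy i = ch.outLaw θ.policy i ⊗ₘ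
      addNoise (multivariateGaussian 0 (θ.innovCov ch i)) (θ.loopMean ch i) := by
  have := isMarkovKernel_addNoise (ρ := multivariateGaussian 0 (θ.innovCov ch i))
    (θ.measurable_loopMean ch i)
  refine Measure.ext_of_lintegral _ fun f hf => ?_
  have hfm : Measurable fun x : Path p q i × Vec q =>
      ∫⁻ y, f (outputs x.1, y) ∂(ch.kernel i x) :=
    Measurable.lintegral_kernel_prod_right'
      (f := fun x : (Path p q i × Vec q) × Vec p => f (outputs x.1.1, x.2)) (by fun_prop)
  rw [GaussianChannel.pairLaw, lintegral_map hf (by fun_prop),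
    Measure.lintegral_compProd (by fun_prop), Measure.lintegral_compProd hf,
    GaussianChannel.outLaw, lintegral_map (by fun_prop) (by fun_prop), inputLaw_policy]
  rw [lintegral_map hfm (by fun_prop), lintegral_prod]
  · refine lintegral_congr fun h => ?_
    rw [addNoise_apply (by fun_prop), lintegral_map (by fun_prop) (by fun_prop), innovCov,
      ← map_mulVecE_add_multivariateGaussian (θ.posSemidef_KZ i) (ch.posDef_KV i).posSemidef,
      lintegral_map (by fun_prop) (by fun_prop), lintegral_prod _ (by fun_prop)]
    refine lintegral_congr fun z => ?_
    rw [ch.lintegral_kernel i _ (f := fun y => f (outputs h, y)) (by fun_prop)]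
    refine lintegral_congr fun v => ?_
    simp only [mean_inputMean_add, add_assoc]
  · exact (hfm.comp (g := fun x : Path p q i × Vec q =>
      ∫⁻ y, f (outputs x.1, y) ∂(ch.kernel i x)) (by fun_prop)).aemeasurable

theorem outLaw_policy (k : ℕ) :
    ch.outLaw θ.policy k = chainLaw (θ.loopMean ch) (θ.innovCov ch) k := by
  induction k with
  | zero =>
    rw [GaussianChannel.outLaw, GaussianChannel.jointLaw, Measure.map_dirac' (by fun_prop),
      chainLaw, show outputs (Fin.elim0 : Path p q 0) = Fin.elim0 from funext fun j => j.elim0]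
  | succ k ih => rw [GaussianChannel.outLaw_succ, pairLaw_policy, ih, chainLaw]

end LinearStrategy

/-! ### The information balance and the upper bound on directed information. -/

namespace LinearStrategy

variable {θ : LinearStrategy p q} {ch : GaussianChannel p q} {P : InputPolicy p q} {n : ℕ}

/-- The rate `(1/2) log (|D K_Z Dᵀ + K_V| / |K_V|)` at time `i`. -/
noncomputable def stageRate (θ : LinearStrategy p q) (ch : GaussianChannel p q) (i : ℕ) : ℝ :=
  1 / 2 * Real.log ((θ.innovCov ch i).det / (ch.KV i).det)

theorem logDetRate_eq_sum (θ : LinearStrategy p q) (ch : GaussianChannel p q) (n : ℕ) :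
    θ.logDetRate ch n = ∑ i ∈ Finset.range (n + 1), θ.stageRate ch i := by
  rw [logDetRate, Finset.mul_sum]
  rfl

/-- Even for non-Gaussian P, subtracting the closed-loop mean cancels the C terms and leaves D (A -
Γ B) + V, whose second moments are fixed by matching. -/
theorem Matches.lintegral_innov_sq (hP : θ.Matches ch P n) {i : ℕ} (hi : i ≤ n) (β : Fin p → ℝ) :
    ∫⁻ x, ENNReal.ofReal ((β ⬝ᵥ (ch.mean i (outputs x.1.1, x.1.2) + x.2 -
      θ.loopMean ch i (outputs x.1.1)).ofLp) ^ 2)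
        ∂((ch.inputLaw P i).prod (multivariateGaussian 0 (ch.KV i))) =
      ENNReal.ofReal (β ⬝ᵥ θ.innovCov ch i *ᵥ β) := by
  have hnn : 0 ≤ β ⬝ᵥ ch.KV i *ᵥ β := by
    simpa using (ch.posDef_KV i).posSemidef.dotProduct_mulVec_nonneg β
  rw [lintegral_prod _ (by simp only [dotProduct]; fun_prop)]
  have h1 : ∀ x : Path p q i × Vec q, ∫⁻ v, ENNReal.ofReal ((β ⬝ᵥ
      (ch.mean i (outputs x.1, x.2) + v - θ.loopMean ch i (outputs x.1)).ofLp) ^ 2)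
        ∂(multivariateGaussian 0 (ch.KV i)) =
      ENNReal.ofReal ((((ch.D i)ᵀ *ᵥ β) ⬝ᵥ x.2.ofLp +
        pairing (fun j => -((θ.Γ i j)ᵀ *ᵥ (ch.D i)ᵀ *ᵥ β)) (outputs x.1)) ^ 2) +
      ENNReal.ofReal (β ⬝ᵥ ch.KV i *ᵥ β) := by
    intro x
    rw [← ENNReal.ofReal_add (sq_nonneg _) hnn,
      ← lintegral_sq_add_multivariateGaussian (ch.posDef_KV i).posSemidef]
    refine lintegral_congr fun v => ?_
    congr 2
    rw [WithLp.ofLp_sub, WithLp.ofLp_add, dotProduct_sub, dotProduct_add,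
      GaussianChannel.dotProduct_mean, loopMean, dotProduct_sum_mulVecE]
    have h2 : (fun j => (θ.loopGain ch i j)ᵀ *ᵥ β) = (fun j => (ch.C i j)ᵀ *ᵥ β) +
        fun j => (θ.Γ i j)ᵀ *ᵥ (ch.D i)ᵀ *ᵥ β := by
      ext1 j
      rw [loopGain, transpose_add, transpose_mul, add_mulVec, ← mulVec_mulVec]
      rfl
    have h3 : pairing (fun j => -((θ.Γ i j)ᵀ *ᵥ (ch.D i)ᵀ *ᵥ β)) (outputs x.1) =
        -pairing (fun j => (θ.Γ i j)ᵀ *ᵥ (ch.D i)ᵀ *ᵥ β) (outputs x.1) := pairing_neg _ _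
    rw [h2, pairing_add, h3]
    ring
  simp only [h1]
  rw [lintegral_add_right _ measurable_const, lintegral_const, measure_univ, mul_one, hP i hi]
  -- The past outputs drop out: what remains of the input is its regression residual.
  have h4 : (fun j => -((θ.Γ i j)ᵀ *ᵥ (ch.D i)ᵀ *ᵥ β) + (θ.Γ i j)ᵀ *ᵥ (ch.D i)ᵀ *ᵥ β) = 0 := by
    ext1 j
    simp
  have h5 : ((ch.D i)ᵀ *ᵥ β) ⬝ᵥ θ.KZ i *ᵥ (ch.D i)ᵀ *ᵥ β =
      β ⬝ᵥ (ch.D i * θ.KZ i * (ch.D i)ᵀ) *ᵥ β := by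
    rw [← mulVec_mulVec, ← mulVec_mulVec, dotProduct_mulVec β, mulVec_transpose]
  simp only [h4, pairing_zero]
  rw [h5, innovCov, add_mulVec, dotProduct_add, ENNReal.ofReal_add _ hnn]
  · simp
  · rw [← h5]
    exact dotProduct_KZ_nonneg _ _ _

theorem Matches.lintegral_innov_quadForm (hP : θ.Matches ch P n) {i : ℕ} (hi : i ≤ n) :
    ∫⁻ x, ENNReal.ofReal ((ch.mean i (outputs x.1.1, x.1.2) + x.2 -
        θ.loopMean ch i (outputs x.1.1)).ofLp ⬝ᵥ (θ.innovCov ch i)⁻¹ *ᵥ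
        (ch.mean i (outputs x.1.1, x.1.2) + x.2 - θ.loopMean ch i (outputs x.1.1)).ofLp)
        ∂((ch.inputLaw P i).prod (multivariateGaussian 0 (ch.KV i))) = ENNReal.ofReal p := by
  have hS := θ.posDef_innovCov ch i
  rw [lintegral_quadForm (by fun_prop) hS.inv.posSemidef hS.posSemidef (hP.lintegral_innov_sq hi),
    nonsing_inv_mul _ hS.det_pos.ne'.isUnit]
  simp

/-- The information gained at time `i` falls short of the rate of `θ` by the divergence of the output
law from that of `θ`. -/
theorem Matches.condMutualInfo_add_klDiv (hP : θ.Matches ch P n) (i : Fin (n + 1)) :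
    InformationTheory.klDiv (ch.pairLaw P i) (ch.outLaw P i ⊗ₘ
        addNoise (multivariateGaussian 0 (θ.innovCov ch i)) (θ.loopMean ch i)) +
      condMutualInfo (ch.jointLaw P (n + 1)) (inputsUpTo i) (outputAt i) (outputsBefore i) =
      ENNReal.ofReal (θ.stageRate ch i) ∧ 0 ≤ θ.stageRate ch i := by
  have hi : (i : ℕ) ≤ n := by omega
  have hγ := isMarkovKernel_addNoise (ρ := multivariateGaussian 0 (θ.innovCov ch i))
    (θ.measurable_loopMean ch i)
  have hU : Measurable (inputsUpTo i : Path p q (n + 1) → _) := by unfold inputsUpTo; fun_prop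
  have hX : Measurable (outputAt i : Path p q (n + 1) → _) := by unfold outputAt; fun_prop
  have hW : Measurable (outputsBefore i : Path p q (n + 1) → _) := by unfold outputsBefore; fun_prop
  -- The channel sees its past only through the outputs and the current input, so its kernel factors
  -- through (B^{i-1}, A^i). This makes the conditional law of B_i given these variables explicit.
  let g : Path p q i × Vec q → (Fin i → Vec p) × (Fin (i + 1) → Vec q) :=
    fun x => (outputs x.1, allInputs x)
  have hg : Measurable g := by fun_prop
  let m : (Fin i → Vec p) × (Fin (i + 1) → Vec q) → Vec p :=
    fun x => ch.mean i (x.1, x.2 (Fin.last i))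
  have hm : Measurable m := by fun_prop
  have := isMarkovKernel_addNoise (ρ := multivariateGaussian 0 (ch.KV i)) hm
  have hmg : ∀ x, m (g x) = ch.mean i (outputs x.1, x.2) := fun x => by
    simp [m, g, allInputs]
  have hker : ch.kernel i = (addNoise (multivariateGaussian 0 (ch.KV i)) m).comap g hg := by
    rw [addNoise_comp hg hm, GaussianChannel.kernel_eq_addNoise]
    congr 1
    ext1 x
    exact (hmg x).symm
  have hWU : (ch.jointLaw P (n + 1)).map (fun ω => (outputsBefore i ω, inputsUpTo i ω)) =
      (ch.inputLaw P i).map g := by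
    have h : (ch.inputLaw P i ⊗ₘ ch.kernel i).map Prod.fst = ch.inputLaw P i :=
      Measure.fst_compProd _ _
    rw [← h, ← GaussianChannel.map_splitAt_jointLaw, Measure.map_map (by fun_prop) (by fun_prop),
      Measure.map_map (by fun_prop) (by fun_prop)]
    congr 1
    ext1 ω
    rw [inputsUpTo_eq]
    rfl
  have hWUX : (ch.jointLaw P (n + 1)).map
      (fun ω => ((outputsBefore i ω, inputsUpTo i ω), outputAt i ω)) =
      ((ch.inputLaw P i).map g) ⊗ₘ addNoise (multivariateGaussian 0 (ch.KV i)) m := by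
    rw [← map_compProd_comap _ hg, ← hker, ← GaussianChannel.map_splitAt_jointLaw,
      Measure.map_map (by fun_prop) (by fun_prop)]
    congr 1
    ext1 ω
    rw [inputsUpTo_eq]
    rfl
  have hpr : IsProbabilityMeasure ((ch.inputLaw P i).map g) :=
    Measure.isProbabilityMeasure_map hg.aemeasurable
  have key := klDiv_compProd_addNoise_gaussian ((ch.inputLaw P i).map g) hm
    (m₂ := fun x => θ.loopMean ch i x.1) (by fun_prop) (ch.posDef_KV i) (θ.posDef_innovCov ch i) (by
      have hprod : ((ch.inputLaw P i).map g).prod (multivariateGaussian 0 (ch.KV i)) =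
          ((ch.inputLaw P i).prod (multivariateGaussian 0 (ch.KV i))).map (Prod.map g id) := by
        conv_lhs => rw [← Measure.map_id (μ := multivariateGaussian 0 (ch.KV i))]
        rw [Measure.map_prod_map _ _ hg measurable_id]
      rw [hprod, lintegral_map (by simp only [dotProduct, mulVec]; fun_prop) (by fun_prop)]
      simp only [Prod.map_fst, Prod.map_snd, id, hmg]
      exact hP.lintegral_innov_quadForm hi)
  refine ⟨?_, key.2⟩
  -- The divergence evaluated in `key` is now decomposed by the chain rule, with the closed-loop
  -- kernel of `θ` as reference.
  have hsplit := klDiv_eq_condMutualInfo_add (ch.jointLaw P (n + 1)) hU hX hW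
    (addNoise (multivariateGaussian 0 (θ.innovCov ch i)) (θ.loopMean ch i))
  rw [hWU, hWUX, addNoise_comp measurable_fst (θ.measurable_loopMean ch i),
    GaussianChannel.map_outputAt_jointLaw, GaussianChannel.map_outputsBefore_jointLaw] at hsplit
  rw [← hsplit]
  exact key.1

/-- The rate is the value of a divergence, taken here with horizon i. -/
theorem stageRate_nonneg (θ : LinearStrategy p q) (ch : GaussianChannel p q) (i : ℕ) :
    0 ≤ θ.stageRate ch i :=
  ((θ.matches_policy ch i).condMutualInfo_add_klDiv (Fin.last i)).2

theorem logDetRate_nonneg (θ : LinearStrategy p q) (ch : GaussianChannel p q) (n : ℕ) :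
    0 ≤ θ.logDetRate ch n := by
  rw [logDetRate_eq_sum]
  exact Finset.sum_nonneg fun i _ => stageRate_nonneg _ _ _

/-- The stage balances add up by the chain rule for divergence. Bound, equality case and entropy
formula all come from this identity. -/
theorem Matches.klDiv_add_directedInfo (hP : θ.Matches ch P n) :
    InformationTheory.klDiv (ch.outputLaw P n) (ch.outputLaw θ.policy n) +
      ch.directedInfo P n = ENNReal.ofReal (θ.logDetRate ch n) := by
  rw [GaussianChannel.outputLaw_eq_outLaw, GaussianChannel.outputLaw_eq_outLaw, outLaw_policy,
    GaussianChannel.klDiv_outLaw_chainLaw _ _ (θ.measurable_loopMean ch), Finset.sum_range,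
    GaussianChannel.directedInfo, ← Finset.sum_add_distrib, logDetRate_eq_sum,
    ENNReal.ofReal_sum_of_nonneg fun i _ => stageRate_nonneg _ _ _, Finset.sum_range]
  exact Finset.sum_congr rfl fun i _ => (hP.condMutualInfo_add_klDiv i).1

theorem directedInfo_policy (θ : LinearStrategy p q) (ch : GaussianChannel p q) (n : ℕ) :
    ch.directedInfo θ.policy n = ENNReal.ofReal (θ.logDetRate ch n) := by
  have h := (θ.matches_policy ch n).klDiv_add_directedInfo
  have : IsProbabilityMeasure (ch.outputLaw θ.policy n) :=
    inferInstanceAs (IsProbabilityMeasure (ch.outLaw θ.policy (n + 1)))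
  rwa [InformationTheory.klDiv_self, zero_add] at h

theorem coe_directedInfo_policy (θ : LinearStrategy p q) (ch : GaussianChannel p q) (n : ℕ) :
    (ch.directedInfo θ.policy n : EReal) = (θ.logDetRate ch n : EReal) := by
  rw [directedInfo_policy, EReal.coe_ennreal_ofReal, max_eq_left (logDetRate_nonneg _ _ _)]

theorem Matches.directedInfo_le (hP : θ.Matches ch P n) :
    ch.directedInfo P n ≤ ch.directedInfo θ.policy n := by
  rw [directedInfo_policy, ← hP.klDiv_add_directedInfo]
  exact le_add_self

/-- If P loses nothing against `θ`, finiteness of the directed information lets it be cancelled, and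
the divergence of the output laws is zero. -/
theorem Matches.outputLaw_eq (hP : θ.Matches ch P n)
    (h : ch.directedInfo θ.policy n ≤ ch.directedInfo P n) :
    ch.outputLaw P n = ch.outputLaw θ.policy n := by
  have h1 := hP.klDiv_add_directedInfo
  rw [directedInfo_policy] at h
  have hP' : IsProbabilityMeasure (ch.outputLaw P n) :=
    inferInstanceAs (IsProbabilityMeasure (ch.outLaw P (n + 1)))
  have hθ : IsProbabilityMeasure (ch.outputLaw θ.policy n) :=
    inferInstanceAs (IsProbabilityMeasure (ch.outLaw θ.policy (n + 1)))
  rw [← InformationTheory.klDiv_eq_zero_iff]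
  have hfin : ch.directedInfo P n ≠ ∞ := by
    intro htop
    rw [htop, add_top] at h1
    exact ENNReal.ofReal_ne_top h1.symm
  have h2 : InformationTheory.klDiv (ch.outputLaw P n) (ch.outputLaw θ.policy n) +
      ch.directedInfo P n ≤ 0 + ch.directedInfo P n := by rwa [h1, zero_add]
  exact le_antisymm ((ENNReal.add_le_add_iff_right hfin).1 h2) zero_le

theorem Matches.mem_feasible (hP : θ.Matches ch P n) {κ : ℝ≥0} (h : P ∈ ch.feasible n κ) :
    θ ∈ LinearStrategy.feasible ch n κ :=
  ((θ.matches_policy ch n).avgCost_eq hP).trans_le h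

end LinearStrategy

namespace GaussianChannel

variable (ch : GaussianChannel p q) (n : ℕ) (κ : ℝ≥0)

variable {ch n κ} in
theorem exists_matches_of_mem_feasible {P : InputPolicy p q} (hP : P ∈ ch.feasible n κ) :
    ∃ θ ∈ LinearStrategy.feasible ch n κ, θ.Matches ch P n := by
  obtain ⟨θ, hθ⟩ := ch.exists_matches P (ne_top_of_le_ne_top ENNReal.coe_ne_top hP)
  exact ⟨θ, hθ.mem_feasible hP, hθ⟩

theorem capacity_eq_iSup_logDetRate :
    ch.capacity n κ = ⨆ θ ∈ LinearStrategy.feasible ch n κ, (θ.logDetRate ch n : EReal) := by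
  refine le_antisymm (iSup₂_le fun P hP => ?_) (iSup₂_le fun θ hθ => ?_)
  · obtain ⟨θ, hθ, hm⟩ := exists_matches_of_mem_feasible hP
    refine le_iSup₂_of_le θ hθ ?_
    rw [← θ.coe_directedInfo_policy]
    exact EReal.coe_ennreal_le_coe_ennreal_iff.2 hm.directedInfo_le
  · rw [← θ.coe_directedInfo_policy]
    exact le_iSup₂_of_le (f := fun P (_ : P ∈ ch.feasible n κ) => (ch.directedInfo P n : EReal))
      θ.policy hθ le_rfl

end GaussianChannel

/-! ### Recovering the law of the effective input from the output law. -/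

section Deconvolution

/-- A Gaussian characteristic function never vanishes, so it can be divided out. The Gaussian law
may be degenerate. -/
theorem eq_of_conv_gaussian_eq {E : Type*} [NormedAddCommGroup E] [NormedSpace ℝ E]
    [MeasurableSpace E] [BorelSpace E] [SecondCountableTopology E] [CompleteSpace E]
    {μ ν ρ : Measure E} [IsFiniteMeasure μ] [IsFiniteMeasure ν] [IsGaussian ρ]
    (h : μ ∗ ρ = ν ∗ ρ) : μ = ν := by
  refine Measure.ext_of_charFunDual (funext fun L => ?_)
  have h1 := congrFun (congrArg charFunDual h) L
  rw [charFunDual_conv, charFunDual_conv] at h1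
  refine mul_right_cancel₀ ?_ h1
  rw [IsGaussian.charFunDual_eq]
  exact Complex.exp_ne_zero _

end Deconvolution

namespace GaussianChannel

variable (ch : GaussianChannel p q) (P P' : InputPolicy p q)

theorem map_mulVecE_inputAt {k : ℕ} (i : Fin k) :
    (ch.jointLaw P k).map (fun ω => (outputsBefore i ω, mulVecE (ch.D i) (inputAt i ω))) =
      (ch.inputLaw P i).map fun x => (outputs x.1, mulVecE (ch.D i) x.2) := by
  have h : (ch.inputLaw P i ⊗ₘ ch.kernel i).map Prod.fst = ch.inputLaw P i :=
    Measure.fst_compProd _ _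
  rw [← h, ← map_splitAt_jointLaw, Measure.map_map (by fun_prop) (by fun_prop),
    Measure.map_map (by fun_prop) (by fun_prop)]
  rfl

/-- Removing the C terms leaves D A_i + V_i. The noise is independent of (B^{i-1}, A_i), so this is
a convolution with a Gaussian carried by the second factor. -/
theorem map_sub_pairLaw (i : ℕ) :
    (ch.pairLaw P i).map (fun x => (x.1, x.2 - ∑ j, mulVecE (ch.C i j) (x.1 j))) =
      ((ch.inputLaw P i).map fun x => (outputs x.1, mulVecE (ch.D i) x.2)) ∗
        ((multivariateGaussian 0 (ch.KV i)).map
          (ContinuousLinearMap.inr ℝ (Fin i → Vec p) (Vec p))) := by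
  rw [Measure.conv, Measure.map_prod_map _ _ (by fun_prop) (by fun_prop),
    Measure.map_map (by fun_prop) (by fun_prop), pairLaw, kernel_eq_addNoise,
    compProd_addNoise _ (by fun_prop), Measure.map_map (by fun_prop) (by fun_prop),
    Measure.map_map (by fun_prop) (by fun_prop)]
  congr 1
  ext1 x
  simp only [Function.comp_apply, Prod.map_fst, Prod.map_snd, mean,
    ContinuousLinearMap.inr_apply, Prod.mk_add_mk, add_zero]
  congr 1
  abel

variable {ch P P'} in
theorem map_mulVecE_eq_of_outputLaw_eq {n : ℕ} (h : ch.outputLaw P n = ch.outputLaw P' n)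
    (i : Fin (n + 1)) :
    (ch.jointLaw P (n + 1)).map
        (fun ω => (outputsBefore i ω, mulVecE (ch.D i) (inputAt i ω))) =
      (ch.jointLaw P' (n + 1)).map
        (fun ω => (outputsBefore i ω, mulVecE (ch.D i) (inputAt i ω))) := by
  have hpair : ∀ P : InputPolicy p q, ch.pairLaw P i = (ch.outputLaw P n).map
      fun b => ((fun j : Fin i => b (j.castLE i.isLt.le)), b i) := by
    intro P
    rw [← map_outputAt_jointLaw, outputLaw, Measure.map_map (by fun_prop) (by fun_prop)]
    rfl
  have h1 : ch.pairLaw P i = ch.pairLaw P' i := by rw [hpair, hpair, h]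
  have h2 := congrArg (fun μ : Measure ((Fin i → Vec p) × Vec p) =>
    μ.map fun x => (x.1, x.2 - ∑ j, mulVecE (ch.C i j) (x.1 j))) h1
  simp only [map_sub_pairLaw] at h2
  rw [map_mulVecE_inputAt, map_mulVecE_inputAt]
  have : ∀ P : InputPolicy p q, IsProbabilityMeasure ((ch.inputLaw P i).map
      fun x => (outputs x.1, mulVecE (ch.D i) x.2)) :=
    fun P => Measure.isProbabilityMeasure_map (by fun_prop)
  exact eq_of_conv_gaussian_eq h2

end GaussianChannel

/-! ### Differential entropies. -/

section Entropy

/-- The density of ν factors as dν/dG times d, so its logarithm is a sum of two ν-integrable terms.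
No Gaussian assumption on ν is needed. -/
theorem hasDiffEntropy_of_klDiv_ne_top {E : Type*} [MeasureSpace E]
    [SigmaFinite (volume : Measure E)]
    {ν G : Measure E} [IsProbabilityMeasure ν] [IsProbabilityMeasure G] {d : E → ℝ}
    (hd : Measurable d) (hpos : ∀ x, 0 < d x)
    (hG : G = volume.withDensity fun x => ENNReal.ofReal (d x))
    (hkl : InformationTheory.klDiv ν G ≠ ∞) (hint : Integrable (fun x => Real.log (d x)) ν) :
    HasDiffEntropy ν ∧ diffEntropy ν =
      -(∫ x, Real.log (d x) ∂ν) - (InformationTheory.klDiv ν G).toReal := by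
  obtain ⟨hac, hllr⟩ := InformationTheory.klDiv_ne_top_iff.1 hkl
  have hGv : G ≪ volume := hG ▸ withDensity_absolutelyContinuous _ _
  have hνv : ν ≪ volume := hac.trans hGv
  have hlog : (fun x => Real.log (ν.rnDeriv volume x).toReal) =ᵐ[ν]
      fun x => llr ν G x + Real.log (d x) := by
    have h1 := hνv.ae_le (Measure.rnDeriv_mul_rnDeriv (κ := volume) hac)
    have h2 : G.rnDeriv volume =ᵐ[ν] fun x => ENNReal.ofReal (d x) := by
      refine hνv.ae_le ?_
      rw [hG]
      exact Measure.rnDeriv_withDensity _ (by fun_prop)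
    have h3 := Measure.rnDeriv_pos hac
    have h4 := hac.ae_le (Measure.rnDeriv_lt_top ν G)
    filter_upwards [h1, h2, h3, h4] with x h1 h2 h3 h4
    rw [← h1, Pi.mul_apply, h2, ENNReal.toReal_mul, ENNReal.toReal_ofReal (hpos x).le,
      Real.log_mul (ENNReal.toReal_pos h3.ne' h4.ne).ne' (hpos x).ne', llr]
  refine ⟨⟨hνv, (hllr.add hint).congr hlog.symm⟩, ?_⟩
  rw [diffEntropy, integral_congr_ae hlog, integral_add hllr hint,
    InformationTheory.toReal_klDiv_of_measure_eq hac (by simp)]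
  ring

/-- The differential entropy of a Gaussian law with covariance `S` on `ℝ^p`. -/
noncomputable def gaussEntropy (S : Matrix (Fin p) (Fin p) ℝ) : ℝ :=
  Real.log ((2 * Real.pi) ^ p * S.det) / 2 + p / 2

theorem integral_log_gaussDensity {Ω : Type*} [MeasurableSpace Ω] {μ : Measure Ω}
    [IsProbabilityMeasure μ] {S : Matrix (Fin p) (Fin p) ℝ} (hS : S.PosDef) {y : Ω → Vec p}
    (hy : Measurable y)
    (h : ∫⁻ ω, ENNReal.ofReal ((y ω).ofLp ⬝ᵥ S⁻¹ *ᵥ (y ω).ofLp) ∂μ = ENNReal.ofReal p) :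
    Integrable (fun ω => Real.log (gaussDensity S (y ω))) μ ∧
      ∫ ω, Real.log (gaussDensity S (y ω)) ∂μ = -gaussEntropy S := by
  have hy' : Measurable fun ω => (y ω).ofLp := by fun_prop
  have hi := integrable_quadForm_of_lintegral hy' hS.inv.posSemidef h
  have hv := integral_quadForm_of_lintegral hy' hS.inv.posSemidef (by positivity) h
  simp_rw [log_gaussDensity hS]
  refine ⟨(integrable_const _).sub (hi.div_const 2), ?_⟩
  rw [integral_sub (integrable_const _) (hi.div_const 2), integral_div, hv, gaussEntropy]
  simp
  ring

theorem addNoise_gaussian_entropy {α : Type*} [MeasurableSpace α] {m : α → Vec p}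
    (hm : Measurable m) {S : Matrix (Fin p) (Fin p) ℝ} (hS : S.PosDef) (x : α) :
    HasDiffEntropy (addNoise (multivariateGaussian 0 S) m x) ∧
      diffEntropy (addNoise (multivariateGaussian 0 S) m x) = gaussEntropy S := by
  have := isMarkovKernel_addNoise (ρ := multivariateGaussian 0 S) hm
  set G := addNoise (multivariateGaussian 0 S) m x with hGdef
  have hcont := (continuous_gaussDensity S).measurable
  have hG : G = volume.withDensity fun y => ENNReal.ofReal (gaussDensity S (y - m x)) := by
    rw [hGdef, addNoise_apply hm, multivariateGaussian_eq_withDensity hS]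
    have h := map_withDensity_comp (volume : Measure (Vec p)) (T := fun v => m x + v) (by fun_prop)
      (f := fun y => ENNReal.ofReal (gaussDensity S (y - m x))) (by fun_prop)
    simp only [add_sub_cancel_left] at h
    rw [h, map_add_left_eq_self]
  have hq : ∫⁻ y, ENNReal.ofReal ((y - m x).ofLp ⬝ᵥ S⁻¹ *ᵥ (y - m x).ofLp) ∂G =
      ENNReal.ofReal p := by
    rw [hGdef, addNoise_apply hm, lintegral_map (by simp only [dotProduct, mulVec]; fun_prop)
      (by fun_prop)]
    simp only [add_sub_cancel_left]
    exact lintegral_inv_quadForm_gaussian hS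
  obtain ⟨h1, h2⟩ := integral_log_gaussDensity (y := fun y => y - m x) hS (by fun_prop) hq
  have h3 := hasDiffEntropy_of_klDiv_ne_top (by fun_prop) (fun y => gaussDensity_pos hS _) hG
    (by rw [InformationTheory.klDiv_self]; exact ENNReal.zero_ne_top) h1
  refine ⟨h3.1, ?_⟩
  rw [h3.2, h2, InformationTheory.klDiv_self]
  simp

theorem pi_eq_map_snoc {E : Type*} [MeasurableSpace E] {k : ℕ} (μ : Fin (k + 1) → Measure E)
    [∀ i, SigmaFinite (μ i)] :
    Measure.pi μ = ((Measure.pi fun j : Fin k => μ j.castSucc).prod (μ (Fin.last k))).map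
      (snocMeasurableEquiv E k) := by
  refine (Measure.pi_eq fun s hs => ?_)
  have : snocMeasurableEquiv E k ⁻¹' (Set.univ.pi s) =
      (Set.univ.pi fun j : Fin k => s j.castSucc) ×ˢ s (Fin.last k) := by
    ext x
    simp [snocMeasurableEquiv_apply, Set.mem_pi, Fin.forall_fin_succ']
  rw [MeasurableEquiv.map_apply, this, Measure.prod_prod, Measure.pi_pi, Fin.prod_univ_castSucc]

/-- The density of `chainLaw m S k`. -/
noncomputable def chainDensity (m : (i : ℕ) → (Fin i → Vec p) → Vec p)
    (S : ℕ → Matrix (Fin p) (Fin p) ℝ) : (k : ℕ) → (Fin k → Vec p) → ℝ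
  | 0, _ => 1
  | k + 1, b => chainDensity m S k (fun j => b j.castSucc) *
      gaussDensity (S k) (b (Fin.last k) - m k fun j => b j.castSucc)

variable {m : (i : ℕ) → (Fin i → Vec p) → Vec p} {S : ℕ → Matrix (Fin p) (Fin p) ℝ}

theorem chainDensity_pos (hS : ∀ i, (S i).PosDef) (k : ℕ) (b : Fin k → Vec p) :
    0 < chainDensity m S k b := by
  induction k with
  | zero => exact one_pos
  | succ k ih => exact mul_pos (ih _) (gaussDensity_pos (hS k) _)

theorem measurable_chainDensity (hm : ∀ i, Measurable (m i)) (k : ℕ) :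
    Measurable (chainDensity m S k) := by
  induction k with
  | zero => exact measurable_const
  | succ k ih =>
    have := (continuous_gaussDensity (S k)).measurable
    have := hm k
    change Measurable fun b : Fin (k + 1) → Vec p => chainDensity m S k (fun j => b j.castSucc) *
      gaussDensity (S k) (b (Fin.last k) - m k fun j => b j.castSucc)
    fun_prop

theorem chainDensity_snoc (k : ℕ) (x : (Fin k → Vec p) × Vec p) :
    chainDensity m S (k + 1) (snocMeasurableEquiv (Vec p) k x) =
      chainDensity m S k x.1 * gaussDensity (S k) (x.2 - m k x.1) := by
  simp [chainDensity, snocMeasurableEquiv_apply]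

theorem chainLaw_eq_withDensity (hm : ∀ i, Measurable (m i)) (hS : ∀ i, (S i).PosDef) (k : ℕ) :
    chainLaw m S k = volume.withDensity fun b => ENNReal.ofReal (chainDensity m S k b) := by
  induction k with
  | zero =>
    simp only [chainLaw, chainDensity, ENNReal.ofReal_one]
    rw [show (fun _ : Fin 0 → Vec p => (1 : ℝ≥0∞)) = 1 from rfl, withDensity_one, volume_pi,
      Measure.pi_of_empty (x := Fin.elim0)]
  | succ k ih =>
    have h1 := measurable_chainDensity (S := S) hm k
    have h2 := measurable_chainDensity (S := S) hm (k + 1)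
    have h3 := (continuous_gaussDensity (S k)).measurable
    have h4 := hm k
    have := isProbabilityMeasure_chainLaw hm S k
    rw [chainLaw, compProd_addNoise_gaussian _ (hm k) (hS k), ih,
      prod_withDensity_left (by fun_prop), ← withDensity_mul _ (by fun_prop) (by fun_prop)]
    have hvol : (volume : Measure (Fin (k + 1) → Vec p)) =
        ((volume : Measure (Fin k → Vec p)).prod volume).map (snocMeasurableEquiv (Vec p) k) :=
      pi_eq_map_snoc fun _ => volume
    rw [hvol, ← map_withDensity_comp _ (MeasurableEquiv.measurable _) (by fun_prop)]
    congr 2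
    ext1 x
    rw [chainDensity_snoc, Pi.mul_apply, ENNReal.ofReal_mul (chainDensity_pos hS _ _).le]

end Entropy

namespace LinearStrategy

variable {θ : LinearStrategy p q} {ch : GaussianChannel p q} {P : InputPolicy p q} {n : ℕ}

/-- The log-density of the reference chain is quadratic in the outputs, so its mean under P depends
only on the matched moments. -/
theorem Matches.integral_log_chainDensity (hP : θ.Matches ch P n) {k : ℕ} (hk : k ≤ n + 1) :
    Integrable (fun b => Real.log (chainDensity (θ.loopMean ch) (θ.innovCov ch) k b))
        (ch.outLaw P k) ∧
      ∫ b, Real.log (chainDensity (θ.loopMean ch) (θ.innovCov ch) k b) ∂(ch.outLaw P k) =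
        -∑ i ∈ Finset.range k, gaussEntropy (θ.innovCov ch i) := by
  induction k with
  | zero => simp [chainDensity]
  | succ k ih =>
    obtain ⟨ih1, ih2⟩ := ih (by omega)
    have hS := θ.posDef_innovCov ch
    rw [← GaussianChannel.fst_pairLaw, Measure.fst] at ih1 ih2
    have hq : ∫⁻ x, ENNReal.ofReal ((x.2 - θ.loopMean ch k x.1).ofLp ⬝ᵥ (θ.innovCov ch k)⁻¹ *ᵥ
        (x.2 - θ.loopMean ch k x.1).ofLp) ∂(ch.pairLaw P k) = ENNReal.ofReal p := by
      rw [GaussianChannel.pairLaw, lintegral_map (by simp only [dotProduct, mulVec]; fun_prop)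
        (by fun_prop), GaussianChannel.kernel_eq_addNoise, compProd_addNoise _ (by fun_prop),
        lintegral_map (by simp only [dotProduct, mulVec]; fun_prop) (by fun_prop)]
      exact hP.lintegral_innov_quadForm (by omega)
    have hy : Measurable fun x : (Fin k → Vec p) × Vec p => x.2 - θ.loopMean ch k x.1 := by
      fun_prop
    obtain ⟨h1, h2⟩ := integral_log_gaussDensity (hS k) hy hq
    have hlog : ∀ x, Real.log (chainDensity (θ.loopMean ch) (θ.innovCov ch) (k + 1)
        (snocMeasurableEquiv (Vec p) k x)) =
        Real.log (chainDensity (θ.loopMean ch) (θ.innovCov ch) k x.1) +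
          Real.log (gaussDensity (θ.innovCov ch k) (x.2 - θ.loopMean ch k x.1)) := by
      intro x
      rw [chainDensity_snoc, Real.log_mul (chainDensity_pos hS _ _).ne'
        (gaussDensity_pos (hS k) _).ne']
    have ih1' : Integrable (fun x => Real.log (chainDensity (θ.loopMean ch) (θ.innovCov ch) k x.1))
        (ch.pairLaw P k) := ih1.comp_measurable measurable_fst
    have ih2' : ∫ x, Real.log (chainDensity (θ.loopMean ch) (θ.innovCov ch) k x.1)
        ∂(ch.pairLaw P k) = -∑ i ∈ Finset.range k, gaussEntropy (θ.innovCov ch i) := by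
      rw [← ih2, integral_map measurable_fst.aemeasurable ih1.1]
    rw [GaussianChannel.outLaw_succ, integrable_map_equiv,
      integral_map_equiv]
    simp only [Function.comp_def, hlog]
    refine ⟨ih1'.add h1, ?_⟩
    rw [integral_add ih1' h1, ih2', h2, Finset.sum_range_succ]
    ring

theorem Matches.hasDiffEntropy (hP : θ.Matches ch P n) :
    HasDiffEntropy (ch.outputLaw P n) ∧
      diffEntropy (ch.outputLaw P n) =
        ∑ i ∈ Finset.range (n + 1), gaussEntropy (θ.innovCov ch i) -
          (InformationTheory.klDiv (ch.outputLaw P n) (ch.outputLaw θ.policy n)).toReal := by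
  have h := hP.klDiv_add_directedInfo
  have hfin : InformationTheory.klDiv (ch.outputLaw P n) (ch.outputLaw θ.policy n) ≠ ∞ := by
    intro htop
    rw [htop, top_add] at h
    exact ENNReal.ofReal_ne_top h.symm
  rw [GaussianChannel.outputLaw_eq_outLaw, GaussianChannel.outputLaw_eq_outLaw] at hfin ⊢
  obtain ⟨h1, h2⟩ := hP.integral_log_chainDensity le_rfl
  have h3 := hasDiffEntropy_of_klDiv_ne_top
    (measurable_chainDensity (θ.measurable_loopMean ch) (n + 1))
    (chainDensity_pos (θ.posDef_innovCov ch) (n + 1))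
    ((θ.outLaw_policy ch (n + 1)).trans
      (chainLaw_eq_withDensity (θ.measurable_loopMean ch) (θ.posDef_innovCov ch) (n + 1))) hfin h1
  rw [h2, neg_neg] at h3
  exact h3

theorem hasDiffEntropy_policy (θ : LinearStrategy p q) (ch : GaussianChannel p q) (n : ℕ) :
    HasDiffEntropy (ch.outputLaw θ.policy n) ∧
      diffEntropy (ch.outputLaw θ.policy n) =
        ∑ i ∈ Finset.range (n + 1), gaussEntropy (θ.innovCov ch i) := by
  have h := (θ.matches_policy ch n).hasDiffEntropy
  have : IsProbabilityMeasure (ch.outputLaw θ.policy n) :=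
    inferInstanceAs (IsProbabilityMeasure (ch.outLaw θ.policy (n + 1)))
  rwa [InformationTheory.klDiv_self, ENNReal.toReal_zero, sub_zero] at h

/-- Almost every conditional law is a translate of one Gaussian, so its entropy does not depend on
the past. -/
theorem condDiffEntropy_policy (θ : LinearStrategy p q) (ch : GaussianChannel p q) {k : ℕ}
    (i : Fin k) :
    HasCondDiffEntropy (ch.jointLaw θ.policy k) (outputAt i) (outputsBefore i) ∧
      condDiffEntropy (ch.jointLaw θ.policy k) (outputAt i) (outputsBefore i) =
        gaussEntropy (θ.innovCov ch i) := by
  have hX : Measurable (outputAt i : Path p q k → _) := by unfold outputAt; fun_prop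
  have hW : Measurable (outputsBefore i : Path p q k → _) := by unfold outputsBefore; fun_prop
  have hγ := isMarkovKernel_addNoise (ρ := multivariateGaussian 0 (θ.innovCov ch i))
    (θ.measurable_loopMean ch i)
  have hae := condDistrib_ae_eq_of_measure_eq_compProd (μ := ch.jointLaw θ.policy k)
    (outputsBefore i) hX.aemeasurable
    (κ := addNoise (multivariateGaussian 0 (θ.innovCov ch i)) (θ.loopMean ch i)) (by
      rw [GaussianChannel.map_outputAt_jointLaw, GaussianChannel.map_outputsBefore_jointLaw,
        pairLaw_policy])
  have hent := addNoise_gaussian_entropy (θ.measurable_loopMean ch i) (θ.posDef_innovCov ch i)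
  have : IsProbabilityMeasure ((ch.jointLaw θ.policy k).map (outputsBefore i)) :=
    Measure.isProbabilityMeasure_map hW.aemeasurable
  have hconst : (fun w => diffEntropy (condDistrib (outputAt i) (outputsBefore i)
      (ch.jointLaw θ.policy k) w)) =ᵐ[(ch.jointLaw θ.policy k).map (outputsBefore i)]
      fun _ => gaussEntropy (θ.innovCov ch i) := by
    filter_upwards [hae] with w hw
    rw [hw, (hent w).2]
  refine ⟨⟨?_, (integrable_const _).congr hconst.symm⟩, ?_⟩
  · filter_upwards [hae] with w hw
    rw [hw]
    exact (hent w).1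
  · rw [condDiffEntropy, integral_congr_ae hconst]
    simp

end LinearStrategy

namespace GaussianChannel

variable (ch : GaussianChannel p q) (n : ℕ)

/-- With C = D = 0 the output is the noise itself, so the entropy formula for outputs applies. -/
theorem noiseLaw_entropy :
    HasDiffEntropy (ch.noiseLaw n) ∧
      diffEntropy (ch.noiseLaw n) = ∑ i ∈ Finset.range (n + 1), gaussEntropy (ch.KV i) := by
  let ch₀ : GaussianChannel p q := { ch with C := 0, D := 0 }
  let θ₀ : LinearStrategy p q := ⟨0, 0, fun _ => Matrix.PosSemidef.zero⟩
  have hS : θ₀.innovCov ch₀ = ch.KV := by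
    ext1 i
    simp [LinearStrategy.innovCov, ch₀, θ₀]
  have hm : θ₀.loopMean ch₀ = fun _ _ => 0 := by
    ext1 i
    ext1 b
    simp [LinearStrategy.loopMean, LinearStrategy.loopGain, ch₀, θ₀, mulVecE]
  have hpi : ∀ k, (Measure.pi fun i : Fin k => multivariateGaussian 0 (ch.KV i)) =
      chainLaw (fun _ _ => 0) ch.KV k := by
    intro k
    induction k with
    | zero => rw [Measure.pi_of_empty (x := Fin.elim0), chainLaw]
    | succ k ih =>
      have := isProbabilityMeasure_chainLaw (p := p) (m := fun _ _ => 0)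
        (fun _ => measurable_const) ch.KV k
      rw [pi_eq_map_snoc, chainLaw, compProd_addNoise _ measurable_const, ← ih]
      simp
  have h := θ₀.hasDiffEntropy_policy ch₀ n
  rw [outputLaw_eq_outLaw, LinearStrategy.outLaw_policy, hS, hm, ← hpi] at h
  exact h

end GaussianChannel

namespace LinearStrategy

variable {θ : LinearStrategy p q} {ch : GaussianChannel p q} {P : InputPolicy p q} {n : ℕ}

theorem sum_gaussEntropy_sub (θ : LinearStrategy p q) (ch : GaussianChannel p q) (n : ℕ) :
    ∑ i ∈ Finset.range (n + 1), gaussEntropy (θ.innovCov ch i) - diffEntropy (ch.noiseLaw n) =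
      θ.logDetRate ch n := by
  rw [(ch.noiseLaw_entropy n).2, ← Finset.sum_sub_distrib, logDetRate_eq_sum]
  refine Finset.sum_congr rfl fun i _ => ?_
  have h1 := (θ.posDef_innovCov ch i).det_pos
  have h2 := (ch.posDef_KV i).det_pos
  rw [gaussEntropy, gaussEntropy, stageRate, Real.log_div h1.ne' h2.ne',
    Real.log_mul (by positivity) h1.ne', Real.log_mul (by positivity) h2.ne']
  ring

theorem diffEntropy_sub_noise (θ : LinearStrategy p q) (ch : GaussianChannel p q) (n : ℕ) :
    diffEntropy (ch.outputLaw θ.policy n) - diffEntropy (ch.noiseLaw n) = θ.logDetRate ch n := by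
  rw [(θ.hasDiffEntropy_policy ch n).2, sum_gaussEntropy_sub]

theorem Matches.diffEntropy_sub_noise_le (hP : θ.Matches ch P n) :
    diffEntropy (ch.outputLaw P n) - diffEntropy (ch.noiseLaw n) ≤ θ.logDetRate ch n := by
  rw [hP.hasDiffEntropy.2, ← sum_gaussEntropy_sub]
  have := ENNReal.toReal_nonneg
    (a := InformationTheory.klDiv (ch.outputLaw P n) (ch.outputLaw θ.policy n))
  linarith

end LinearStrategy

/-! ### Joint Gaussianity and the realization of linear strategies. -/

theorem isGaussian_map_of_isLinearMap {E F : Type*} [NormedAddCommGroup E] [NormedSpace ℝ E]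
    [MeasurableSpace E] [BorelSpace E] [NormedAddCommGroup F] [NormedSpace ℝ F]
    [MeasurableSpace F] [BorelSpace F] {μ : Measure E} [IsGaussian μ] {f : E → F}
    (hf : IsLinearMap ℝ f) (hc : Continuous f) : IsGaussian (μ.map f) :=
  isGaussian_map (μ := μ) (⟨hf.mk' f, hc⟩ : E →L[ℝ] F)

theorem indepFun_of_map_eq_prod {Ω E F : Type*} [MeasurableSpace Ω] [MeasurableSpace E]
    [MeasurableSpace F] {μ : Measure Ω} [IsProbabilityMeasure μ] {α : Measure E} {β : Measure F}
    [IsProbabilityMeasure α] [IsProbabilityMeasure β] {X : Ω → E} {Y : Ω → F} (hX : Measurable X)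
    (hY : Measurable Y) (h : μ.map (fun ω => (X ω, Y ω)) = α.prod β) :
    IndepFun X Y μ ∧ μ.map X = α ∧ μ.map Y = β := by
  have h1 : μ.map X = α := by
    have := congrArg (Measure.map Prod.fst) h
    rwa [Measure.map_map (by fun_prop) (by fun_prop), Measure.map_fst_prod, measure_univ,
      one_smul] at this
  have h2 : μ.map Y = β := by
    have := congrArg (Measure.map Prod.snd) h
    rwa [Measure.map_map (by fun_prop) (by fun_prop), Measure.map_snd_prod, measure_univ,
      one_smul] at this
  refine ⟨?_, h1, h2⟩
  rw [indepFun_iff_map_prod_eq_prod_map_map hX.aemeasurable hY.aemeasurable, h, h1, h2]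

theorem mulVecE_smul {a b : ℕ} (M : Matrix (Fin a) (Fin b) ℝ) (c : ℝ) (x : Vec b) :
    mulVecE M (c • x) = c • mulVecE M x :=
  (Matrix.toEuclideanLin M).map_smul c x

namespace LinearStrategy

variable (θ : LinearStrategy p q) (ch : GaussianChannel p q)

/-- One step of the closed loop, driven by the innovation `z` and the channel noise `v`. -/
def loopStep (k : ℕ) (x : (Path p q k × Vec q) × Vec p) : Path p q (k + 1) :=
  Fin.snoc x.1.1 (θ.inputMean k (outputs x.1.1) + x.1.2,
    ch.mean k (outputs x.1.1, θ.inputMean k (outputs x.1.1) + x.1.2) + x.2)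

theorem continuous_inputMean (k : ℕ) : Continuous (θ.inputMean k) := by
  unfold inputMean; fun_prop

theorem continuous_mean (k : ℕ) : Continuous (ch.mean k) := by
  unfold GaussianChannel.mean; fun_prop

theorem continuous_loopStep (k : ℕ) : Continuous (θ.loopStep ch k) := by
  have h1 := θ.continuous_inputMean k
  have h2 := continuous_mean ch k
  refine continuous_pi fun j => ?_
  unfold loopStep outputs
  induction j using Fin.lastCases with
  | last => simp only [Fin.snoc_last]; fun_prop
  | cast j => simp only [Fin.snoc_castSucc]; fun_prop

theorem isLinearMap_loopStep (k : ℕ) : IsLinearMap ℝ (θ.loopStep ch k) := by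
  constructor
  · intro x y
    ext1 j
    unfold loopStep outputs
    induction j using Fin.lastCases with
    | last =>
      simp only [Fin.snoc_last, Pi.add_apply, inputMean, GaussianChannel.mean, mulVecE_add,
        mulVecE_sum, Prod.fst_add, Prod.snd_add, Finset.sum_add_distrib, Prod.mk_add_mk]
      congr 1 <;> abel
    | cast j => simp only [Fin.snoc_castSucc, Pi.add_apply, Prod.fst_add]
  · intro c x
    ext1 j
    unfold loopStep outputs
    induction j using Fin.lastCases with
    | last =>
      simp only [Fin.snoc_last, Pi.smul_apply, inputMean, GaussianChannel.mean, mulVecE_add,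
        mulVecE_sum, mulVecE_smul, Prod.smul_fst, Prod.smul_snd, Prod.smul_mk, smul_add,
        Finset.smul_sum]
    | cast j => simp only [Fin.snoc_castSucc, Pi.smul_apply, Prod.smul_fst]

theorem inputLaw_compProd_kernel (k : ℕ) :
    ch.inputLaw θ.policy k ⊗ₘ ch.kernel k =
      (((ch.jointLaw θ.policy k).prod (multivariateGaussian 0 (θ.KZ k))).prod
        (multivariateGaussian 0 (ch.KV k))).map fun x =>
          ((x.1.1, θ.inputMean k (outputs x.1.1) + x.1.2),
            ch.mean k (outputs x.1.1, θ.inputMean k (outputs x.1.1) + x.1.2) + x.2) := by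
  rw [GaussianChannel.kernel_eq_addNoise, compProd_addNoise _ (by fun_prop), inputLaw_policy]
  conv_lhs =>
    rw [← Measure.map_id (μ := multivariateGaussian 0 (ch.KV k))]
    rw [Measure.map_prod_map _ _ (by fun_prop) measurable_id]
  rw [Measure.map_map (by fun_prop) (by fun_prop)]
  rfl

theorem jointLaw_policy_succ (k : ℕ) :
    ch.jointLaw θ.policy (k + 1) =
      (((ch.jointLaw θ.policy k).prod (multivariateGaussian 0 (θ.KZ k))).prod
        (multivariateGaussian 0 (ch.KV k))).map (θ.loopStep ch k) := by
  rw [GaussianChannel.jointLaw_succ, inputLaw_compProd_kernel,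
    Measure.map_map (GaussianChannel.measurable_snoc_path k) (by fun_prop)]
  rfl

/-- Each step is a continuous linear image of a product of Gaussian laws, starting from a Dirac
mass. -/
theorem isGaussian_jointLaw (k : ℕ) : IsGaussian (ch.jointLaw θ.policy k) := by
  induction k with
  | zero => unfold GaussianChannel.jointLaw; infer_instance
  | succ k ih =>
    rw [jointLaw_policy_succ]
    exact isGaussian_map_of_isLinearMap (θ.isLinearMap_loopStep ch k) (θ.continuous_loopStep ch k)

/-- The innovation `Z_i = A_i - ∑_{j < i} Γ_{i,j} B_j` as a function of the trajectory. -/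
def innovation {k : ℕ} (i : Fin k) (ω : Path p q k) : Vec q :=
  inputAt i ω - θ.inputMean i (outputsBefore i ω)

end LinearStrategy

namespace GaussianChannel

variable (ch : GaussianChannel p q)

/-- The channel noise `V_i` as a function of the trajectory. -/
def noise {k : ℕ} (i : Fin k) (ω : Path p q k) : Vec p :=
  outputAt i ω - ch.mean i (outputsBefore i ω, inputAt i ω)

@[fun_prop]
theorem measurable_noise {k : ℕ} (i : Fin k) : Measurable (ch.noise i : Path p q k → Vec p) := by
  unfold noise outputAt outputsBefore inputAt; fun_prop

end GaussianChannel

namespace LinearStrategy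

variable (θ : LinearStrategy p q) (ch : GaussianChannel p q)

@[fun_prop]
theorem measurable_innovation {k : ℕ} (i : Fin k) :
    Measurable (θ.innovation i : Path p q k → Vec q) := by
  unfold innovation outputsBefore inputAt; fun_prop

/-- Subtracting the means inverts the shear that generated input and output, returning the
independent past, innovation and noise. -/
theorem map_past_innovation_noise {k : ℕ} (i : Fin k) :
    (ch.jointLaw θ.policy k).map
      (fun ω => (((fun j => ω (j.castLE i.isLt.le) : Path p q i), θ.innovation i ω),
        ch.noise i ω)) =
      ((ch.jointLaw θ.policy i).prod (multivariateGaussian 0 (θ.KZ i))).prod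
        (multivariateGaussian 0 (ch.KV i)) := by
  have h := (ch.map_splitAt_jointLaw θ.policy i).trans (θ.inputLaw_compProd_kernel ch i)
  have h' := congrArg (Measure.map fun x : (Path p q i × Vec q) × Vec p =>
    ((x.1.1, x.1.2 - θ.inputMean i (outputs x.1.1)), x.2 - ch.mean i (outputs x.1.1, x.1.2))) h
  rw [Measure.map_map (by fun_prop) (by fun_prop), Measure.map_map (by fun_prop) (by fun_prop)] at h'
  refine h'.trans ?_
  convert! Measure.map_id
  ext1 x
  simp

theorem map_prod_prod_eq {E F G H : Type*} [MeasurableSpace E] [MeasurableSpace F]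
    [MeasurableSpace G] [MeasurableSpace H] {f : E → F} (hf : Measurable f) (α : Measure E)
    (β : Measure G) (γ : Measure H) [SFinite α] [SFinite β] [SFinite γ] :
    (α.map f).prod (β.prod γ) = ((α.prod β).prod γ).map fun x => (f x.1.1, (x.1.2, x.2)) := by
  conv_lhs => rw [← Measure.map_id (μ := β.prod γ)]
  rw [Measure.map_prod_map _ _ hf measurable_id, ← Measure.prodAssoc_prod,
    Measure.map_map (by fun_prop) (by fun_prop)]
  rfl

theorem innovation_eq_splitAt {k : ℕ} (i : Fin k) (ω : Path p q k) :
    θ.innovation i ω = (splitAt i ω).1.2 - θ.inputMean i (outputs (splitAt i ω).1.1) := rfl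

theorem noise_eq_splitAt {k : ℕ} (i : Fin k) (ω : Path p q k) :
    ch.noise i ω = (splitAt i ω).2 -
      ch.mean i (outputs (splitAt i ω).1.1, (splitAt i ω).1.2) := rfl

theorem map_innovation_noise (k : ℕ) :
    (ch.jointLaw θ.policy k).map (fun ω i => (θ.innovation i ω, ch.noise i ω)) =
      Measure.pi fun i : Fin k =>
        (multivariateGaussian 0 (θ.KZ i)).prod (multivariateGaussian 0 (ch.KV i)) := by
  induction k with
  | zero =>
    rw [GaussianChannel.jointLaw, Measure.map_dirac' (by fun_prop), Measure.pi_of_empty]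
    congr 1
    exact Subsingleton.elim _ _
  | succ k ih =>
    rw [jointLaw_policy_succ, Measure.map_map (by fun_prop) (θ.continuous_loopStep ch k).measurable,
      pi_eq_map_snoc]
    simp only [Fin.val_castSucc, Fin.val_last]
    rw [← ih, map_prod_prod_eq (by fun_prop),
      Measure.map_map (MeasurableEquiv.measurable _) (by fun_prop)]
    congr 1
    ext1 x
    ext1 j
    simp only [Function.comp_apply, innovation_eq_splitAt, noise_eq_splitAt, loopStep,
      snocMeasurableEquiv_apply]
    induction j using Fin.lastCases with
    | last =>
      rw [splitAt_last_snoc, Fin.snoc_last]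
      simp only [Fin.val_last, add_sub_cancel_left]
    | cast j =>
      rw [splitAt_castSucc_snoc, Fin.snoc_castSucc]
      rfl

theorem map_innovations_noises (k : ℕ) :
    (ch.jointLaw θ.policy k).map
      (fun ω => ((fun i => θ.innovation i ω), (fun i => ch.noise i ω))) =
      (Measure.pi fun i : Fin k => multivariateGaussian 0 (θ.KZ i)).prod
        (Measure.pi fun i : Fin k => multivariateGaussian 0 (ch.KV i)) := by
  have h := congrArg (Measure.map (MeasurableEquiv.arrowProdEquivProdArrow _ _ _))
    (θ.map_innovation_noise ch k)
  rwa [(measurePreserving_arrowProdEquivProdArrow _ _ _ _ _).map_eq,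
    Measure.map_map (MeasurableEquiv.measurable _) (by fun_prop)] at h

theorem map_innovation {k : ℕ} (i : Fin k) :
    (ch.jointLaw θ.policy k).map (θ.innovation i) = multivariateGaussian 0 (θ.KZ i) :=
  (indepFun_of_map_eq_prod (by fun_prop) (by fun_prop) (indepFun_of_map_eq_prod (by fun_prop)
    (by fun_prop) (θ.map_past_innovation_noise ch i)).2.1).2.2

/-- The trajectory space itself carries the realization, with Z and V read off as residuals. The two
equations then hold by definition and only the independence statements have content. -/
theorem isRealization (n : ℕ) :
    θ.IsRealization ch n (ch.jointLaw θ.policy (n + 1)) (fun i => θ.innovation i)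
      (fun i => inputAt i) (fun i => ch.noise i) (fun i => outputAt i) where
  isProbability := inferInstance
  law_Z i := ⟨by fun_prop, θ.map_innovation ch i⟩
  law_V i := ⟨by fun_prop, (indepFun_of_map_eq_prod (by fun_prop) (by fun_prop)
    (θ.map_past_innovation_noise ch i)).2.2⟩
  indep_Z := by
    rw [iIndepFun_iff_map_fun_eq_pi_map (by fun_prop)]
    refine (indepFun_of_map_eq_prod (by fun_prop) (by fun_prop)
      (θ.map_innovations_noises ch (n + 1))).2.1.trans ?_
    congr 1
    ext1 i
    exact (θ.map_innovation ch i).symm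
  indep_Z_V := (indepFun_of_map_eq_prod (by fun_prop) (by fun_prop)
    (θ.map_innovations_noises ch (n + 1))).1
  indep_Z_past i := by
    have h := indepFun_of_map_eq_prod (by fun_prop) (by fun_prop)
      (θ.map_past_innovation_noise ch i)
    exact (indepFun_of_map_eq_prod (by fun_prop) (by fun_prop) h.2.1).1.symm
  indep_V_past i := by
    have h := (indepFun_of_map_eq_prod (by fun_prop) (by fun_prop)
      (θ.map_past_innovation_noise ch i)).1.symm
    -- The earlier noises and all inputs up to time i are functions of the past trajectory and the
    -- innovation at time i.
    have h' := h.comp (φ := id) (ψ := fun x : Path p q i × Vec q =>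
      ((fun j : Fin i => ch.noise j x.1),
        allInputs (x.1, θ.inputMean i (outputs x.1) + x.2))) measurable_id (by fun_prop)
    refine h'.congr (.of_forall fun ω => rfl) (.of_forall fun ω => Prod.ext rfl ?_)
    change allInputs _ = inputsUpTo i ω
    rw [inputsUpTo_eq]
    congr 1
    refine Prod.ext rfl ?_
    exact add_sub_cancel _ _
  input_eq i ω := (add_sub_cancel (θ.inputMean i (outputsBefore i ω)) (inputAt i ω)).symm
  output_eq i ω := (add_sub_cancel (ch.mean i (outputsBefore i ω, inputAt i ω))
    (outputAt i ω)).symm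

end LinearStrategy

/-! ### Compactness and existence of an optimal strategy. -/

namespace LinearStrategy

/-- The gains and innovations covariances, as real arrays. -/
def coords (θ : LinearStrategy p q) :
    ((i : ℕ) → Fin i → Fin q → Fin p → ℝ) × (ℕ → Fin q → Fin q → ℝ) := (θ.Γ, θ.KZ)

/-- The topology of entrywise convergence of gains and innovations covariances. -/
instance : TopologicalSpace (LinearStrategy p q) := .induced coords inferInstance

theorem isInducing_coords : Topology.IsInducing (coords : LinearStrategy p q → _) := ⟨rfl⟩

theorem continuous_gain (i : ℕ) (j : Fin i) :
    Continuous fun θ : LinearStrategy p q => θ.Γ i j :=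
  (continuous_apply j).comp
    ((continuous_apply i).comp (continuous_fst.comp isInducing_coords.continuous))

theorem continuous_cov (i : ℕ) : Continuous fun θ : LinearStrategy p q => θ.KZ i :=
  (continuous_apply i).comp (continuous_snd.comp isInducing_coords.continuous)

theorem isClosed_posSemidef {ι : Type*} [Fintype ι] :
    IsClosed {M : Matrix ι ι ℝ | M.PosSemidef} := by
  have : {M : Matrix ι ι ℝ | M.PosSemidef} =
      {M | Mᵀ = M} ∩ ⋂ x : ι → ℝ, {M | 0 ≤ x ⬝ᵥ M *ᵥ x} := by
    ext M
    simp [Matrix.posSemidef_iff_dotProduct_mulVec, Matrix.IsHermitian]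
  rw [this]
  refine IsClosed.inter (isClosed_eq (by fun_prop) (by fun_prop))
    (isClosed_iInter fun x => isClosed_le (by fun_prop) ?_)
  exact continuous_const.dotProduct (continuous_id.matrix_mulVec continuous_const)

theorem isClosedEmbedding_coords :
    Topology.IsClosedEmbedding (coords : LinearStrategy p q → _) := by
  refine ⟨⟨isInducing_coords, fun θ θ' h => ?_⟩, ?_⟩
  · cases θ; cases θ'
    obtain ⟨rfl, rfl⟩ := Prod.mk.inj h
    rfl
  · have : Set.range (coords : LinearStrategy p q → _) =
        ⋂ i, (fun x => x.2 i) ⁻¹' {M : Matrix (Fin q) (Fin q) ℝ | M.PosSemidef} := by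
      ext x
      simp only [Set.mem_range, Set.mem_iInter]
      exact ⟨fun ⟨θ, h⟩ i => h ▸ θ.posSemidef_KZ i, fun h => ⟨⟨x.1, x.2, h⟩, rfl⟩⟩
    rw [this]
    exact isClosed_iInter fun i => isClosed_posSemidef.preimage
      ((continuous_apply i).comp continuous_snd)

variable (ch : GaussianChannel p q)

theorem continuous_innovCov (i : ℕ) :
    Continuous fun θ : LinearStrategy p q => θ.innovCov ch i := by
  have := continuous_cov (p := p) (q := q) i
  unfold innovCov
  fun_prop

theorem continuous_loopGain (i : ℕ) (j : Fin i) :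
    Continuous fun θ : LinearStrategy p q => θ.loopGain ch i j := by
  have := continuous_gain (p := p) (q := q) i j
  unfold loopGain
  fun_prop

/-- Joint continuity is needed because the recursion changes the coefficients by gains that
themselves depend on `θ`. -/
theorem continuous_outQuad (i : ℕ) :
    Continuous fun x : LinearStrategy p q × (Fin i → Fin p → ℝ) => x.1.outQuad ch i x.2 := by
  induction i with
  | zero => exact continuous_const
  | succ i ih =>
    have h1 := continuous_loopGain (q := q) ch i
    have h2 := continuous_innovCov ch i
    unfold outQuad
    refine Continuous.add (ih.comp (continuous_fst.prodMk (continuous_pi fun j => ?_))) ?_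
    · exact Continuous.add (by fun_prop)
        (((h1 j).comp continuous_fst).matrix_transpose.matrix_mulVec (by fun_prop))
    · exact Continuous.dotProduct (by fun_prop)
        ((h2.comp continuous_fst).matrix_mulVec (by fun_prop))

theorem lintegral_sum_sq {Ω ι : Type*} [MeasurableSpace Ω] [Fintype ι] {μ : Measure Ω}
    {f : ι → Ω → ℝ} (hf : ∀ k, Measurable (f k)) :
    ∫⁻ ω, ENNReal.ofReal (∑ k, f k ω ^ 2) ∂μ = ∑ k, ∫⁻ ω, ENNReal.ofReal (f k ω ^ 2) ∂μ := by
  rw [← lintegral_finsetSum _ fun k _ => ((hf k).pow_const 2).ennreal_ofReal]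
  exact lintegral_congr fun ω => ENNReal.ofReal_sum_of_nonneg fun _ _ => sq_nonneg _

theorem continuous_avgCost (n : ℕ) :
    Continuous fun θ : LinearStrategy p q => ch.avgCost θ.policy n := by
  unfold GaussianChannel.avgCost
  refine (ENNReal.continuous_const_mul (ENNReal.inv_ne_top.2 (by simp))).comp
    (continuous_finsetSum _ fun i _ => ?_)
  have hi : (i : ℕ) ≤ n := by omega
  simp only [GaussianChannel.lintegral_stageCost]
  obtain ⟨C, -, hC⟩ := exists_quadForm_eq_sum_sq (ch.posDef_R i).posSemidef
  obtain ⟨C', -, hC'⟩ := exists_quadForm_eq_sum_sq (ch.posSemidef_Q i)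
  simp_rw [hC, hC']
  refine Continuous.add ?_ ?_
  · have h : ∀ θ : LinearStrategy p q,
        ∫⁻ x, ENNReal.ofReal (∑ k, (C k ⬝ᵥ x.2.ofLp) ^ 2) ∂(ch.inputLaw θ.policy i) =
          ∑ k, ENNReal.ofReal (θ.outQuad ch i (fun j => (θ.Γ i j)ᵀ *ᵥ C k) +
            C k ⬝ᵥ θ.KZ i *ᵥ C k) := by
      intro θ
      rw [lintegral_sum_sq (fun k => by simp only [dotProduct]; fun_prop)]
      refine Finset.sum_congr rfl fun k _ => ?_
      simpa using (θ.matches_policy ch n).lintegral_input_sq hi (C k) 0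
    simp_rw [h]
    refine continuous_finsetSum _ fun k _ => ENNReal.continuous_ofReal.comp ?_
    refine Continuous.add ((continuous_outQuad ch i).comp
      (continuous_id.prodMk (continuous_pi fun j => ?_))) ?_
    · exact (continuous_gain (i : ℕ) j).matrix_transpose.matrix_mulVec continuous_const
    · exact continuous_const.dotProduct ((continuous_cov i).matrix_mulVec continuous_const)
  · have h : ∀ θ : LinearStrategy p q,
        ∫⁻ ω, ENNReal.ofReal (∑ k, (C' k ⬝ᵥ fun jl => outputs ω jl.1 jl.2) ^ 2)
          ∂(ch.jointLaw θ.policy i) =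
          ∑ k, ENNReal.ofReal (θ.outQuad ch i (fun j l => C' k (j, l))) := by
      intro θ
      rw [lintegral_sum_sq (fun k => by simp only [dotProduct]; fun_prop)]
      refine Finset.sum_congr rfl fun k _ => ?_
      rw [← (θ.matches_policy ch n).lintegral_sq (i := i) (by omega)]
      simp only [pairing, dotProduct, Fintype.sum_prod_type]
    simp_rw [h]
    exact continuous_finsetSum _ fun k _ => ENNReal.continuous_ofReal.comp
      ((continuous_outQuad ch i).comp (continuous_id.prodMk continuous_const))

theorem continuous_logDetRate (n : ℕ) :
    Continuous fun θ : LinearStrategy p q => θ.logDetRate ch n := by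
  unfold logDetRate
  refine continuous_const.mul (continuous_finsetSum _ fun i _ => ?_)
  refine Continuous.log ?_ fun θ =>
    (div_pos (θ.posDef_innovCov ch i).det_pos (ch.posDef_KV i).det_pos).ne'
  exact (continuous_innovCov ch i).matrix_det.div_const _

/-- The strategy which agrees with `θ` up to time `n` and then stops. -/
def truncate (θ : LinearStrategy p q) (n : ℕ) : LinearStrategy p q where
  Γ i := if i ≤ n then θ.Γ i else 0
  KZ i := if i ≤ n then θ.KZ i else 0
  posSemidef_KZ i := by
    split_ifs
    exacts [θ.posSemidef_KZ i, Matrix.PosSemidef.zero]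

variable {ch} {θ : LinearStrategy p q} {n : ℕ} {κ : ℝ≥0}

/-- The constraint does not bound coefficients after time n. Setting them to zero changes neither
cost nor rate and makes compactness possible. -/
theorem truncate_mem_feasible (h : θ ∈ feasible ch n κ) : θ.truncate n ∈ feasible ch n κ := by
  refine Matches.mem_feasible (P := θ.policy) (fun i hi => ?_) h
  simpa only [truncate, if_pos hi] using θ.matches_policy ch n i hi

theorem logDetRate_truncate (θ : LinearStrategy p q) (ch : GaussianChannel p q) (n : ℕ) :
    (θ.truncate n).logDetRate ch n = θ.logDetRate ch n := by
  unfold logDetRate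
  congr 1
  refine Finset.sum_congr rfl fun i hi => ?_
  simp only [truncate, if_pos (Nat.lt_succ_iff.1 (Finset.mem_range.1 hi))]

variable (ch n κ)

theorem exists_input_bound {i : ℕ} (hi : i ≤ n) : ∃ b : ℝ, ∀ θ ∈ feasible ch n κ, ∀ k,
    θ.outQuad ch i (fun j => θ.Γ i j k) + θ.KZ i k k ≤ b := by
  obtain ⟨c, hc, hle⟩ := exists_sq_le_mul_quadForm (ch.posDef_R i)
  -- The bounded quantity is the second moment of the k-th input coordinate: one stage costs at most
  -- (n + 1) κ, and `c` compares a squared coordinate with the form of R.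
  refine ⟨c * ((n + 1) * κ), fun θ hθ k => ?_⟩
  have h1 : ∫⁻ x, ENNReal.ofReal (x.2.ofLp ⬝ᵥ ch.R i *ᵥ x.2.ofLp) ∂(ch.inputLaw θ.policy i) ≤
      ENNReal.ofReal ((n + 1) * κ) := by
    have h := (ENNReal.inv_mul_le_iff (by simp) (by simp)).1 hθ
    refine le_trans ?_ (h.trans_eq ?_)
    · refine le_trans ?_ (Finset.single_le_sum (fun _ _ => zero_le)
        (Finset.mem_univ (⟨i, by omega⟩ : Fin (n + 1))))
      rw [ch.lintegral_stageCost]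
      exact le_self_add
    · rw [ENNReal.ofReal_mul (by positivity), ENNReal.ofReal_add (by positivity) zero_le_one]
      simp
  have h2 := (θ.matches_policy ch n).lintegral_input_sq hi (Pi.single k 1) 0
  simp only [single_one_dotProduct, pairing_zero, add_zero, Pi.zero_apply, zero_add,
    mulVec_single_one] at h2
  have h3 : ENNReal.ofReal (θ.outQuad ch i (fun j => θ.Γ i j k) + θ.KZ i k k) ≤
      ENNReal.ofReal (c * ((n + 1) * κ)) := by
    refine h2.symm.trans_le (le_trans ?_ ((mul_le_mul_right h1 (ENNReal.ofReal c)).trans_eq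
      (ENNReal.ofReal_mul hc).symm))
    rw [← lintegral_const_mul' _ _ ENNReal.ofReal_ne_top]
    refine lintegral_mono fun x => ?_
    rw [← ENNReal.ofReal_mul hc]
    exact ENNReal.ofReal_le_ofReal (hle _ _)
  exact (ENNReal.ofReal_le_ofReal_iff (by positivity)).1 h3

theorem exists_gain_bound {i : ℕ} (hi : i ≤ n) {K : ℝ}
    (hK : ∀ θ ∈ feasible ch n κ, ∀ (β : Fin i → Fin p → ℝ) j l, β j l ^ 2 ≤ K * θ.outQuad ch i β) :
    ∃ b : ℝ, ∀ θ ∈ feasible ch n κ, ∀ j k l, |θ.Γ i j k l| ≤ b := by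
  obtain ⟨b, hb⟩ := exists_input_bound ch n κ hi
  refine ⟨√(max K 0 * b), fun θ hθ j k l => Real.abs_le_sqrt ?_⟩
  have h1 := hb θ hθ k
  have h2 := (θ.posSemidef_KZ i).diag_nonneg (i := k)
  have h3 := θ.outQuad_nonneg ch i (fun j => θ.Γ i j k)
  calc θ.Γ i j k l ^ 2 ≤ K * θ.outQuad ch i (fun j => θ.Γ i j k) := hK θ hθ (fun j => θ.Γ i j k) j l
    _ ≤ max K 0 * θ.outQuad ch i (fun j => θ.Γ i j k) := by gcongr; exact le_max_left _ _
    _ ≤ max K 0 * b := by gcongr; linarith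

theorem exists_loopGain_bound {i : ℕ} {b : ℝ}
    (hb : ∀ θ ∈ feasible ch n κ, ∀ j k l, |θ.Γ i j k l| ≤ b) :
    ∃ b' : ℝ, ∀ θ ∈ feasible ch n κ, ∀ j l, ∑ m, θ.loopGain ch i j m l ^ 2 ≤ b' := by
  let f : (Fin i → Fin q → Fin p → ℝ) → ℝ := fun G =>
    ∑ j, ∑ l, ∑ m, (ch.C i j + ch.D i * Matrix.of (G j)) m l ^ 2
  have hf : Continuous f := by
    refine continuous_finsetSum _ fun j _ => continuous_finsetSum _ fun l _ =>
      continuous_finsetSum _ fun m _ => ?_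
    simp only [Matrix.add_apply, Matrix.mul_apply, Matrix.of_apply]
    fun_prop
  obtain ⟨b', hb'⟩ := (isCompact_Icc (a := fun _ _ _ => -b) (b := fun _ _ _ => b)).bddAbove_image
    hf.continuousOn
  refine ⟨b', fun θ hθ j l => ?_⟩
  refine le_trans ?_ (hb' ⟨θ.Γ i, ⟨fun j k l => (abs_le.1 (hb θ hθ j k l)).1,
    fun j k l => (abs_le.1 (hb θ hθ j k l)).2⟩, rfl⟩)
  refine le_trans (Finset.single_le_sum
    (f := fun l => ∑ m, θ.loopGain ch i j m l ^ 2) (fun _ _ => by positivity)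
    (Finset.mem_univ l)) ?_
  exact Finset.single_le_sum
    (f := fun j => ∑ l, ∑ m, θ.loopGain ch i j m l ^ 2) (fun _ _ => by positivity)
    (Finset.mem_univ j)

/-- Uniform nondegeneracy of the output moments. It bounds the gains at time i, since Γ B has
bounded second moment, and bounded loop gains together with K_V ≻ 0 carry it to the next time. -/
theorem exists_sq_le_mul_outQuad {i : ℕ} (hi : i ≤ n + 1) : ∃ K : ℝ, ∀ θ ∈ feasible ch n κ,
    ∀ (β : Fin i → Fin p → ℝ) j l, β j l ^ 2 ≤ K * θ.outQuad ch i β := by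
  induction i with
  | zero => exact ⟨0, fun θ _ β j => j.elim0⟩
  | succ i ih =>
    obtain ⟨K, hK⟩ := ih (by omega)
    obtain ⟨b, hb⟩ := exists_gain_bound ch n κ (by omega) hK
    obtain ⟨b', hb'⟩ := exists_loopGain_bound ch n κ hb
    obtain ⟨c, hc, hle⟩ := exists_sq_le_mul_quadForm (ch.posDef_KV i)
    -- `c` handles the last coefficient, through K_V. An earlier one is β' minus a loop-gain term,
    -- and (x - y)² ≤ 2x² + 2y² gives the other two summands.
    refine ⟨c + 2 * max K 0 + 2 * (max b' 0 * (p * c)), fun θ hθ β j l => ?_⟩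
    set β' := fun j => β j.castSucc + (θ.loopGain ch i j)ᵀ *ᵥ β (Fin.last i) with hβ'
    have hO : θ.outQuad ch (i + 1) β = θ.outQuad ch i β' +
      β (Fin.last i) ⬝ᵥ θ.innovCov ch i *ᵥ β (Fin.last i) := rfl
    set O := θ.outQuad ch (i + 1) β
    have h1 := θ.outQuad_nonneg ch i β'
    have h2 : β (Fin.last i) ⬝ᵥ ch.KV i *ᵥ β (Fin.last i) ≤
        β (Fin.last i) ⬝ᵥ θ.innovCov ch i *ᵥ β (Fin.last i) := by
      rw [innovCov, add_mulVec, dotProduct_add]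
      refine le_add_of_nonneg_left ?_
      simpa using ((θ.posSemidef_KZ i).mul_mul_conjTranspose_same
        (ch.D i)).dotProduct_mulVec_nonneg (β (Fin.last i))
    have h3 : 0 ≤ β (Fin.last i) ⬝ᵥ ch.KV i *ᵥ β (Fin.last i) := by
      simpa using (ch.posDef_KV i).posSemidef.dotProduct_mulVec_nonneg (β (Fin.last i))
    have hO' : 0 ≤ O := by linarith
    have h4 : ∀ m, β (Fin.last i) m ^ 2 ≤ c * O := fun m =>
      (hle _ m).trans (by gcongr; linarith)
    have h0 : 0 ≤ max b' 0 * (p * c) * O := by positivity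
    have h0' : 0 ≤ max K 0 * O := by positivity
    induction j using Fin.lastCases with
    | last => nlinarith [h4 l]
    | cast j =>
      have h5 : β j.castSucc l = β' j l - ∑ m, θ.loopGain ch i j m l * β (Fin.last i) m := by
        simp [hβ', mulVec, dotProduct]
      have h6 : β' j l ^ 2 ≤ max K 0 * O :=
        (hK θ hθ β' j l).trans ((mul_le_mul_of_nonneg_right (le_max_left _ _) h1).trans
          (by gcongr; linarith))
      have h7 : (∑ m, θ.loopGain ch i j m l * β (Fin.last i) m) ^ 2 ≤ max b' 0 * (p * c) * O := by
        refine (Finset.sum_mul_sq_le_sq_mul_sq _ _ _).trans ?_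
        rw [mul_assoc]
        refine mul_le_mul ((hb' θ hθ j l).trans (le_max_left _ _)) ?_ (by positivity) (by positivity)
        refine (Finset.sum_le_sum fun m _ => h4 m).trans_eq ?_
        simp [mul_assoc]
      rw [h5]
      have := mul_nonneg hc hO'
      nlinarith [sq_nonneg (β' j l + ∑ m, θ.loopGain ch i j m l * β (Fin.last i) m)]

/-- The form is tested on e_k + e_l and e_k - e_l. -/
theorem abs_apply_le_of_posSemidef {ι : Type*} [Fintype ι] [DecidableEq ι] {M : Matrix ι ι ℝ}
    (hM : M.PosSemidef) (k l : ι) : |M k l| ≤ (M k k + M l l) / 2 := by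
  have hs : M l k = M k l := by simpa using hM.isHermitian.apply k l
  have h1 := hM.dotProduct_mulVec_nonneg (Pi.single k 1 + Pi.single l 1)
  have h2 := hM.dotProduct_mulVec_nonneg (Pi.single k 1 - Pi.single l 1)
  simp [mulVec_add, mulVec_sub, add_dotProduct, sub_dotProduct, hs] at h1 h2
  rw [abs_le]
  constructor <;> linarith

theorem exists_coords_bound (i : ℕ) : ∃ b : ℝ, ∀ θ ∈ feasible ch n κ,
    (∀ j k l, |(θ.truncate n).Γ i j k l| ≤ b) ∧ ∀ k l, |(θ.truncate n).KZ i k l| ≤ b := by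
  by_cases hi : i ≤ n
  · obtain ⟨K, hK⟩ := exists_sq_le_mul_outQuad ch n κ (i := i) (by omega)
    obtain ⟨b, hb⟩ := exists_gain_bound ch n κ hi hK
    obtain ⟨b', hb'⟩ := exists_input_bound ch n κ hi
    refine ⟨max b b', fun θ hθ => ⟨fun j k l => ?_, fun k l => ?_⟩⟩
    · simp only [truncate, if_pos hi]
      exact (hb θ hθ j k l).trans (le_max_left _ _)
    · simp only [truncate, if_pos hi]
      refine (abs_apply_le_of_posSemidef (θ.posSemidef_KZ i) k l).trans
        (le_trans ?_ (le_max_right _ _))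
      linarith [hb' θ hθ k, hb' θ hθ l, θ.outQuad_nonneg ch i (fun j => θ.Γ i j k),
        θ.outQuad_nonneg ch i (fun j => θ.Γ i j l)]
  · exact ⟨0, fun θ _ => by simp [truncate, if_neg hi]⟩

/-- Truncated feasible strategies lie in a fixed box, compact by Tychonoff. The cost constraint is
closed, and truncation preserves the rate, so a maximum over the box is global. -/
theorem exists_isMaxOn_logDetRate (h : (feasible ch n κ).Nonempty) :
    ∃ θ ∈ feasible ch n κ, IsMaxOn (fun θ => θ.logDetRate ch n) (feasible ch n κ) θ := by
  choose b hb using exists_coords_bound ch n κ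
  let a : ((i : ℕ) → Fin i → Fin q → Fin p → ℝ) × (ℕ → Fin q → Fin q → ℝ) :=
    (fun i _ _ _ => b i, fun i _ _ => b i)
  have hmem : ∀ θ ∈ feasible ch n κ, θ.truncate n ∈ coords ⁻¹' Set.Icc (-a) a := fun θ hθ =>
    ⟨⟨fun i j k l => (abs_le.1 ((hb i θ hθ).1 j k l)).1,
      fun i k l => (abs_le.1 ((hb i θ hθ).2 k l)).1⟩,
      ⟨fun i j k l => (abs_le.1 ((hb i θ hθ).1 j k l)).2,
      fun i k l => (abs_le.1 ((hb i θ hθ).2 k l)).2⟩⟩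
  have hcomp : IsCompact (coords ⁻¹' Set.Icc (-a) a ∩ feasible ch n κ) :=
    (isClosedEmbedding_coords.isCompact_preimage isCompact_Icc).inter_right
      (isClosed_le (continuous_avgCost ch n) continuous_const)
  obtain ⟨θ₀, hθ₀⟩ := h
  obtain ⟨θ, hθ, hmax⟩ := hcomp.exists_isMaxOn ⟨_, hmem θ₀ hθ₀, truncate_mem_feasible hθ₀⟩
    (continuous_logDetRate ch n).continuousOn
  refine ⟨θ, hθ.2, fun θ' hθ' => ?_⟩
  have := hmax ⟨hmem θ' hθ', truncate_mem_feasible hθ'⟩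
  simpa only [Set.mem_ofPred_eq, logDetRate_truncate] using this

end LinearStrategy

/-! ### Capacity formulas and optimal input distributions. -/

namespace LinearStrategy

theorem outputOnly_policy (θ : LinearStrategy p q) : θ.policy.OutputOnly := by
  intro i h h' hh
  simp only [policy_kernel_eq_addNoise]
  rw [addNoise_apply (by fun_prop), addNoise_apply (by fun_prop), hh]

variable {ch : GaussianChannel p q} {n : ℕ} {κ : ℝ≥0}

theorem policy_mem_gaussianFeasible {θ : LinearStrategy p q} (hθ : θ ∈ feasible ch n κ) :
    θ.policy ∈ ch.gaussianFeasible n κ :=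
  ⟨hθ, θ.outputOnly_policy, θ.isGaussian_jointLaw ch (n + 1)⟩

end LinearStrategy

namespace GaussianChannel

variable (ch : GaussianChannel p q) (n : ℕ) (κ : ℝ≥0)

theorem capacity_eq_iSup_gaussianFeasible :
    ch.capacity n κ = ⨆ P ∈ ch.gaussianFeasible n κ,
      ((diffEntropy (ch.outputLaw P n) - diffEntropy (ch.noiseLaw n) : ℝ) : EReal) := by
  rw [capacity_eq_iSup_logDetRate]
  refine le_antisymm (iSup₂_le fun θ hθ => ?_) (iSup₂_le fun P hP => ?_)
  · rw [← θ.diffEntropy_sub_noise]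
    exact le_iSup₂_of_le (f := fun P (_ : P ∈ ch.gaussianFeasible n κ) =>
      ((diffEntropy (ch.outputLaw P n) - diffEntropy (ch.noiseLaw n) : ℝ) : EReal))
      θ.policy (LinearStrategy.policy_mem_gaussianFeasible hθ) le_rfl
  · obtain ⟨θ, hθ, hm⟩ := exists_matches_of_mem_feasible hP.1
    exact le_iSup₂_of_le θ hθ (EReal.coe_le_coe_iff.2 hm.diffEntropy_sub_noise_le)

theorem exists_policy_directedInfo_eq_capacity (h : (ch.feasible n κ).Nonempty) :
    ∃ θ ∈ LinearStrategy.feasible ch n κ,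
      (ch.directedInfo θ.policy n : EReal) = ch.capacity n κ := by
  obtain ⟨P, hP⟩ := h
  obtain ⟨θ₀, hθ₀, -⟩ := exists_matches_of_mem_feasible hP
  obtain ⟨θ, hθ, hmax⟩ := LinearStrategy.exists_isMaxOn_logDetRate ch n κ ⟨θ₀, hθ₀⟩
  refine ⟨θ, hθ, ?_⟩
  rw [θ.coe_directedInfo_policy, capacity_eq_iSup_logDetRate]
  exact le_antisymm (le_iSup₂_of_le (f := fun (θ : LinearStrategy p q)
    (_ : θ ∈ LinearStrategy.feasible ch n κ) => (θ.logDetRate ch n : EReal)) θ hθ le_rfl)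
    (iSup₂_le fun θ' hθ' => EReal.coe_le_coe_iff.2 (hmax hθ'))

/-- The matched strategy does at least as well as P and, being feasible, no better than the
capacity; equality of rates then forces equality of output laws. -/
theorem exists_policy_of_optimal {P : InputPolicy p q} (hP : P ∈ ch.feasible n κ)
    (hopt : (ch.directedInfo P n : EReal) = ch.capacity n κ) :
    ∃ θ ∈ LinearStrategy.feasible ch n κ,
      (ch.directedInfo θ.policy n : EReal) = ch.capacity n κ ∧
      ch.outputLaw P n = ch.outputLaw θ.policy n := by
  obtain ⟨θ, hθ, hm⟩ := exists_matches_of_mem_feasible hP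
  have hle : (ch.directedInfo θ.policy n : EReal) ≤ ch.directedInfo P n := by
    rw [hopt]
    exact le_iSup₂_of_le (f := fun P (_ : P ∈ ch.feasible n κ) => (ch.directedInfo P n : EReal))
      θ.policy hθ le_rfl
  refine ⟨θ, hθ, le_antisymm (hle.trans_eq hopt) ?_,
    hm.outputLaw_eq (EReal.coe_ennreal_le_coe_ennreal_iff.1 hle)⟩
  rw [← hopt]
  exact EReal.coe_ennreal_le_coe_ennreal_iff.2 hm.directedInfo_le

end GaussianChannel

end FeedbackCapacity

theorem theorem4 {p q : ℕ} (ch : GaussianChannel p q) (n : ℕ) (κ : ℝ≥0) :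
    -- the entropies of the noise and of the output under Gaussian inputs are well defined, and
    -- the capacity is attained, in the supremum, by Gaussian input distributions
    (HasDiffEntropy (ch.noiseLaw n) ∧
      (∀ P ∈ ch.gaussianFeasible n κ, HasDiffEntropy (ch.outputLaw P n)) ∧
      ch.capacity n κ = ⨆ P ∈ ch.gaussianFeasible n κ,
        ((diffEntropy (ch.outputLaw P n) -
          diffEntropy (ch.noiseLaw n) : ℝ) : EReal)) ∧
    -- if the constraint can be met, some linear Gaussian strategy is optimal
    ((ch.feasible n κ).Nonempty →
      ∃ θ ∈ LinearStrategy.feasible ch n κ,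
        (ch.directedInfo θ.policy n : EReal) = ch.capacity n κ) ∧
    -- every optimal input distribution is, as far as it acts on the channel, linear Gaussian
    (∀ P ∈ ch.feasible n κ, (ch.directedInfo P n : EReal) = ch.capacity n κ →
      ∃ θ ∈ LinearStrategy.feasible ch n κ,
        (ch.directedInfo θ.policy n : EReal) = ch.capacity n κ ∧
        ch.outputLaw P n = ch.outputLaw θ.policy n ∧
        ∀ i : Fin (n + 1),
          (ch.jointLaw P (n + 1)).map (fun ω => (outputsBefore i ω,
              mulVecE (ch.D i) (inputAt i ω))) =
            (ch.jointLaw θ.policy (n + 1)).map (fun ω => (outputsBefore i ω,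
              mulVecE (ch.D i) (inputAt i ω)))) ∧
    -- the capacity as a supremum over the pairs `(Γ, K_Z)`
    (ch.capacity n κ = ⨆ θ ∈ LinearStrategy.feasible ch n κ,
        ((diffEntropy (ch.outputLaw θ.policy n) -
          diffEntropy (ch.noiseLaw n) : ℝ) : EReal)) ∧
    (ch.capacity n κ = ⨆ θ ∈ LinearStrategy.feasible ch n κ,
        (θ.logDetRate ch n : EReal)) ∧
    -- properties of every linear Gaussian strategy
    (∀ θ : LinearStrategy p q,
      θ.policy.OutputOnly ∧ IsGaussian (ch.jointLaw θ.policy (n + 1)) ∧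
      HasDiffEntropy (ch.outputLaw θ.policy n) ∧
      (∀ i : Fin (n + 1), HasCondDiffEntropy (ch.jointLaw θ.policy (n + 1))
        (outputAt i) (outputsBefore i)) ∧
      diffEntropy (ch.outputLaw θ.policy n) -
          diffEntropy (ch.noiseLaw n) =
        (∑ i : Fin (n + 1), condDiffEntropy (ch.jointLaw θ.policy (n + 1))
          (outputAt i) (outputsBefore i)) -
          diffEntropy (ch.noiseLaw n) ∧
      diffEntropy (ch.outputLaw θ.policy n) -
          diffEntropy (ch.noiseLaw n) = θ.logDetRate ch n ∧
      ch.directedInfo θ.policy n = ENNReal.ofReal (θ.logDetRate ch n) ∧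
      ∃ (Ω : Type) (_ : MeasurableSpace Ω) (μ : Measure Ω)
        (Z A : Fin (n + 1) → Ω → Vec q)
        (V B : Fin (n + 1) → Ω → Vec p),
        θ.IsRealization ch n μ Z A V B ∧
        μ.map (fun ω i => (A i ω, B i ω)) = ch.jointLaw θ.policy (n + 1)) := by
  refine ⟨⟨(ch.noiseLaw_entropy n).1, fun P hP => ?_, ch.capacity_eq_iSup_gaussianFeasible n κ⟩,
    ch.exists_policy_directedInfo_eq_capacity n κ, fun P hP hopt => ?_, ?_,
    ch.capacity_eq_iSup_logDetRate n κ, fun θ => ?_⟩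
  · obtain ⟨θ, -, hm⟩ := GaussianChannel.exists_matches_of_mem_feasible hP.1
    exact hm.hasDiffEntropy.1
  · obtain ⟨θ, hθ, hcap, hout⟩ := ch.exists_policy_of_optimal n κ hP hopt
    exact ⟨θ, hθ, hcap, hout, fun i => ch.map_mulVecE_eq_of_outputLaw_eq hout i⟩
  · simp only [LinearStrategy.diffEntropy_sub_noise]
    exact ch.capacity_eq_iSup_logDetRate n κ
  · refine ⟨θ.outputOnly_policy, θ.isGaussian_jointLaw ch (n + 1),
      (θ.hasDiffEntropy_policy ch n).1, fun i => (θ.condDiffEntropy_policy ch i).1, ?_,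
      θ.diffEntropy_sub_noise ch n, θ.directedInfo_policy ch n,
      Path p q (n + 1), inferInstance, ch.jointLaw θ.policy (n + 1), fun i => θ.innovation i,
      fun i => inputAt i, fun i => ch.noise i, fun i => outputAt i, θ.isRealization ch n,
      Measure.map_id⟩
    congr 1
    rw [(θ.hasDiffEntropy_policy ch n).2, Finset.sum_range]
    exact Finset.sum_congr rfl fun i _ => (θ.condDiffEntropy_policy ch i).2.symm
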